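/- Let $n$ be an even non-negative integer and let $\frac12 \le p \le 1$. For a partition $\lambda$ of $n$ let $\chi_\lambda$ be the character of the irreducible representation of the symmetric group $S_n$ indexed by $\lambda$ (so that $\lambda=[n]$ indexes the trivial representation), let $d_\lambda$ be its dimension, and write $\chi_\lambda(1^{n-2s},2^s)$ for the value of $\chi_\lambda$ at a product of $s$ disjoint transpositions. Let \[ \psi_\lambda \;=\; \sum_{s=0}^{n/2} p^{\,n/2-s}(1-p)^s \binom{n/2}{s}\, \frac{\chi_\lambda(1^{n-2s},2^s)}{d_\lambda} \] be the eigenvalue at $\lambda$ of the random walk on $S_n$ whose steps are obtained by choosing a uniformly random fixed-point-free involution and discarding each of its $2$-cycles independently with probability $p$. Let $\lambda_1$ be the first (largest) part of $\lambda$ and $\lambda_1'$ its number of parts. Then for every partition $\lambda$ of $n$ with $\lambda_1' \le \lambda_1 < \frac n2$, \[ \psi_\lambda \;\le\; \psi_{[n/2,\,n/2]} . \] -/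

import Mathlib

noncomputable section

namespace InvolutionWalk

/-- A filling of the Young diagram `μ` (English convention: cell `(i, j)` is in row `i` and
column `j`) by the numbers `0, …, n - 1`, each used once. -/
abbrev Filling (n : ℕ) (μ : YoungDiagram) : Type := Fin n ≃ {c : ℕ × ℕ // c ∈ μ.cells}

/-- The permutations that map every entry of the filling to an entry of the same row. -/
def rowGroup {n : ℕ} {μ : YoungDiagram} (T : Filling n μ) : Subgroup (Equiv.Perm (Fin n)) where
  carrier := {σ | ∀ i, (T (σ i)).1.1 = (T i).1.1}
  mul_mem' := by
    intro a b ha hb i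
    exact (ha (b i)).trans (hb i)
  one_mem' := by
    intro i
    rfl
  inv_mem' := by
    intro a ha i
    have h := ha (a⁻¹ i)
    rw [← Equiv.Perm.mul_apply, mul_inv_cancel, Equiv.Perm.one_apply] at h
    exact h.symm

/-- The permutations that map every entry of the filling to an entry of the same column. -/
def colGroup {n : ℕ} {μ : YoungDiagram} (T : Filling n μ) : Subgroup (Equiv.Perm (Fin n)) where
  carrier := {σ | ∀ i, (T (σ i)).1.2 = (T i).1.2}
  mul_mem' := by
    intro a b ha hb i
    exact (ha (b i)).trans (hb i)
  one_mem' := by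
    intro i
    rfl
  inv_mem' := by
    intro a ha i
    have h := ha (a⁻¹ i)
    rw [← Equiv.Perm.mul_apply, mul_inv_cancel, Equiv.Perm.one_apply] at h
    exact h.symm

open Classical in
/-- The Young symmetrizer `(∑ r) * (∑ sgn(q) q)`, over the row group and the column group of the
filling, in the group algebra of the symmetric group. -/
def youngSymmetrizer {n : ℕ} {μ : YoungDiagram} (T : Filling n μ) :
    MonoidAlgebra ℝ (Equiv.Perm (Fin n)) :=
  (∑ r : rowGroup T, MonoidAlgebra.single (r : Equiv.Perm (Fin n)) (1 : ℝ)) *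
    ∑ q : colGroup T, MonoidAlgebra.single (q : Equiv.Perm (Fin n))
      (((Equiv.Perm.sign (q : Equiv.Perm (Fin n)) : ℤˣ) : ℤ) : ℝ)

/-- The Specht module of the filling: the left ideal of the group algebra generated by the Young
symmetrizer. -/
abbrev spechtModule {n : ℕ} {μ : YoungDiagram} (T : Filling n μ) :
    Ideal (MonoidAlgebra ℝ (Equiv.Perm (Fin n))) :=
  Ideal.span {youngSymmetrizer T}

/-- The symmetric group acting on the Specht module by left multiplication. -/
def spechtRep {n : ℕ} {μ : YoungDiagram} (T : Filling n μ) :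
    Representation ℝ (Equiv.Perm (Fin n)) (spechtModule T) :=
  Representation.ofModule' (spechtModule T)

/-- A fixed filling of `μ`; a different choice gives an isomorphic representation. -/
def filling (μ : YoungDiagram) : Filling μ.card μ := μ.cells.equivFin.symm

/-- The irreducible representation of the symmetric group indexed by `μ`. It is absolutely
irreducible, so that its character and dimension are those of the complex irreducible
representation indexed by `μ`. -/
def irrep (μ : YoungDiagram) :
    Representation ℝ (Equiv.Perm (Fin μ.card)) (spechtModule (filling μ)) :=
  spechtRep (filling μ)

/-- The irreducible character `χ_μ`. -/
def chi (μ : YoungDiagram) (σ : Equiv.Perm (Fin μ.card)) : ℝ := (irrep μ).character σ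

/-- The dimension `d_μ` of the irreducible representation indexed by `μ`. -/
def dimIrrep (μ : YoungDiagram) : ℕ := Module.finrank ℝ (spechtModule (filling μ))

/-- The involution `(0 1)(2 3)⋯(2s-2 2s-1)` on `n` letters (for `2 * s ≤ n`), of cycle type
`(1^(n-2s), 2^s)`. -/
def involution (n : ℕ) : ℕ → Equiv.Perm (Fin n)
  | 0 => 1
  | s + 1 =>
    if h : 2 * s + 1 < n then
      Equiv.swap ⟨2 * s, by omega⟩ ⟨2 * s + 1, h⟩ * involution n s
    else involution n s

theorem involution_apply_of_le (n s : ℕ) (i : Fin n) (hi : 2 * s ≤ (i : ℕ)) :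
    involution n s i = i := by
  induction s with
  | zero => rfl
  | succ s ih =>
    have h1 := ih (by omega)
    rw [involution]
    split_ifs with h
    · rw [Equiv.Perm.mul_apply, h1]
      apply Equiv.swap_apply_of_ne_of_ne
      · intro h2
        have := congrArg Fin.val h2
        simp only at this
        omega
      · intro h2
        have := congrArg Fin.val h2
        simp only at this
        omega
    · exact h1

/-- The cycle type (in Mathlib fixed points are not recorded) is as claimed. -/
theorem cycleType_involution (n s : ℕ) (hs : 2 * s ≤ n) :
    (involution n s).cycleType = Multiset.replicate s 2 := by
  induction s with
  | zero => simp [involution]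
  | succ s ih =>
    have h : 2 * s + 1 < n := by omega
    rw [involution, dif_pos h, Equiv.Perm.Disjoint.cycleType_mul, ih (by omega),
      Equiv.Perm.isSwap_iff_cycleType.mp]
    · rw [Multiset.replicate_succ, Multiset.singleton_add]
    · refine ⟨_, _, ?_, rfl⟩
      intro h2
      have := congrArg Fin.val h2
      simp only at this
      omega
    · intro i
      by_cases hi : 2 * s ≤ (i : ℕ)
      · exact Or.inr (involution_apply_of_le n s i hi)
      · left
        apply Equiv.swap_apply_of_ne_of_ne
        · intro h2
          have := congrArg Fin.val h2
          simp only at this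
          omega
        · intro h2
          have := congrArg Fin.val h2
          simp only at this
          omega

/-- With `n = μ.card`, the eigenvalue of the involution walk on `S_n` at the partition `μ`:
`∑_{s=0}^{n/2} p^(n/2-s) (1-p)^s (n/2 choose s) χ_μ(1^(n-2s), 2^s) / d_μ`. -/
def eigenvalue (p : ℝ) (μ : YoungDiagram) : ℝ :=
  ∑ s ∈ Finset.range (μ.card / 2 + 1),
    p ^ (μ.card / 2 - s) * (1 - p) ^ s * ((μ.card / 2).choose s : ℝ) *
      (chi μ (involution μ.card s) / (dimIrrep μ : ℝ))

/-- The partition `[m, m]`. -/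
def twoRows (m : ℕ) : YoungDiagram :=
  YoungDiagram.ofRowLens [m, m] (by simp [List.sortedGE_iff_pairwise])

theorem rowLens_twoRows (m : ℕ) (hm : 0 < m) : (twoRows m).rowLens = [m, m] :=
  YoungDiagram.rowLens_ofRowLens_eq_self (by simp [hm])

theorem card_twoRows (m : ℕ) : (twoRows m).card = 2 * m := by
  change (YoungDiagram.cellsOfRowLens [m, m]).card = 2 * m
  simp only [YoungDiagram.cellsOfRowLens, Finset.map_empty, Finset.union_empty]
  rw [Finset.card_union_of_disjoint]
  · simp only [Finset.card_map, Finset.card_product, Finset.card_singleton, Finset.card_range]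
    omega
  · rw [Finset.disjoint_left]
    rintro ⟨i, j⟩ h1 h2
    simp only [Finset.mem_product, Finset.mem_singleton, Finset.mem_map] at h1 h2
    obtain ⟨⟨a, b⟩, -, h⟩ := h2
    have h3 := congrArg Prod.fst h
    simp only [Function.Embedding.prodMap, Function.Embedding.coeFn_mk, Prod.map_fst] at h3
    omega

end InvolutionWalk

end

/-! With `n = 2m`, the theorem is a case of a bound valid for every partition `μ` of `n`
(`eigenvalue_le_psi`): the eigenvalue at `μ` is at most the eigenvalue `psi p m k` of the two-row
partition `[m + k, m - k]`, where `k` is `μ₁ - m` truncated at `0`. For `μ₁ < m` this is the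
eigenvalue of `[m, m]`.

The bound is proved by induction on `m`. By Frobenius' formula the numerator `d_μ ψ_μ` is the
coefficient of `x^(μ+ρ)` in `a_ρ (p p₁² + (1-p) p₂)^m`, with `a_ρ` the Vandermonde alternant.
Passing from `m` to `m + 1` is therefore a linear operator, `stepOp`, on alternating functions of `μ
+ ρ`, which removes two boxes. Terms that leave the dominant chamber come back with a minus sign,
but for `p ≥ 1/2` a term of weight `2p` absorbs each of them, so nonnegativity on the chamber is
preserved (`stepOp_nonneg`). Hence a bound `φ(μ₁) d_μ` at size `2m` yields at size `2m + 2` a bound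
by three terms `φ A₂ + φ A₁ + φ A₀`, where `Aᵢ` is the weighted dimension left after removing `i`
boxes from the first row (`eigFn_succ_le`).

Three estimates, all equalities for two-row partitions, control these terms. The sum `A₂ + A₁ + A₀`
is given by the content sum, that is, by the character at a transposition (`stepOp_dimFn`,
`twiceContent_le`). The term `A₀` is bounded above (`restSum_bound`) and `A₂` below
(`dimFn_sub_two_bound`). Both come from the hook length formula: for a given first row, the
dimension ratio for removing a box from it is smallest when the other boxes form a single row.
Summation by parts combines the estimates, provided that `psi p m k` is nondecreasing in `k`.

Monotonicity (`psi_le_psi_succ`) is again an induction on `m`; its boundary case `k = 0` is a growth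
bound for Motzkin-type numbers with a three-term recurrence. It fails only for `m = 2`, `k = 0`, `p
< 2/3`, so some partitions of `6` are treated separately (`eigenvalue_le_psi_three`).

Frobenius' formula itself is derived from the Specht module: its character and Frobenius' expression
both have square sum `n!` over the group, and their pairing is also `n!`, so they coincide
(`spechtChar_eq_omega`). -/

noncomputable section

open Finset

namespace InvolutionWalk

/-! ### Characters of left ideals generated by quasi-idempotents. -/

section QuasiIdempotent

theorem eq_sum_single {G : Type*} [Fintype G] (x : MonoidAlgebra ℝ G) :
    x = ∑ g, MonoidAlgebra.single g (x.coeff g) := by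
  ext g
  simp

variable {G : Type*} [Group G]

theorem coeff_mul_eq_sum [Fintype G] (x y : MonoidAlgebra ℝ G) (g : G) :
    (x * y).coeff g = ∑ h, x.coeff h * y.coeff (h⁻¹ * g) := by
  classical
  rw [MonoidAlgebra.coeff_mul]
  rw [Finsupp.sum_fintype _ _ (by simp)]
  refine Finset.sum_congr rfl fun h _ => ?_
  rw [Finsupp.sum_fintype _ _ (by simp)]
  simp [← eq_inv_mul_iff_mul_eq]

theorem coeff_single_mul_apply (x : MonoidAlgebra ℝ G) (g h : G) :
    (MonoidAlgebra.single g (1 : ℝ) * x).coeff h = x.coeff (g⁻¹ * h) := by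
  rw [MonoidAlgebra.coeff_single_mul_eq_mul_coeff (g⁻¹ * h), one_mul]
  intro a _
  rw [eq_inv_mul_iff_mul_eq]

theorem coeff_mul_single_apply (x : MonoidAlgebra ℝ G) (g h : G) :
    (x * MonoidAlgebra.single g (1 : ℝ)).coeff h = x.coeff (h * g⁻¹) := by
  rw [MonoidAlgebra.coeff_mul_single_eq_coeff_mul (h * g⁻¹), mul_one]
  intro a _
  rw [eq_mul_inv_iff_mul_eq]

/-- The map `x ↦ g x c` of the group algebra. -/
def sandwich (g : G) (c : MonoidAlgebra ℝ G) : MonoidAlgebra ℝ G →ₗ[ℝ] MonoidAlgebra ℝ G :=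
  LinearMap.mulLeft ℝ (MonoidAlgebra.single g (1 : ℝ)) ∘ₗ LinearMap.mulRight ℝ c

/-- In the basis of group elements, the diagonal entry at `h` is the coefficient of `h` in `g h c`.
-/
theorem trace_sandwich [Fintype G] (g : G) (c : MonoidAlgebra ℝ G) :
    LinearMap.trace ℝ (MonoidAlgebra ℝ G) (sandwich g c) = ∑ h, c.coeff (h⁻¹ * g⁻¹ * h) := by
  classical
  rw [LinearMap.trace_eq_matrix_trace ℝ (MonoidAlgebra.basis G ℝ), Matrix.trace]
  refine Finset.sum_congr rfl fun h _ => ?_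
  rw [Matrix.diag_apply, LinearMap.toMatrix_apply]
  simp only [sandwich, LinearMap.comp_apply, LinearMap.mulLeft_apply, LinearMap.mulRight_apply]
  change (MonoidAlgebra.single g (1 : ℝ) * (MonoidAlgebra.single h (1 : ℝ) * c)).coeff h = _
  rw [coeff_single_mul_apply, coeff_single_mul_apply, mul_assoc]

variable [Fintype G] {c : MonoidAlgebra ℝ G}

/-- Right multiplication by `κ⁻¹ c` projects the group algebra onto the ideal, so by cyclicity the
trace of `g` on the ideal is that of `x ↦ κ⁻¹ g x c` on the whole algebra. -/
theorem character_span_quasiIdempotent {κ : ℝ} (hκ : κ ≠ 0) (hc : c * c = κ • c) (g : G) :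
    (Representation.ofModule' (Ideal.span {c} : Ideal (MonoidAlgebra ℝ G)) :
      Representation ℝ G _).character g = κ⁻¹ * ∑ h, c.coeff (h⁻¹ * g⁻¹ * h) := by
  rw [← trace_sandwich, Representation.character]
  set S : Ideal (MonoidAlgebra ℝ G) := Ideal.span {c} with hS
  let incl : S →ₗ[ℝ] MonoidAlgebra ℝ G := (S.subtype).restrictScalars ℝ
  have hmem : ∀ x : MonoidAlgebra ℝ G, κ⁻¹ • (x * c) ∈ S := by
    intro x
    rw [← smul_mul_assoc]
    exact Ideal.mul_mem_left _ _ (Ideal.subset_span rfl)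
  let E : MonoidAlgebra ℝ G →ₗ[ℝ] S :=
    { toFun := fun x => ⟨κ⁻¹ • (x * c), hmem x⟩
      map_add' := by
        intro x y
        ext1
        simp [add_mul]
      map_smul' := by
        intro r x
        ext1
        simp [smul_comm r] }
  have hE : ∀ x : S, E (incl x) = x := by
    rintro ⟨x, hx⟩
    obtain ⟨y, rfl⟩ := Ideal.mem_span_singleton'.mp hx
    ext1
    change κ⁻¹ • (y * c * c) = y * c
    rw [mul_assoc, hc, mul_smul_comm, smul_smul, inv_mul_cancel₀ hκ, one_smul]
  let Lg := LinearMap.mulLeft ℝ (MonoidAlgebra.single g (1 : ℝ))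
  have h1 : (Representation.ofModule' S : Representation ℝ G _) g = E ∘ₗ (Lg ∘ₗ incl) := by
    refine LinearMap.ext fun x => ?_
    rw [← hE ((Representation.ofModule' S : Representation ℝ G _) g x)]
    rw [LinearMap.comp_apply]
    congr 1
  rw [h1, LinearMap.trace_comp_comm']
  have h2 : (Lg ∘ₗ incl) ∘ₗ E = κ⁻¹ • sandwich g c := by
    refine LinearMap.ext fun x => ?_
    change MonoidAlgebra.single g (1 : ℝ) * (κ⁻¹ • (x * c)) =
      κ⁻¹ • (MonoidAlgebra.single g (1 : ℝ) * (x * c))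
    rw [mul_smul_comm]
  rw [h2, map_smul, smul_eq_mul]

/-- If `κ` were `0`, right multiplication by `c` would be nilpotent and hence traceless, whereas its
trace is `|G|` times the coefficient of `c` at `1`. -/
theorem quasiIdempotent_ne_zero {κ : ℝ} (h1 : c.coeff 1 = 1) (hc : c * c = κ • c) : κ ≠ 0 := by
  rintro rfl
  have hnil : IsNilpotent (sandwich 1 c) := by
    refine ⟨2, ?_⟩
    refine LinearMap.ext fun x => ?_
    simp only [pow_two, Module.End.mul_apply, sandwich, LinearMap.comp_apply,
      LinearMap.mulLeft_apply, LinearMap.mulRight_apply, ← MonoidAlgebra.one_def, one_mul]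
    rw [mul_assoc, hc]
    simp
  have h2 := LinearMap.isNilpotent_trace_of_isNilpotent hnil
  rw [trace_sandwich] at h2
  simp [h1] at h2

/-- Average over the conjugates: the sum over `g` of `∑ h, c (h⁻¹ g⁻¹ h)` against a class
function. -/
theorem sum_conj_mul_classFunction (θ : G → ℝ) (hθ : ∀ g h, θ (h * g * h⁻¹) = θ g)
    (hinv : ∀ g, θ g⁻¹ = θ g) :
    ∑ g, (∑ h, c.coeff (h⁻¹ * g⁻¹ * h)) * θ g = Fintype.card G * ∑ g, c.coeff g * θ g := by
  simp_rw [Finset.sum_mul]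
  rw [Finset.sum_comm, ← Finset.card_univ, ← nsmul_eq_mul, ← Finset.sum_const]
  refine Finset.sum_congr rfl fun h _ => ?_
  let e : G ≃ G := (Equiv.inv G).trans (MulAut.conj h⁻¹).toEquiv
  rw [← Equiv.sum_comp e (fun g => c.coeff g * θ g)]
  refine Finset.sum_congr rfl fun g _ => ?_
  have : e g = h⁻¹ * g⁻¹ * h := by simp [e]
  rw [this]
  congr 1
  have h3 := hθ g⁻¹ h⁻¹
  rw [inv_inv] at h3
  rw [h3, hinv]

/-- For fixed `h` the sum over `g` is the coefficient of `c h c` at `h`. As `c h c` is a multiple of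
`c`, this is also the coefficient at `1` of `c · (c(h) h) · c`; summing over `h` produces `c³`. It
gives the orthogonality relation for the character without Schur's lemma. -/
theorem sum_conj_mul_self
    (hcc : ∀ x : MonoidAlgebra ℝ G, c * x * c = (c * x * c).coeff 1 • c) :
    ∑ g, c.coeff g * ∑ h, c.coeff (h⁻¹ * g⁻¹ * h) = ((c * c).coeff 1) ^ 2 := by
  have h1 : ∀ h : G, ∑ g, c.coeff g * c.coeff (h⁻¹ * g⁻¹ * h) =
      (c * MonoidAlgebra.single h (1 : ℝ) * c).coeff h := by
    intro h
    rw [mul_assoc, coeff_mul_eq_sum]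
    refine Finset.sum_congr rfl fun g _ => ?_
    rw [coeff_single_mul_apply, mul_assoc]
  simp_rw [Finset.mul_sum]
  rw [Finset.sum_comm]
  simp_rw [h1]
  have h2 : ∀ h : G, (c * MonoidAlgebra.single h (1 : ℝ) * c).coeff h =
      (c * MonoidAlgebra.single h (c.coeff h) * c).coeff 1 := by
    intro h
    have h3 : MonoidAlgebra.single h (c.coeff h) = c.coeff h • MonoidAlgebra.single h (1 : ℝ) := by
      rw [MonoidAlgebra.smul_single, smul_eq_mul, mul_one]
    conv_lhs => rw [hcc]
    rw [h3, mul_smul_comm, smul_mul_assoc, MonoidAlgebra.coeff_smul_apply,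
      MonoidAlgebra.coeff_smul_apply, smul_eq_mul, smul_eq_mul, mul_comm]
  simp_rw [h2]
  rw [← Finsupp.finsetSum_apply, ← MonoidAlgebra.coeff_sum, ← Finset.sum_mul, ← Finset.mul_sum,
    ← eq_sum_single]
  have h4 : c * c = (c * c).coeff 1 • c := by simpa using hcc 1
  conv_lhs => rw [h4]
  rw [smul_mul_assoc, MonoidAlgebra.coeff_smul_apply, smul_eq_mul, pow_two]

end QuasiIdempotent

end InvolutionWalk

end

noncomputable section

open Finset

namespace InvolutionWalk

/-! ### The Young symmetrizer and the character of the Specht module. -/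

section YoungSymmetrizer

variable {n : ℕ} {μ : YoungDiagram} (T : Filling n μ)

theorem cell_mem (x : Fin n) : ((T x).1.1, (T x).1.2) ∈ μ := (T x).2

theorem filling_ext {x y : Fin n} (h1 : (T x).1.1 = (T y).1.1) (h2 : (T x).1.2 = (T y).1.2) :
    x = y :=
  T.injective (Subtype.ext (Prod.ext h1 h2))

/-- A function on the entries of the filling which is injective on each column. -/
def ColumnInjective {α : Type*} (f : Fin n → α) : Prop :=
  ∀ x y, (T x).1.2 = (T y).1.2 → f x = f y → x = y

theorem card_column_row_lt (i j : ℕ) :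
    #{x | (T x).1.2 = j ∧ (T x).1.1 < i} = min i (μ.colLen j) := by
  rw [← Finset.card_range (min i (μ.colLen j))]
  refine Finset.card_bij (fun x _ => (T x).1.1) ?_ ?_ ?_
  · intro x hx
    simp only [mem_filter, mem_univ, true_and] at hx
    have := YoungDiagram.mem_iff_lt_colLen.mp (cell_mem T x)
    rw [hx.1] at this
    simp [hx.2, this]
  · intro x hx y hy hxy
    simp only [mem_filter, mem_univ, true_and] at hx hy
    exact filling_ext T hxy (hx.1.trans hy.1.symm)
  · intro r hr
    simp only [mem_range, lt_min_iff] at hr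
    refine ⟨T.symm ⟨(r, j), YoungDiagram.mem_iff_lt_colLen.mpr hr.2⟩, ?_, ?_⟩ <;> simp [hr.1]

theorem card_column_lt_le {f : Fin n → ℕ} (hf : ColumnInjective T f) (i j : ℕ) :
    #{x | (T x).1.2 = j ∧ f x < i} ≤ #{x | (T x).1.2 = j ∧ (T x).1.1 < i} := by
  rw [card_column_row_lt]
  refine le_min ?_ ?_
  · conv_rhs => rw [← Finset.card_range i]
    refine Finset.card_le_card_of_injOn f ?_ ?_
    · intro x hx
      simp only [coe_filter, mem_univ, true_and, Set.mem_ofPred_eq] at hx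
      simpa using hx.2
    · intro x hx y hy hxy
      simp only [coe_filter, mem_univ, true_and, Set.mem_ofPred_eq] at hx hy
      exact hf x y (hx.1.trans hy.1.symm) hxy
  · have h := card_column_row_lt T (μ.colLen j) j
    rw [min_self] at h
    rw [← h]
    refine Finset.card_le_card ?_
    intro x hx
    simp only [mem_filter, mem_univ, true_and] at hx ⊢
    have := YoungDiagram.mem_iff_lt_colLen.mp (cell_mem T x)
    rw [hx.1] at this
    exact ⟨hx.1, this⟩

theorem card_filter_eq_sum_columns (P : Fin n → Prop) [DecidablePred P] :
    #{x | P x} = ∑ j ∈ univ.image (fun x => (T x).1.2), #{x | (T x).1.2 = j ∧ P x} := by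
  rw [Finset.card_eq_sum_card_fiberwise (f := fun x => (T x).1.2)
    (t := univ.image (fun x => (T x).1.2))]
  · refine Finset.sum_congr rfl fun j _ => ?_
    rw [Finset.filter_filter]
    simp_rw [and_comm]
  · intro x _
    simp

/-- In each column `f` takes at most as many values below `i` as the row index does, and `hdom` is
the reverse inequality summed over the columns. A value reaching the height `i` of its column would
make the inequality strict there. -/
theorem lt_colLen_of_columnInjective {f : Fin n → ℕ} (hf : ColumnInjective T f)
    (hdom : ∀ i, #{x | (T x).1.1 < i} ≤ #{x | f x < i}) (x : Fin n) :
    f x < μ.colLen (T x).1.2 := by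
  by_contra hx
  push Not at hx
  set i := μ.colLen (T x).1.2 with hi
  have h := hdom i
  rw [card_filter_eq_sum_columns T (fun x => (T x).1.1 < i),
    card_filter_eq_sum_columns T (fun x => f x < i)] at h
  refine absurd h (not_le.mpr ?_)
  refine Finset.sum_lt_sum (fun j _ => card_column_lt_le T hf i j) ⟨(T x).1.2, by simp, ?_⟩
  refine Finset.card_lt_card ((Finset.ssubset_iff_of_subset ?_).mpr ⟨x, ?_, ?_⟩)
  · intro y hy
    simp only [mem_filter, mem_univ, true_and] at hy ⊢
    have := YoungDiagram.mem_iff_lt_colLen.mp (cell_mem T y)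
    rw [hy.1] at this
    exact ⟨hy.1, this⟩
  · simp only [mem_filter, mem_univ, true_and]
    exact YoungDiagram.mem_iff_lt_colLen.mp (cell_mem T x)
  · simp only [mem_filter, mem_univ, true_and, not_lt]
    exact hx

theorem exists_colGroup_of_columnInjective {f : Fin n → ℕ} (hf : ColumnInjective T f)
    (hdom : ∀ i, #{x | (T x).1.1 < i} ≤ #{x | f x < i}) :
    ∃ u ∈ colGroup T, ∀ x, f x = (T (u x)).1.1 := by
  have hmem : ∀ x, (f x, (T x).1.2) ∈ μ.cells := fun x =>
    YoungDiagram.mem_iff_lt_colLen.mpr (lt_colLen_of_columnInjective T hf hdom x)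
  let u : Fin n → Fin n := fun x => T.symm ⟨(f x, (T x).1.2), hmem x⟩
  have hu : Function.Injective u := by
    intro x y hxy
    have h1 : (f x, (T x).1.2) = (f y, (T y).1.2) :=
      congrArg Subtype.val (T.symm.injective hxy)
    exact hf x y (Prod.ext_iff.mp h1).2 (Prod.ext_iff.mp h1).1
  refine ⟨Equiv.ofBijective u ((Fintype.bijective_iff_injective_and_card u).mpr ⟨hu, rfl⟩),
    ?_, ?_⟩
  · intro x
    simp [u]
  · intro x
    simp [u]

/-- Von Neumann's dichotomy. If `g` never sends two entries of a column into one row, then the row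
of `g x` is a column-injective function with the same distribution as the row index, hence it is the
row of `u x` for some column permutation `u`, and `g u⁻¹` preserves rows. -/
theorem eq_mul_or_exists_swap (g : Equiv.Perm (Fin n)) :
    (∃ r ∈ rowGroup T, ∃ q ∈ colGroup T, g = r * q) ∨
      ∃ x y, x ≠ y ∧ (T x).1.2 = (T y).1.2 ∧ (T (g x)).1.1 = (T (g y)).1.1 := by
  by_cases h : ColumnInjective T (fun x => (T (g x)).1.1)
  · left
    obtain ⟨u, hu, h2⟩ := exists_colGroup_of_columnInjective T h (by
      intro i
      refine le_of_eq (Finset.card_equiv g.symm ?_)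
      simp)
    refine ⟨g * u⁻¹, ?_, u, hu, by simp⟩
    intro x
    have := h2 (u⁻¹ x)
    simpa using this
  · right
    simp only [ColumnInjective] at h
    push Not at h
    obtain ⟨x, y, h1, h2, h3⟩ := h
    exact ⟨x, y, h3, h1, h2⟩

theorem swap_mem_rowGroup {x y : Fin n} (h : (T x).1.1 = (T y).1.1) :
    Equiv.swap x y ∈ rowGroup T := by
  intro z
  by_cases h1 : z = x
  · subst h1
    rw [Equiv.swap_apply_left, h]
  by_cases h2 : z = y
  · subst h2
    rw [Equiv.swap_apply_right, h]
  rw [Equiv.swap_apply_of_ne_of_ne h1 h2]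

theorem swap_mem_colGroup {x y : Fin n} (h : (T x).1.2 = (T y).1.2) :
    Equiv.swap x y ∈ colGroup T := by
  intro z
  by_cases h1 : z = x
  · subst h1
    rw [Equiv.swap_apply_left, h]
  by_cases h2 : z = y
  · subst h2
    rw [Equiv.swap_apply_right, h]
  rw [Equiv.swap_apply_of_ne_of_ne h1 h2]

/-- The sign of a permutation as a real number. -/
def rsign {α : Type*} [Fintype α] [DecidableEq α] (σ : Equiv.Perm α) : ℝ :=
  ((Equiv.Perm.sign σ : ℤˣ) : ℤ)

section rsign
variable {α : Type*} [Fintype α] [DecidableEq α]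

@[simp] theorem rsign_one : rsign (1 : Equiv.Perm α) = 1 := by simp [rsign]

theorem rsign_mul (σ τ : Equiv.Perm α) : rsign (σ * τ) = rsign σ * rsign τ := by simp [rsign]

@[simp] theorem rsign_inv (σ : Equiv.Perm α) : rsign σ⁻¹ = rsign σ := by simp [rsign]

theorem rsign_swap {x y : α} (h : x ≠ y) : rsign (Equiv.swap x y) = -1 := by
  simp [rsign, Equiv.Perm.sign_swap h]

end rsign

/-- Invariance under the row group on the left, and sign-invariance under the column group on the
right. -/
def YoungCovariant (y : Equiv.Perm (Fin n) → ℝ) : Prop :=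
  (∀ r ∈ rowGroup T, ∀ g, y (r * g) = y g) ∧ ∀ q ∈ colGroup T, ∀ g, y (g * q) = rsign q * y g

-- Covariance determines the value at a product `r q`. At any other `g` there is a transposition in
-- a column which `g` conjugates into the row group, and this forces `y g = -y g`.
variable {T} in
theorem YoungCovariant.eq_mul {y z : Equiv.Perm (Fin n) → ℝ} (hy : YoungCovariant T y)
    (hz : YoungCovariant T z) (hz1 : z 1 = 1) (g : Equiv.Perm (Fin n)) : y g = y 1 * z g := by
  rcases eq_mul_or_exists_swap T g with ⟨r, hr, q, hq, rfl⟩ | ⟨a, b, hab, hc, hr⟩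
  · have h : ∀ y : Equiv.Perm (Fin n) → ℝ, YoungCovariant T y → y (r * q) = rsign q * y 1 := by
      intro y hy
      rw [hy.1 r hr, ← hy.2 q hq, one_mul]
    rw [h y hy, h z hz, hz1, mul_one, mul_comm]
  · have h : ∀ y : Equiv.Perm (Fin n) → ℝ, YoungCovariant T y → y g = 0 := by
      intro y hy
      have h1 := hy.1 _ (swap_mem_rowGroup T hr) g
      have h2 := hy.2 _ (swap_mem_colGroup T hc) g
      rw [Equiv.mul_swap_eq_swap_mul, h1, rsign_swap hab] at h2
      linarith
    rw [h y hy, h z hz, mul_zero]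

open Classical in
theorem sum_youngSymmetrizer_mul (Φ : Equiv.Perm (Fin n) → ℝ) :
    ∑ g, (youngSymmetrizer T).coeff g * Φ g =
      ∑ q : colGroup T, ∑ r : rowGroup T,
        rsign (q : Equiv.Perm (Fin n)) * Φ ((r : Equiv.Perm (Fin n)) * q) := by
  have h : youngSymmetrizer T = ∑ q : colGroup T, ∑ r : rowGroup T,
      MonoidAlgebra.single ((r : Equiv.Perm (Fin n)) * (q : Equiv.Perm (Fin n)))
        (rsign (q : Equiv.Perm (Fin n))) := by
    rw [youngSymmetrizer, Finset.sum_mul_sum, Finset.sum_comm]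
    refine Finset.sum_congr rfl fun q _ => Finset.sum_congr rfl fun r _ => ?_
    rw [MonoidAlgebra.single_mul_single, one_mul]
    rfl
  rw [h]
  simp only [MonoidAlgebra.coeff_sum, Finsupp.finsetSum_apply, MonoidAlgebra.coeff_single,
    Finset.sum_mul]
  rw [Finset.sum_comm]
  refine Finset.sum_congr rfl fun q _ => ?_
  rw [Finset.sum_comm]
  refine Finset.sum_congr rfl fun r _ => ?_
  simp [Finsupp.single_apply]

open Classical in
theorem youngSymmetrizer_coeff (h : Equiv.Perm (Fin n)) :
    (youngSymmetrizer T).coeff h =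
      ∑ q : colGroup T, rsign (q : Equiv.Perm (Fin n)) *
        if h * (q : Equiv.Perm (Fin n))⁻¹ ∈ rowGroup T then 1 else 0 := by
  have h1 := sum_youngSymmetrizer_mul T (fun g => if g = h then 1 else 0)
  simp only [mul_ite, mul_one, mul_zero, Finset.sum_ite_eq', mem_univ, if_true] at h1
  rw [h1]
  refine Finset.sum_congr rfl fun q _ => ?_
  split_ifs with h2
  · rw [Finset.sum_eq_single (⟨_, h2⟩ : rowGroup T)]
    · simp
    · intro r _ hr
      rw [if_neg]
      rintro rfl
      exact hr (by simp)
    · simp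
  · simp only [mul_zero]
    refine Finset.sum_eq_zero fun r _ => ?_
    rw [if_neg]
    rintro rfl
    exact h2 (by simp)

theorem eq_one_of_mem_rowGroup_of_mem_colGroup {g : Equiv.Perm (Fin n)} (hr : g ∈ rowGroup T)
    (hc : g ∈ colGroup T) : g = 1 :=
  Equiv.ext fun x => filling_ext T (hr x) (hc x)

theorem youngSymmetrizer_coeff_one : (youngSymmetrizer T).coeff 1 = 1 := by
  classical
  rw [youngSymmetrizer_coeff, Finset.sum_eq_single (1 : colGroup T)]
  · simp [one_mem]
  · intro q _ hq
    rw [if_neg, mul_zero]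
    intro h
    refine hq (Subtype.ext ?_)
    have := eq_one_of_mem_rowGroup_of_mem_colGroup T (g := (q : Equiv.Perm (Fin n))⁻¹)
      (by simpa using h) (inv_mem q.2)
    simpa using this
  · simp

theorem youngCovariant_youngSymmetrizer :
    YoungCovariant T (fun g => (youngSymmetrizer T).coeff g) := by
  classical
  constructor
  · intro r hr g
    simp only [youngSymmetrizer_coeff]
    refine Finset.sum_congr rfl fun q _ => ?_
    rw [mul_assoc, Subgroup.mul_mem_cancel_left _ hr]
  · intro q hq g
    simp only [youngSymmetrizer_coeff]
    rw [← Equiv.sum_comp (Equiv.mulRight (⟨q, hq⟩ : colGroup T)), Finset.mul_sum]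
    refine Finset.sum_congr rfl fun q' _ => ?_
    simp only [Equiv.coe_mulRight, Subgroup.coe_mul, rsign_mul, mul_inv_rev]
    rw [mul_assoc g q, ← mul_assoc q, mul_inv_cancel, one_mul]
    ring

theorem youngCovariant_mul (x : MonoidAlgebra ℝ (Equiv.Perm (Fin n))) :
    YoungCovariant T (fun g => (youngSymmetrizer T * x * youngSymmetrizer T).coeff g) := by
  have h := youngCovariant_youngSymmetrizer T
  constructor
  · intro r hr g
    have h1 : MonoidAlgebra.single r⁻¹ (1 : ℝ) * youngSymmetrizer T = youngSymmetrizer T := by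
      ext g
      rw [coeff_single_mul_apply, inv_inv]
      exact h.1 r hr g
    beta_reduce
    conv_rhs => rw [mul_assoc, ← h1, mul_assoc, coeff_single_mul_apply, inv_inv, ← mul_assoc]
    rw [h1]
  · intro q hq g
    have h1 : youngSymmetrizer T * MonoidAlgebra.single q⁻¹ (1 : ℝ) =
        rsign q • youngSymmetrizer T := by
      ext g
      rw [coeff_mul_single_apply, inv_inv]
      exact h.2 q hq g
    have h2 := congrArg (fun z => (youngSymmetrizer T * x * z).coeff g) h1
    simp only [mul_smul_comm, MonoidAlgebra.coeff_smul_apply, smul_eq_mul] at h2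
    rw [← h2, ← mul_assoc, coeff_mul_single_apply, inv_inv]

/-- The product `c x c` inherits both covariances of `c`, and covariant functions form a line. -/
theorem youngSymmetrizer_mul_mul (x : MonoidAlgebra ℝ (Equiv.Perm (Fin n))) :
    youngSymmetrizer T * x * youngSymmetrizer T =
      (youngSymmetrizer T * x * youngSymmetrizer T).coeff 1 • youngSymmetrizer T := by
  ext g
  exact (youngCovariant_mul T x).eq_mul (youngCovariant_youngSymmetrizer T)
    (youngSymmetrizer_coeff_one T) g

/-- The scalar `κ` with `c * c = κ c` for the Young symmetrizer `c`. -/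
def hookScalar : ℝ := (youngSymmetrizer T * youngSymmetrizer T).coeff 1

theorem youngSymmetrizer_mul_self :
    youngSymmetrizer T * youngSymmetrizer T = hookScalar T • youngSymmetrizer T := by
  have h := youngSymmetrizer_mul_mul T 1
  rwa [mul_one] at h

theorem hookScalar_ne_zero : hookScalar T ≠ 0 :=
  quasiIdempotent_ne_zero (youngSymmetrizer_coeff_one T) (youngSymmetrizer_mul_self T)

-- The triple sum is written in the form in which it reappears when the symmetrizer is paired with
-- fixed functions in `sum_youngSymmetrizer_mul_fixed`.
open Classical in
theorem hookScalar_eq :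
    hookScalar T = ∑ u : colGroup T, ∑ q : colGroup T, ∑ r : rowGroup T,
      rsign (q : Equiv.Perm (Fin n)) * (rsign (u : Equiv.Perm (Fin n)) *
        if (u : Equiv.Perm (Fin n)) * (r * q) ∈ rowGroup T then 1 else 0) := by
  rw [hookScalar, coeff_mul_eq_sum]
  rw [sum_youngSymmetrizer_mul T (fun h => (youngSymmetrizer T).coeff (h⁻¹ * 1))]
  conv_rhs => rw [Finset.sum_comm]
  refine Finset.sum_congr rfl fun q _ => ?_
  conv_rhs => rw [Finset.sum_comm]
  refine Finset.sum_congr rfl fun r _ => ?_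
  rw [youngSymmetrizer_coeff, Finset.mul_sum]
  refine Finset.sum_congr rfl fun u _ => ?_
  congr 3
  rw [← inv_mem_iff]
  simp

/-- The character of the Specht module of the filling. -/
def spechtChar (g : Equiv.Perm (Fin n)) : ℝ := (spechtRep T).character g

theorem spechtChar_eq (g : Equiv.Perm (Fin n)) :
    spechtChar T g = (hookScalar T)⁻¹ * ∑ h, (youngSymmetrizer T).coeff (h⁻¹ * g⁻¹ * h) :=
  character_span_quasiIdempotent (hookScalar_ne_zero T) (youngSymmetrizer_mul_self T) g

theorem spechtChar_conj (g h : Equiv.Perm (Fin n)) :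
    spechtChar T (h * g * h⁻¹) = spechtChar T g :=
  Representation.char_conj _ g h

-- The inverse of `r q` is `q⁻¹ r⁻¹`, a conjugate of `r⁻¹ q⁻¹`, and inversion preserves signs.
open Classical in
theorem spechtChar_inv (g : Equiv.Perm (Fin n)) : spechtChar T g⁻¹ = spechtChar T g := by
  have key : ∀ g : Equiv.Perm (Fin n), ∑ h, (youngSymmetrizer T).coeff (h⁻¹ * g * h) =
      ∑ q : colGroup T, ∑ r : rowGroup T, rsign (q : Equiv.Perm (Fin n)) *
        ∑ h : Equiv.Perm (Fin n), if (r : Equiv.Perm (Fin n)) * q = h⁻¹ * g * h then 1 else 0 := by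
    intro g
    have h1 : ∀ h : Equiv.Perm (Fin n), (youngSymmetrizer T).coeff (h⁻¹ * g * h) =
        ∑ q : colGroup T, ∑ r : rowGroup T, rsign (q : Equiv.Perm (Fin n)) *
          if (r : Equiv.Perm (Fin n)) * q = h⁻¹ * g * h then 1 else 0 := by
      intro h
      have := sum_youngSymmetrizer_mul T (fun k => if k = h⁻¹ * g * h then 1 else 0)
      rw [← this]
      simp
    simp_rw [h1, Finset.mul_sum]
    rw [Finset.sum_comm]
    refine Finset.sum_congr rfl fun q _ => ?_
    rw [Finset.sum_comm]
  rw [spechtChar_eq, spechtChar_eq, inv_inv, key, key]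
  congr 1
  rw [← Equiv.sum_comp (Equiv.inv (colGroup T))]
  refine Finset.sum_congr rfl fun q _ => ?_
  rw [← Equiv.sum_comp (Equiv.inv (rowGroup T))]
  refine Finset.sum_congr rfl fun r _ => ?_
  simp only [Equiv.inv_apply, Subgroup.coe_inv, rsign_inv]
  congr 1
  rw [← Equiv.sum_comp (Equiv.mulRight (r : Equiv.Perm (Fin n)))]
  refine Finset.sum_congr rfl fun h _ => if_congr ?_ rfl rfl
  simp only [Equiv.coe_mulRight, mul_inv_rev]
  constructor
  · intro h2
    have h3 := congrArg (fun z => (r : Equiv.Perm (Fin n)) * z⁻¹ * (r : Equiv.Perm (Fin n))⁻¹) h2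
    simp only [mul_inv_rev, inv_inv] at h3
    simpa [mul_assoc] using h3
  · intro h2
    rw [← inv_inj]
    have h3 := congrArg (fun z => (r : Equiv.Perm (Fin n))⁻¹ * z * (r : Equiv.Perm (Fin n))) h2
    simpa [mul_assoc] using h3

theorem sum_spechtChar_mul_classFunction (θ : Equiv.Perm (Fin n) → ℝ)
    (hθ : ∀ g h, θ (h * g * h⁻¹) = θ g) (hinv : ∀ g, θ g⁻¹ = θ g) :
    ∑ g, spechtChar T g * θ g =
      (hookScalar T)⁻¹ * (n.factorial * ∑ g, (youngSymmetrizer T).coeff g * θ g) := by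
  simp_rw [spechtChar_eq]
  simp_rw [mul_assoc (hookScalar T)⁻¹, ← Finset.mul_sum]
  rw [sum_conj_mul_classFunction θ hθ hinv, Fintype.card_perm, Fintype.card_fin]

theorem sum_spechtChar_mul_self : ∑ g, spechtChar T g * spechtChar T g = n.factorial := by
  rw [sum_spechtChar_mul_classFunction T _ (spechtChar_conj T) (spechtChar_inv T)]
  have h := sum_conj_mul_self (youngSymmetrizer_mul_mul T)
  have h2 : ∑ g, (youngSymmetrizer T).coeff g * spechtChar T g =
      (hookScalar T)⁻¹ * hookScalar T ^ 2 := by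
    rw [hookScalar, ← h, Finset.mul_sum, ← hookScalar]
    refine Finset.sum_congr rfl fun g _ => ?_
    rw [spechtChar_eq]
    ring
  rw [h2]
  have := hookScalar_ne_zero T
  field_simp

/-- Pairing the Young symmetrizer with the `θ`-weighted count of the functions fixed by a
permutation, when among column-injective functions `θ` is the indicator of the functions obtained
from the row index by a column permutation. -/
theorem sum_youngSymmetrizer_mul_fixed {N : ℕ} (θ : (Fin n → Fin N) → ℝ)
    (hθ1 : ∀ (f : Fin n → Fin N), ∀ u ∈ colGroup T, (∀ x, (f x : ℕ) = (T (u x)).1.1) → θ f = 1)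
    (hθ2 : ∀ f : Fin n → Fin N, ColumnInjective T f → θ f ≠ 0 →
      ∃ u ∈ colGroup T, ∀ x, (f x : ℕ) = (T (u x)).1.1)
    (hN : ∀ x, (T x).1.1 < N) :
    ∑ g, (youngSymmetrizer T).coeff g * ∑ f : Fin n → Fin N with f ∘ g = f, θ f =
      hookScalar T := by
  classical
  simp_rw [Finset.sum_filter, Finset.mul_sum]
  rw [Finset.sum_comm]
  let S : (Fin n → Fin N) → ℝ := fun f =>
    ∑ g, (youngSymmetrizer T).coeff g * if f ∘ g = f then 1 else 0
  have hS : ∀ f, (∑ g : Equiv.Perm (Fin n), (youngSymmetrizer T).coeff g *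
      if f ∘ g = f then θ f else 0) = θ f * S f := by
    intro f
    rw [Finset.mul_sum]
    refine Finset.sum_congr rfl fun g _ => ?_
    split_ifs <;> ring
  simp_rw [hS]
  -- If `f` agrees at two entries of a column, right multiplication of `g` by their transposition
  -- changes the sign of the coefficient and keeps the condition `f ∘ g = f`.
  have hS0 : ∀ f, ¬ ColumnInjective T f → S f = 0 := by
    intro f hf
    simp only [ColumnInjective] at hf
    push Not at hf
    obtain ⟨x, y, hc, hfxy, hne⟩ := hf
    have hs := swap_mem_colGroup T hc
    have hfs : f ∘ Equiv.swap x y = f := by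
      ext1 z
      simp only [Function.comp_apply]
      by_cases h1 : z = x
      · subst h1
        rw [Equiv.swap_apply_left, hfxy]
      by_cases h2 : z = y
      · subst h2
        rw [Equiv.swap_apply_right, hfxy]
      rw [Equiv.swap_apply_of_ne_of_ne h1 h2]
    have h3 : S f = -S f := by
      conv_lhs => simp only [S]
      rw [← Equiv.sum_comp (Equiv.mulRight (Equiv.swap x y)), ← Finset.sum_neg_distrib]
      refine Finset.sum_congr rfl fun g _ => ?_
      have h4 := (youngCovariant_youngSymmetrizer T).2 _ hs g
      simp only at h4
      rw [Equiv.coe_mulRight, h4, rsign_swap hne, neg_one_mul, neg_mul]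
      congr 3
      rw [Equiv.Perm.coe_mul, ← Function.comp_assoc]
      apply propext
      constructor
      · intro h
        have := congrArg (fun k => k ∘ Equiv.swap x y) h
        simp only [Function.comp_assoc, hfs] at this
        rw [← Equiv.Perm.coe_mul, Equiv.swap_mul_self] at this
        simpa using this
      · intro h
        rw [h, hfs]
    linarith
  let F : colGroup T → (Fin n → Fin N) := fun u x => ⟨(T ((u : Equiv.Perm (Fin n)) x)).1.1, hN _⟩
  have hF : Function.Injective F := by
    intro u v huv
    refine Subtype.ext (Equiv.ext fun x => filling_ext T ?_ ?_)
    · exact congrArg Fin.val (congrFun huv x)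
    · rw [u.2 x, v.2 x]
  -- What survives is the row index composed with a column permutation, each such function once and
  -- with weight `1`.
  have h5 : ∑ f, θ f * S f = ∑ u : colGroup T, S (F u) := by
    rw [← Finset.sum_subset (Finset.subset_univ (univ.image F)),
      Finset.sum_image (fun u _ v _ h => hF h)]
    · refine Finset.sum_congr rfl fun u _ => ?_
      rw [hθ1 (F u) u u.2 (fun x => rfl), one_mul]
    · intro f _ hf
      by_contra hne
      have h6 : ColumnInjective T f := by
        by_contra h
        exact hne (by rw [hS0 f h, mul_zero])
      obtain ⟨u, hu, h7⟩ := hθ2 f h6 (left_ne_zero_of_mul hne)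
      refine hf (Finset.mem_image.mpr ⟨⟨u, hu⟩, mem_univ _, ?_⟩)
      ext1 x
      exact Fin.ext (h7 x).symm
  rw [h5, hookScalar_eq]
  refine Finset.sum_congr rfl fun u _ => ?_
  simp only [S]
  rw [sum_youngSymmetrizer_mul T (fun g => if F u ∘ g = F u then 1 else 0)]
  rw [← Equiv.sum_comp (Equiv.mulRight u)]
  refine Finset.sum_congr rfl fun q _ => Finset.sum_congr rfl fun r _ => ?_
  rw [Equiv.coe_mulRight, Subgroup.coe_mul, rsign_mul, mul_assoc]
  congr 3
  apply propext
  constructor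
  · intro h x
    have h1 := congrArg Fin.val (congrFun h ((u : Equiv.Perm (Fin n))⁻¹ x))
    simpa [F] using h1
  · intro h
    ext1 x
    refine Fin.ext ?_
    have h1 := h ((u : Equiv.Perm (Fin n)) x)
    simpa [F] using h1

end YoungSymmetrizer

end InvolutionWalk

end

noncomputable section

open Finset

namespace InvolutionWalk

/-! ### Alternants, the Jacobi–Trudi identity and orthonormality of Frobenius' expressions. -/

section SymmetricPolynomials

open MvPolynomial

/-- The monomial with the given exponents. -/
def mono {ι : Type*} [Finite ι] (a : ι → ℕ) : MvPolynomial ι ℝ :=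
  monomial (Finsupp.equivFunOnFinite.symm a) 1

section mono
variable {ι : Type*} [Fintype ι]

theorem mono_add (a b : ι → ℕ) : mono (a + b) = mono a * mono b := by
  have h : Finsupp.equivFunOnFinite.symm (a + b) =
      Finsupp.equivFunOnFinite.symm a + Finsupp.equivFunOnFinite.symm b := by
    ext
    simp
  rw [mono, mono, mono, monomial_mul, one_mul, h]

@[simp] theorem mono_zero : mono (0 : ι → ℕ) = 1 := by
  have h : Finsupp.equivFunOnFinite.symm (0 : ι → ℕ) = 0 := by
    ext
    simp
  rw [mono, h, ← C_1, C_apply]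

theorem mono_sum {κ : Type*} (s : Finset κ) (a : κ → ι → ℕ) :
    mono (∑ x ∈ s, a x) = ∏ x ∈ s, mono (a x) := by
  classical
  induction s using Finset.induction_on with
  | empty => simp
  | insert x s hx ih => rw [sum_insert hx, prod_insert hx, mono_add, ih]

theorem mono_single [DecidableEq ι] (i : ι) : mono (Pi.single i 1) = X i := by
  rw [mono, X]
  congr 1
  ext j
  simp [eq_comm]

theorem mono_eq_prod (a : ι → ℕ) : mono a = ∏ i, (X i : MvPolynomial ι ℝ) ^ a i := by
  classical
  have h : a = ∑ i, a i • Pi.single i 1 := by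
    ext j
    simp [Pi.single_apply]
  conv_lhs => rw [h, mono_sum]
  refine Finset.prod_congr rfl fun i _ => ?_
  rw [← mono_single]
  induction a i with
  | zero => simp
  | succ k ih => rw [succ_nsmul, mono_add, ih, pow_succ]

/-- The coefficient at the given exponents. -/
def coeffAt (b : ι → ℕ) : MvPolynomial ι ℝ →ₗ[ℝ] ℝ :=
  MvPolynomial.lcoeff ℝ (Finsupp.equivFunOnFinite.symm b)

theorem coeffAt_mono [DecidableEq ι] (a b : ι → ℕ) :
    coeffAt b (mono a) = if a = b then 1 else 0 := by
  simp [coeffAt, mono, coeff_monomial]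

end mono

/-- The number of arguments at which a function takes each value. -/
def cnt {n : ℕ} {ι : Type*} [DecidableEq ι] (f : Fin n → ι) : ι → ℕ := fun i => #{x | f x = i}

section cnt
variable {n : ℕ} {ι : Type*} [Fintype ι] [DecidableEq ι]

omit [Fintype ι] in
theorem cnt_eq_sum (f : Fin n → ι) : cnt f = ∑ x, Pi.single (f x) 1 := by
  ext i
  rw [cnt, Finset.card_filter, Finset.sum_apply]
  refine Finset.sum_congr rfl fun x _ => ?_
  rw [Pi.single_apply]
  exact if_congr eq_comm rfl rfl

theorem mono_cnt (f : Fin n → ι) : mono (cnt f) = ∏ x, X (f x) := by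
  rw [cnt_eq_sum, mono_sum]
  simp_rw [mono_single]

theorem sum_cnt (f : Fin n → ι) : ∑ i, cnt f i = n := by
  have := Finset.card_eq_sum_card_fiberwise (f := f) (s := univ) (t := univ) (by simp)
  simpa [cnt] using this.symm

omit [Fintype ι] in
theorem cnt_comp_perm (f : Fin n → ι) (σ : Equiv.Perm (Fin n)) : cnt (f ∘ σ) = cnt f := by
  ext i
  refine Finset.card_equiv σ ?_
  simp

/-- Two expansions of the `n`-th power of the sum of the variables are compared. -/
theorem card_cnt_eq (k : ι → ℕ) (hk : ∑ i, k i = n) :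
    #{f : Fin n → ι | cnt f = k} = Nat.multinomial univ k := by
  have h1 : (∑ i : ι, (X i : MvPolynomial ι ℝ)) ^ n = ∑ f : Fin n → ι, mono (cnt f) := by
    simp_rw [mono_cnt]
    rw [← Fintype.piFinset_univ, ← Finset.prod_univ_sum (fun _ => univ) (fun _ i => X i)]
    simp
  have h2 := congrArg (coeffAt k) h1
  rw [Finset.sum_pow_eq_sum_piAntidiag] at h2
  simp_rw [← mono_eq_prod, ← nsmul_eq_mul] at h2
  rw [map_sum, map_sum] at h2
  simp_rw [map_nsmul, coeffAt_mono] at h2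
  rw [Finset.sum_eq_single k] at h2
  · simp only [if_true, Finset.sum_boole, nsmul_eq_mul, mul_one] at h2
    exact_mod_cast h2.symm
  · intro b _ hb
    simp [hb]
  · intro h
    exact absurd (by simpa [mem_piAntidiag] using hk) h

/-- Orbit counting: a function with fibre sizes `k` is fixed by `∏ kᵢ!` permutations, and there are
`n! / ∏ kᵢ!` such functions. For `g = mono` this is the expansion of `n! hₙ` in power sums. -/
theorem sum_stabilizer_smul {E : Type*} [AddCommMonoid E] (g : (ι → ℕ) → E) :
    ∑ σ : Equiv.Perm (Fin n), ∑ f : Fin n → ι with f ∘ σ = f, g (cnt f) =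
      n.factorial • ∑ k ∈ piAntidiag univ n, g k := by
  simp_rw [Finset.sum_filter]
  rw [Finset.sum_comm]
  have h1 : ∀ f : Fin n → ι, (∑ σ : Equiv.Perm (Fin n), if f ∘ σ = f then g (cnt f) else 0) =
      (∏ i, (cnt f i).factorial) • g (cnt f) := by
    intro f
    rw [← Finset.sum_filter, Finset.sum_const]
    congr 1
    have := DomMulAct.stabilizer_card f
    rw [Fintype.card_subtype] at this
    rw [this]
    refine Finset.prod_congr rfl fun i _ => ?_
    rw [Fintype.card_subtype, cnt]
  simp_rw [h1]
  rw [← Finset.sum_fiberwise_of_maps_to (g := cnt) (t := piAntidiag univ n)]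
  · rw [Finset.smul_sum]
    refine Finset.sum_congr rfl fun k hk => ?_
    have hk' : ∑ i, k i = n := by simpa [mem_piAntidiag] using hk
    rw [Finset.sum_congr rfl (g := fun _ => (∏ i, (k i).factorial) • g k)]
    · rw [Finset.sum_const, card_cnt_eq k hk', ← mul_smul]
      congr 1
      rw [mul_comm, Nat.multinomial_spec, hk']
    · intro f hf
      rw [(Finset.mem_filter.mp hf).2]
  · intro f _
    simp [mem_piAntidiag, sum_cnt]

end cnt

variable {N : ℕ}

/-- The staircase `N - 1, N - 2, …, 0`. -/
def rho (i : Fin N) : ℕ := (i.rev : ℕ)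

theorem rho_injective : Function.Injective (rho (N := N)) := fun _ _ h =>
  Fin.rev_injective (Fin.ext h)

/-- The alternating sum of the monomials `x ^ (b ∘ w)`. -/
def alternant (b : Fin N → ℕ) : MvPolynomial (Fin N) ℝ :=
  ∑ w : Equiv.Perm (Fin N), rsign w • mono (b ∘ w)

theorem alternant_eq_det (b : Fin N → ℕ) :
    alternant b = (Matrix.of fun j i : Fin N => (X i : MvPolynomial (Fin N) ℝ) ^ b j).det := by
  rw [Matrix.det_apply', alternant]
  refine Finset.sum_congr rfl fun w _ => ?_
  rw [mono_eq_prod, rsign, smul_eq_C_mul]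
  simp

theorem coeffAt_alternant (b : Fin N → ℕ) (hb : Function.Injective b) :
    coeffAt b (alternant b) = 1 := by
  simp_rw [alternant, map_sum, map_smul, coeffAt_mono]
  rw [Finset.sum_eq_single 1]
  · simp
  · intro w _ hw
    rw [if_neg, smul_zero]
    intro h
    refine hw (Equiv.ext fun i => hb ?_)
    exact congrFun h i
  · simp

/-- The complete homogeneous symmetric polynomial. -/
def hpoly (N b : ℕ) : MvPolynomial (Fin N) ℝ := ∑ k ∈ piAntidiag univ b, mono k

/-- The generating series of the complete homogeneous symmetric polynomials. -/
def hseries (N : ℕ) : PowerSeries (MvPolynomial (Fin N) ℝ) :=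
  ∏ l, PowerSeries.mk fun k => X l ^ k

theorem coeff_hseries (b : ℕ) : PowerSeries.coeff b (hseries N) = hpoly N b := by
  rw [hseries, PowerSeries.coeff_prod, hpoly]
  refine Finset.sum_bij' (fun l _ => (l : Fin N → ℕ))
    (fun k _ => Finsupp.equivFunOnFinite.symm k) ?_ ?_ ?_ ?_ ?_
  · intro l hl
    simpa [mem_finsuppAntidiag, mem_piAntidiag] using hl
  · intro l hl
    simpa [mem_finsuppAntidiag, mem_piAntidiag] using hl
  · intro l _
    simp
  · intro k _
    rfl
  · intro l _
    simp [mono_eq_prod]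

/-- The product of `1 - x_l y` over `l ≠ k`. -/
def cofactorSeries (k : Fin N) : PowerSeries (MvPolynomial (Fin N) ℝ) :=
  ∏ l ∈ univ.erase k, (1 - PowerSeries.C (X l) * PowerSeries.X)

/-- The series `∏ 1 / (1 - x_l y)` loses all its factors except the one with `l = k`. -/
theorem hseries_mul_cofactorSeries (k : Fin N) :
    hseries N * cofactorSeries k = PowerSeries.mk fun b => X k ^ b := by
  rw [hseries, ← Finset.mul_prod_erase univ _ (mem_univ k), cofactorSeries, mul_assoc,
    ← Finset.prod_mul_distrib, Finset.prod_eq_one, mul_one]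
  intro l _
  rw [mul_sub, mul_one]
  ext b : 1
  rw [map_sub, ← mul_assoc, mul_comm _ (PowerSeries.C (X l)), mul_assoc]
  rcases b with _ | b
  · simp
  · rw [PowerSeries.coeff_C_mul, PowerSeries.coeff_succ_mul_X, PowerSeries.coeff_mk,
      PowerSeries.coeff_mk, PowerSeries.coeff_one, if_neg (by omega), pow_succ', sub_self]

/-- The degree in `y` is at most `N - 1`, so no term of the Cauchy product is lost when it is
written with `N × N` matrices. -/
theorem coeff_cofactorSeries_of_le (k : Fin N) {b : ℕ} (hb : N ≤ b) :
    PowerSeries.coeff b (cofactorSeries k) = 0 := by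
  let P : Polynomial (MvPolynomial (Fin N) ℝ) :=
    ∏ l ∈ univ.erase k, (1 - Polynomial.C (X l) * Polynomial.X)
  have h1 : cofactorSeries k = (P : PowerSeries (MvPolynomial (Fin N) ℝ)) := by
    rw [cofactorSeries, ← Polynomial.coeToPowerSeries.ringHom_apply, map_prod]
    refine Finset.prod_congr rfl fun l _ => ?_
    simp
  rw [h1, Polynomial.coeff_coe]
  refine Polynomial.coeff_eq_zero_of_natDegree_lt (lt_of_lt_of_le ?_ hb)
  refine lt_of_le_of_lt (Polynomial.natDegree_prod_le _ _) ?_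
  refine lt_of_le_of_lt (Finset.sum_le_card_nsmul _ _ 1 ?_) ?_
  · intro l _
    compute_degree
  · rw [Finset.card_erase_of_mem (mem_univ k), Finset.card_univ, Fintype.card_fin]
    have := k.2
    simp only [smul_eq_mul, mul_one]
    omega

/-- The entries of the Jacobi–Trudi matrix. -/
def jacobiTrudi (b : Fin N → ℕ) : Matrix (Fin N) (Fin N) (MvPolynomial (Fin N) ℝ) :=
  Matrix.of fun i j => if rho j ≤ b i then hpoly N (b i - rho j) else 0

theorem sum_rho (g : ℕ → MvPolynomial (Fin N) ℝ) :
    ∑ j : Fin N, g (rho j) = ∑ t ∈ range N, g t := by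
  rw [← Fin.sum_univ_eq_sum_range, ← Equiv.sum_comp Fin.revPerm]
  simp [rho]

/-- Row `i` reads off the coefficient of `y ^ (b i)` in `hseries_mul_cofactorSeries`. The second
factor does not depend on `b`, so its determinant is found by taking `b = rho`, where the first
factor is unitriangular. -/
theorem jacobiTrudi_mul (b : Fin N → ℕ) :
    jacobiTrudi b * (Matrix.of fun j k => PowerSeries.coeff (rho j) (cofactorSeries k)) =
      Matrix.of fun j i : Fin N => (X i : MvPolynomial (Fin N) ℝ) ^ b j := by
  refine Matrix.ext fun i k => ?_
  rw [Matrix.mul_apply, Matrix.of_apply]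
  simp only [jacobiTrudi, Matrix.of_apply]
  rw [sum_rho (fun t => (if t ≤ b i then hpoly N (b i - t) else 0) *
    PowerSeries.coeff t (cofactorSeries k))]
  have h := congrArg (PowerSeries.coeff (b i)) (hseries_mul_cofactorSeries k)
  rw [PowerSeries.coeff_mk] at h
  rw [← h, mul_comm, PowerSeries.coeff_mul, Finset.Nat.sum_antidiagonal_eq_sum_range_succ_mk]
  simp only [coeff_hseries]
  have h1 : ∀ t, (if t ≤ b i then hpoly N (b i - t) else 0) *
      PowerSeries.coeff t (cofactorSeries k) =
      if t ∈ range (b i + 1) then PowerSeries.coeff t (cofactorSeries k) * hpoly N (b i - t)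
      else 0 := by
    intro t
    simp only [mem_range, Nat.lt_succ_iff]
    split_ifs
    · rw [mul_comm]
    · rw [zero_mul]
  simp_rw [h1]
  rw [Finset.sum_ite_mem]
  refine Finset.sum_subset ?_ ?_
  · exact Finset.inter_subset_right
  intro t ht ht'
  rw [coeff_cofactorSeries_of_le k, zero_mul]
  by_contra h2
  exact ht' (mem_inter.mpr ⟨by simpa using h2, ht⟩)

theorem det_jacobiTrudi_rho : (jacobiTrudi (rho (N := N))).det = 1 := by
  rw [Matrix.det_of_isUpperTriangular]
  · refine Finset.prod_eq_one fun i _ => ?_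
    simp only [jacobiTrudi, Matrix.of_apply, le_refl, if_true, Nat.sub_self, hpoly]
    simp
  · intro i j hij
    simp only [jacobiTrudi, Matrix.of_apply]
    rw [if_neg]
    simp only [id_eq, rho, Fin.val_rev] at hij ⊢
    have := Fin.lt_def.mp hij
    omega

/-- The Jacobi–Trudi identity. -/
theorem alternant_rho_mul_det_jacobiTrudi (b : Fin N → ℕ) :
    alternant rho * (jacobiTrudi b).det = alternant b := by
  rw [alternant_eq_det b, ← jacobiTrudi_mul, Matrix.det_mul, alternant_eq_det rho,
    ← jacobiTrudi_mul, Matrix.det_mul, det_jacobiTrudi_rho, one_mul, mul_comm]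

/-- The power sum symmetric polynomial of the cycle type of `σ`. -/
def fixedPoly (N : ℕ) {n : ℕ} (σ : Equiv.Perm (Fin n)) : MvPolynomial (Fin N) ℝ :=
  ∑ f : Fin n → Fin N with f ∘ σ = f, mono (cnt f)

/-- Frobenius' expression for the character value at `σ`, in terms of `b = λ + ρ`. -/
def omega {n : ℕ} (b : Fin N → ℕ) (σ : Equiv.Perm (Fin n)) : ℝ :=
  coeffAt b (alternant rho * fixedPoly N σ)

theorem prod_hpoly (a : Fin N → ℕ) (n : ℕ) (ha : ∑ i, a i = n) :
    ∏ i, hpoly N (a i) = ∑ k ∈ piAntidiag (univ : Finset (Fin N × Fin N)) n,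
      if (fun i => ∑ j, k (i, j)) = a then mono (fun j => ∑ i, k (i, j)) else 0 := by
  simp_rw [hpoly]
  rw [Finset.prod_univ_sum, ← Finset.sum_filter]
  refine Finset.sum_bij' (fun k _ => fun p => k p.1 p.2) (fun k _ => fun i j => k (i, j))
    ?_ ?_ ?_ ?_ ?_
  · intro k hk
    simp only [Fintype.mem_piFinset, mem_piAntidiag] at hk
    simp only [mem_filter, mem_piAntidiag, mem_univ, implies_true, and_true]
    constructor
    · rw [Fintype.sum_prod_type, ← ha]
      exact Finset.sum_congr rfl fun i _ => (hk i).1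
    · ext i
      exact (hk i).1
  · intro k hk
    simp only [mem_filter] at hk
    simp only [Fintype.mem_piFinset, mem_piAntidiag, mem_univ, implies_true, and_true]
    intro i
    exact congrFun hk.2 i
  · intro k _
    rfl
  · intro k _
    rfl
  · intro k _
    rw [← mono_sum]
    congr 1
    ext j
    simp

/-- Two functions fixed by `σ` are one fixed function with values in `Fin N × Fin N`; its fibre
sizes form a matrix whose row and column sums are the fibre sizes of the two. Orbit counting then
applies to the pair. -/
theorem sum_fixedPoly_eq_prod_hpoly {n : ℕ} (a : Fin N → ℕ) (ha : ∑ i, a i = n) :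
    ∑ σ : Equiv.Perm (Fin n), ∑ f : Fin n → Fin N with f ∘ σ = f,
      (if cnt f = a then fixedPoly N σ else 0) = n.factorial • ∏ i, hpoly N (a i) := by
  rw [prod_hpoly a n ha]
  rw [← sum_stabilizer_smul (n := n) (fun k : Fin N × Fin N → ℕ =>
    if (fun i => ∑ j, k (i, j)) = a then mono (fun j => ∑ i, k (i, j)) else 0)]
  refine Finset.sum_congr rfl fun σ _ => ?_
  have h1 : ∀ F : Fin n → Fin N × Fin N, ∀ i, ∑ j, cnt F (i, j) = cnt (Prod.fst ∘ F) i := by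
    intro F i
    simp only [cnt, Function.comp_apply]
    rw [Finset.card_eq_sum_card_fiberwise (f := fun x => (F x).2) (t := univ) (by simp)]
    refine Finset.sum_congr rfl fun j _ => ?_
    rw [Finset.filter_filter]
    congr 1
    ext x
    simp [Prod.ext_iff]
  have h2 : ∀ F : Fin n → Fin N × Fin N, ∀ j, ∑ i, cnt F (i, j) = cnt (Prod.snd ∘ F) j := by
    intro F j
    simp only [cnt, Function.comp_apply]
    rw [Finset.card_eq_sum_card_fiberwise (f := fun x => (F x).1) (t := univ) (by simp)]
    refine Finset.sum_congr rfl fun i _ => ?_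
    rw [Finset.filter_filter]
    congr 1
    ext x
    simp [Prod.ext_iff, and_comm]
  simp_rw [h1, h2]
  have h3 : ∀ f : Fin n → Fin N, (if cnt f = a then fixedPoly N σ else 0) =
      ∑ f' : Fin n → Fin N with f' ∘ σ = f', if cnt f = a then mono (cnt f') else 0 := by
    intro f
    split_ifs <;> simp [fixedPoly]
  simp_rw [h3]
  rw [← Finset.sum_product']
  refine Finset.sum_bij' (fun p _ => fun x => (p.1 x, p.2 x))
    (fun F _ => (Prod.fst ∘ F, Prod.snd ∘ F)) ?_ ?_ ?_ ?_ ?_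
  · rintro ⟨f, f'⟩ h
    simp only [mem_product, mem_filter, mem_univ, true_and] at h ⊢
    ext1 x
    exact Prod.ext (congrFun h.1 x) (congrFun h.2 x)
  · intro F h
    simp only [mem_product, mem_filter, mem_univ, true_and, Function.comp_assoc] at h ⊢
    rw [h]
    exact ⟨rfl, rfl⟩
  · rintro ⟨f, f'⟩ _
    rfl
  · intro F _
    rfl
  · rintro ⟨f, f'⟩ _
    rfl

theorem coeffAt_alternant_mul_mono (b a : Fin N → ℕ) :
    coeffAt b (alternant rho * mono a) =
      ∑ w : Equiv.Perm (Fin N), rsign w * if rho ∘ w + a = b then 1 else 0 := by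
  rw [alternant, Finset.sum_mul, map_sum]
  refine Finset.sum_congr rfl fun w _ => ?_
  rw [smul_mul_assoc, map_smul, ← mono_add, coeffAt_mono, smul_eq_mul]

theorem omega_eq_sum {n : ℕ} (b : Fin N → ℕ) (σ : Equiv.Perm (Fin n)) :
    omega b σ = ∑ f : Fin n → Fin N with f ∘ σ = f, coeffAt b (alternant rho * mono (cnt f)) := by
  rw [omega, fixedPoly, Finset.mul_sum, map_sum]

theorem omega_inv {n : ℕ} (b : Fin N → ℕ) (σ : Equiv.Perm (Fin n)) :
    omega b σ⁻¹ = omega b σ := by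
  rw [omega_eq_sum, omega_eq_sum]
  congr 1
  ext f
  simp only [mem_filter, mem_univ, true_and]
  constructor
  · intro h
    conv_lhs => rw [← h]
    rw [Function.comp_assoc, ← Equiv.Perm.coe_mul]
    simp
  · intro h
    conv_lhs => rw [← h]
    rw [Function.comp_assoc, ← Equiv.Perm.coe_mul]
    simp

theorem omega_conj {n : ℕ} (b : Fin N → ℕ) (σ τ : Equiv.Perm (Fin n)) :
    omega b (τ * σ * τ⁻¹) = omega b σ := by
  rw [omega_eq_sum, omega_eq_sum]
  refine Finset.sum_bij' (fun f _ => f ∘ τ) (fun f _ => f ∘ ⇑τ⁻¹) ?_ ?_ ?_ ?_ ?_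
  · intro f h
    simp only [mem_filter, mem_univ, true_and] at h ⊢
    conv_rhs => rw [← h]
    ext x
    simp
  · intro f h
    simp only [mem_filter, mem_univ, true_and] at h ⊢
    conv_rhs => rw [← h]
    ext x
    simp
  · intro f _
    ext x
    simp
  · intro f _
    ext x
    simp
  · intro f _
    rw [cnt_comp_perm]

/-- One factor is expanded as a signed sum over `w`. Summing over `σ` turns the term of `w` into
`n!` times a product of complete symmetric polynomials, so the signed sum is a Jacobi–Trudi
determinant; multiplied by the alternant of `ρ` it becomes the alternant of `b`, whose coefficient
at `b` is `1`. -/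
theorem sum_omega_mul_self {n : ℕ} (b : Fin N → ℕ) (hb : Function.Injective b)
    (hn : ∑ i, b i = n + ∑ i : Fin N, rho i) :
    ∑ σ : Equiv.Perm (Fin n), omega b σ * omega b σ = n.factorial := by
  have h1 : ∀ σ : Equiv.Perm (Fin n), omega b σ * omega b σ =
      coeffAt b (alternant rho * ∑ w : Equiv.Perm (Fin N), rsign w •
        ∑ f : Fin n → Fin N with f ∘ σ = f,
          if rho ∘ w + cnt f = b then fixedPoly N σ else 0) := by
    intro σ
    have h2 : (∑ w : Equiv.Perm (Fin N), rsign w • ∑ f : Fin n → Fin N with f ∘ σ = f,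
        if rho ∘ w + cnt f = b then fixedPoly N σ else 0) = omega b σ • fixedPoly N σ := by
      rw [omega_eq_sum]
      simp_rw [coeffAt_alternant_mul_mono]
      rw [Finset.sum_comm, Finset.sum_smul]
      refine Finset.sum_congr rfl fun w _ => ?_
      rw [← Finset.mul_sum, mul_smul, Finset.sum_smul]
      congr 1
      refine Finset.sum_congr rfl fun f _ => ?_
      split_ifs <;> simp
    rw [h2, mul_smul_comm, map_smul, smul_eq_mul]
    rfl
  simp_rw [h1]
  rw [← map_sum, ← Finset.mul_sum, Finset.sum_comm]
  simp_rw [← Finset.smul_sum]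
  have h3 : ∀ w : Equiv.Perm (Fin N), (∑ σ : Equiv.Perm (Fin n),
      ∑ f : Fin n → Fin N with f ∘ σ = f, if rho ∘ w + cnt f = b then fixedPoly N σ else 0) =
      n.factorial • ∏ i, jacobiTrudi b i (w i) := by
    intro w
    by_cases hw : ∀ i, rho (w i) ≤ b i
    · have h4 : ∀ f : Fin n → Fin N, rho ∘ w + cnt f = b ↔ cnt f = fun i => b i - rho (w i) := by
        intro f
        rw [funext_iff, funext_iff]
        refine forall_congr' fun i => ?_
        have := hw i
        simp only [Pi.add_apply, Function.comp_apply]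
        omega
      simp_rw [h4]
      rw [sum_fixedPoly_eq_prod_hpoly]
      · congr 1
        refine Finset.prod_congr rfl fun i _ => ?_
        simp [jacobiTrudi, hw i]
      · have h5 : ∑ i, (b i - rho (w i)) + ∑ i, rho (w i) = ∑ i, b i := by
          rw [← Finset.sum_add_distrib]
          exact Finset.sum_congr rfl fun i _ => Nat.sub_add_cancel (hw i)
        rw [Equiv.sum_comp w rho] at h5
        omega
    · push Not at hw
      obtain ⟨i, hi⟩ := hw
      rw [Finset.prod_eq_zero (mem_univ i) (by simp [jacobiTrudi, not_le.mpr hi]), smul_zero]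
      refine Finset.sum_eq_zero fun σ _ => Finset.sum_eq_zero fun f _ => ?_
      rw [if_neg]
      intro h
      have := congrFun h i
      simp only [Pi.add_apply, Function.comp_apply] at this
      omega
  simp_rw [h3]
  have h6 : ∑ w : Equiv.Perm (Fin N), rsign w • (n.factorial • ∏ i, jacobiTrudi b i (w i)) =
      (n.factorial : ℝ) • (jacobiTrudi b).det := by
    rw [← Matrix.det_transpose, Matrix.det_apply', Finset.smul_sum]
    refine Finset.sum_congr rfl fun w _ => ?_
    rw [← Nat.cast_smul_eq_nsmul ℝ, smul_comm]
    congr 1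
    rw [rsign, smul_eq_C_mul]
    simp
  rw [h6, mul_smul_comm, alternant_rho_mul_det_jacobiTrudi, map_smul, coeffAt_alternant b hb,
    smul_eq_mul, mul_one]

end SymmetricPolynomials

end InvolutionWalk

end

noncomputable section

open Finset

namespace InvolutionWalk

/-! ### Frobenius' character formula for the Specht module. -/

section Frobenius

variable {n N : ℕ} {μ : YoungDiagram} (T : Filling n μ)

/-- The exponents `λ + ρ`. -/
def shifted (N : ℕ) (μ : YoungDiagram) : Fin N → ℕ := fun i => μ.rowLen i + rho i

theorem card_row_eq (i : ℕ) : #{x | (T x).1.1 = i} = μ.rowLen i := by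
  rw [← Finset.card_range (μ.rowLen i)]
  refine Finset.card_bij (fun x _ => (T x).1.2) ?_ ?_ ?_
  · intro x hx
    simp only [mem_filter, mem_univ, true_and] at hx
    have := YoungDiagram.mem_iff_lt_rowLen.mp (cell_mem T x)
    rw [hx] at this
    simpa using this
  · intro x hx y hy hxy
    simp only [mem_filter, mem_univ, true_and] at hx hy
    exact filling_ext T (hx.trans hy.symm) hxy
  · intro r hr
    simp only [mem_range] at hr
    exact ⟨T.symm ⟨(i, r), YoungDiagram.mem_iff_lt_rowLen.mpr hr⟩, by simp, by simp⟩

theorem row_lt_of_colLen_le (hN : μ.colLen 0 ≤ N) (x : Fin n) : (T x).1.1 < N :=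
  lt_of_lt_of_le (lt_of_lt_of_le (YoungDiagram.mem_iff_lt_colLen.mp (cell_mem T x))
    (μ.colLen_anti _ _ (Nat.zero_le _))) hN

/-- The row of an entry. -/
def rowFin (hN : μ.colLen 0 ≤ N) (x : Fin n) : Fin N := ⟨(T x).1.1, row_lt_of_colLen_le T hN x⟩

theorem cnt_rowFin (hN : μ.colLen 0 ≤ N) (i : Fin N) : cnt (rowFin T hN) i = μ.rowLen i := by
  rw [← card_row_eq T]
  simp [cnt, rowFin, Fin.ext_iff]

theorem rho_strictAnti : StrictAnti (rho (N := N)) := fun i j h => by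
  simp only [rho, Fin.val_rev]
  have := Fin.lt_def.mp h
  omega

theorem shifted_strictAnti (N : ℕ) (μ : YoungDiagram) : StrictAnti (shifted N μ) := by
  intro i j h
  have h1 := rho_strictAnti h
  have h2 := μ.rowLen_anti i j (Fin.lt_def.mp h).le
  simp only [shifted]
  omega

include T in
theorem sum_shifted (hN : μ.colLen 0 ≤ N) : ∑ i, shifted N μ i = n + ∑ i : Fin N, rho i := by
  simp only [shifted]
  rw [Finset.sum_add_distrib, ← sum_cnt (rowFin T hN)]
  simp_rw [cnt_rowFin]

/-- Rearrangement inequality: `ρ` is decreasing, so its first `t` entries have the largest sum. -/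
theorem sum_lt_rho_comp_le (w : Equiv.Perm (Fin N)) (t : ℕ) :
    ∑ i : Fin N with i.val < t, rho (w i) ≤ ∑ i : Fin N with i.val < t, rho i := by
  have h : Monovary (fun i : Fin N => if (i : ℕ) < t then 1 else 0) (rho (N := N)) := by
    intro i j hij
    have : j < i := rho_strictAnti.lt_iff_gt.mp hij
    have := Fin.lt_def.mp this
    simp only
    split_ifs <;> omega
  have h2 := h.sum_mul_comp_perm_le_sum_mul (σ := w)
  simpa [Finset.sum_filter] using h2

theorem card_lt_eq_sum_cnt (f : Fin n → Fin N) (t : ℕ) :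
    #{x | (f x : ℕ) < t} = ∑ i : Fin N with i.val < t, cnt f i := by
  rw [Finset.card_eq_sum_card_fiberwise (f := f) (t := univ.filter fun i : Fin N => i.val < t)]
  · refine Finset.sum_congr rfl fun i hi => ?_
    rw [Finset.filter_filter, cnt]
    congr 1
    ext x
    simp only [mem_filter, mem_univ, true_and] at hi ⊢
    constructor
    · exact fun h => h.2
    · rintro rfl
      exact ⟨hi, rfl⟩
  · intro x hx
    simpa using hx

theorem cnt_eq_rowLen_of_colGroup (hN : μ.colLen 0 ≤ N) (f : Fin n → Fin N)
    (u : Equiv.Perm (Fin n)) (hf : ∀ x, (f x : ℕ) = (T (u x)).1.1) (i : Fin N) :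
    cnt f i = μ.rowLen i := by
  have : f = rowFin T hN ∘ u := by
    ext x
    exact hf x
  rw [this, cnt_comp_perm, cnt_rowFin]

/-- The weight of `f` is the signed number of `w` with `wρ + cnt f = μ + ρ`. If it is nonzero, `cnt
f` dominates `μ` because `ρ` dominates `wρ`, so a column-injective `f` is a column rearrangement of
the row index. Then `cnt f = μ` and only `w = 1` contributes. -/
theorem sum_youngSymmetrizer_mul_omega (hN : μ.colLen 0 ≤ N) :
    ∑ g, (youngSymmetrizer T).coeff g * omega (shifted N μ) g = hookScalar T := by
  simp_rw [omega_eq_sum]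
  refine sum_youngSymmetrizer_mul_fixed T
    (fun f => coeffAt (shifted N μ) (alternant rho * mono (cnt f))) ?_ ?_
    (row_lt_of_colLen_le T hN)
  · intro f u _ hf
    have h1 := cnt_eq_rowLen_of_colGroup T hN f u hf
    rw [coeffAt_alternant_mul_mono, Finset.sum_eq_single 1]
    · rw [if_pos, rsign_one, mul_one]
      ext i
      simp [h1, shifted, add_comm]
    · intro w _ hw
      rw [if_neg, mul_zero]
      intro h
      refine hw (Equiv.ext fun i => rho_injective ?_)
      have h2 := congrFun h i
      simp only [Pi.add_apply, Function.comp_apply, h1, shifted] at h2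
      simp only [Equiv.Perm.one_apply]
      omega
    · simp
  · intro f hf hθ
    rw [coeffAt_alternant_mul_mono] at hθ
    obtain ⟨w, _, hw⟩ := Finset.exists_ne_zero_of_sum_ne_zero hθ
    have hw2 : rho ∘ w + cnt f = shifted N μ := by
      by_contra h
      rw [if_neg h, mul_zero] at hw
      exact hw rfl
    refine exists_colGroup_of_columnInjective T (f := fun x => (f x : ℕ))
      (fun x y h1 h2 => hf x y h1 (Fin.ext h2)) ?_
    intro t
    have h3 := card_lt_eq_sum_cnt f t
    have h4 : #{x | (T x).1.1 < t} = ∑ i : Fin N with i.val < t, cnt (rowFin T hN) i :=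
      card_lt_eq_sum_cnt (rowFin T hN) t
    rw [h3, h4]
    have h5 := sum_lt_rho_comp_le w t
    have h6 : ∑ i : Fin N with i.val < t, (rho (w i) + cnt f i) =
        ∑ i : Fin N with i.val < t, (μ.rowLen i + rho i) :=
      Finset.sum_congr rfl fun i _ => congrFun hw2 i
    rw [Finset.sum_add_distrib, Finset.sum_add_distrib] at h6
    have h7 : ∑ i : Fin N with i.val < t, cnt (rowFin T hN) i =
        ∑ i : Fin N with i.val < t, μ.rowLen i :=
      Finset.sum_congr rfl fun i _ => cnt_rowFin T hN i
    omega

/-- Frobenius' character formula. -/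
theorem spechtChar_eq_omega (hN : μ.colLen 0 ≤ N) (g : Equiv.Perm (Fin n)) :
    spechtChar T g = omega (shifted N μ) g := by
  have h1 := sum_spechtChar_mul_self T
  have h2 := sum_omega_mul_self (n := n) (shifted N μ) (shifted_strictAnti N μ).injective
    (sum_shifted T hN)
  have h3 := sum_spechtChar_mul_classFunction T (omega (shifted N μ))
    (fun g h => omega_conj _ g h) (omega_inv _)
  rw [sum_youngSymmetrizer_mul_omega T hN] at h3
  -- The squared distance is `n! - 2 n! + n!`.
  have h4 : ∑ g, (spechtChar T g - omega (shifted N μ) g) ^ 2 = 0 := by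
    have h5 : ∀ g, (spechtChar T g - omega (shifted N μ) g) ^ 2 = spechtChar T g * spechtChar T g
        - 2 * (spechtChar T g * omega (shifted N μ) g)
        + omega (shifted N μ) g * omega (shifted N μ) g := fun g => by ring
    simp_rw [h5]
    rw [Finset.sum_add_distrib, Finset.sum_sub_distrib, ← Finset.mul_sum, h1, h2, h3]
    have := hookScalar_ne_zero T
    field_simp
    ring
  have h6 := (Finset.sum_eq_zero_iff_of_nonneg (fun g _ => sq_nonneg _)).mp h4 g (mem_univ g)
  exact sub_eq_zero.mp (pow_eq_zero_iff (two_ne_zero) |>.mp h6)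

end Frobenius

end InvolutionWalk

end

noncomputable section

open Finset

namespace InvolutionWalk

/-! ### The eigenvalue as a ratio of coefficients. -/

section Eigenvalue

open MvPolynomial

theorem involution_apply (n s : ℕ) (hs : 2 * s ≤ n) (x : Fin n) :
    (involution n s x : ℕ) =
      if (x : ℕ) < 2 * s then (if (x : ℕ) % 2 = 0 then (x : ℕ) + 1 else (x : ℕ) - 1) else x := by
  induction s with
  | zero => simp [involution]
  | succ s ih =>
    have h1 := ih (by omega)
    rw [involution, dif_pos (by omega), Equiv.Perm.mul_apply]
    by_cases h2 : (x : ℕ) < 2 * s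
    · rw [Equiv.swap_apply_of_ne_of_ne]
      · rw [h1, if_pos h2, if_pos (by omega : (x : ℕ) < 2 * (s + 1))]
      · intro h
        have h3 := congrArg Fin.val h
        rw [h1, if_pos h2] at h3
        simp only at h3
        split_ifs at h3 <;> omega
      · intro h
        have h3 := congrArg Fin.val h
        rw [h1, if_pos h2] at h3
        simp only at h3
        split_ifs at h3 <;> omega
    · rw [involution_apply_of_le n s x (by omega)]
      by_cases h3 : (x : ℕ) = 2 * s
      · have : x = ⟨2 * s, by omega⟩ := Fin.ext h3
        rw [this, Equiv.swap_apply_left]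
        simp
      by_cases h4 : (x : ℕ) = 2 * s + 1
      · have : x = ⟨2 * s + 1, by omega⟩ := Fin.ext h4
        rw [this, Equiv.swap_apply_right]
        simp only
        rw [if_pos (by omega), if_neg (by omega)]
        simp
      rw [Equiv.swap_apply_of_ne_of_ne, if_neg (by omega)]
      · exact fun h => h3 (congrArg Fin.val h)
      · exact fun h => h4 (congrArg Fin.val h)

/-- The power sum `p_k`. -/
def powerSum (N k : ℕ) : MvPolynomial (Fin N) ℝ := ∑ i, X i ^ k

theorem comp_involution_eq_iff {N : ℕ} (m s : ℕ) (hs : s ≤ m) (f : Fin (m * 2) → Fin N) :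
    f ∘ involution (m * 2) s = f ↔
      ∀ k : Fin m, (k : ℕ) < s → f (finProdFinEquiv (k, 0)) = f (finProdFinEquiv (k, 1)) := by
  have hval : ∀ (k : Fin m) (j : Fin 2), (finProdFinEquiv (k, j) : ℕ) = j + 2 * k :=
    fun k j => rfl
  have key : ∀ k : Fin m, ∀ j : Fin 2, (k : ℕ) < s →
      involution (m * 2) s (finProdFinEquiv (k, j)) = finProdFinEquiv (k, 1 - j) := by
    intro k j hk
    refine Fin.ext ?_
    rw [involution_apply _ _ (by omega), hval, hval]
    fin_cases j
    · simp only [Fin.mk_zero]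
      rw [if_pos (by omega), if_pos (by omega)]
      simp
      omega
    · simp only [Fin.mk_one]
      rw [if_pos (by omega), if_neg (by omega)]
      simp
  constructor
  · intro h k hk
    have h1 := congrFun h (finProdFinEquiv (k, 0))
    rw [Function.comp_apply, key k 0 hk] at h1
    exact h1.symm
  · intro h
    ext1 x
    obtain ⟨⟨k, j⟩, rfl⟩ := finProdFinEquiv.surjective x
    rw [Function.comp_apply]
    by_cases hk : (k : ℕ) < s
    · rw [key k j hk]
      have h1 := h k hk
      fin_cases j
      · exact h1.symm
      · exact h1
    · rw [involution_apply_of_le]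
      rw [hval]
      omega

/-- Letters are grouped into the pairs `2k, 2k + 1`. Each of the `s` pairs that form a 2-cycle
contributes `p₂`, each of the other `m - s` pairs `p₁²`. -/
theorem fixedPoly_involution (N m s : ℕ) (hs : s ≤ m) :
    fixedPoly N (involution (m * 2) s) = powerSum N 2 ^ s * (powerSum N 1 ^ 2) ^ (m - s) := by
  have h1 : ∀ k : Fin m, (if (k : ℕ) < s then powerSum N 2 else powerSum N 1 ^ 2) =
      ∑ g : Fin N × Fin N, if (k : ℕ) < s → g.1 = g.2 then
        (X g.1 * X g.2 : MvPolynomial (Fin N) ℝ) else 0 := by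
    intro k
    rw [Fintype.sum_prod_type]
    split_ifs with h
    · simp only [h, true_imp_iff]
      rw [powerSum]
      refine Finset.sum_congr rfl fun i _ => ?_
      rw [Finset.sum_ite_eq, if_pos (mem_univ i), pow_two]
    · simp only [h, false_imp_iff, if_true]
      rw [powerSum, pow_two, Finset.sum_mul_sum]
      simp
  have h2 : ∏ k : Fin m, (if (k : ℕ) < s then powerSum N 2 else powerSum N 1 ^ 2) =
      powerSum N 2 ^ s * (powerSum N 1 ^ 2) ^ (m - s) := by
    rw [Fin.prod_univ_eq_prod_range (fun k => if k < s then powerSum N 2 else powerSum N 1 ^ 2),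
      ← Finset.prod_range_mul_prod_Ico _ hs]
    congr 1
    · rw [Finset.prod_congr rfl (g := fun _ => powerSum N 2)]
      · simp
      · intro k hk
        rw [if_pos (mem_range.mp hk)]
    · rw [Finset.prod_congr rfl (g := fun _ => powerSum N 1 ^ 2)]
      · simp
      · intro k hk
        rw [if_neg (not_lt.mpr (mem_Ico.mp hk).1)]
  rw [← h2]
  simp_rw [h1]
  rw [Finset.prod_univ_sum, Fintype.piFinset_univ, fixedPoly, Finset.sum_filter]
  let e : (Fin (m * 2) → Fin N) ≃ (Fin m → Fin N × Fin N) :=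
    { toFun := fun f k => (f (finProdFinEquiv (k, 0)), f (finProdFinEquiv (k, 1)))
      invFun := fun g x => if (finProdFinEquiv.symm x).2 = 0 then (g (finProdFinEquiv.symm x).1).1
        else (g (finProdFinEquiv.symm x).1).2
      left_inv := by
        intro f
        ext1 x
        obtain ⟨⟨k, j⟩, rfl⟩ := finProdFinEquiv.surjective x
        fin_cases j <;> simp
      right_inv := by
        intro g
        ext1 k
        simp }
  refine Fintype.sum_equiv e _ _ fun f => ?_
  simp only [comp_involution_eq_iff m s hs]
  split_ifs with h
  · rw [Finset.prod_congr rfl (g := fun k => X (f (finProdFinEquiv (k, 0))) *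
      X (f (finProdFinEquiv (k, 1))))]
    · rw [mono_cnt, ← Equiv.prod_comp finProdFinEquiv, Fintype.prod_prod_type]
      simp
    · intro k _
      exact if_pos (h k)
  · push Not at h
    obtain ⟨k, hk, hne⟩ := h
    symm
    refine Finset.prod_eq_zero (mem_univ k) ?_
    rw [if_neg]
    intro h
    exact hne (h hk)

/-- The generating polynomial of a step of the walk. -/
def stepPoly (N : ℕ) (p : ℝ) : MvPolynomial (Fin N) ℝ :=
  p • powerSum N 1 ^ 2 + (1 - p) • powerSum N 2

theorem stepPoly_pow (N : ℕ) (p : ℝ) (m : ℕ) :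
    stepPoly N p ^ m = ∑ s ∈ range (m + 1), (p ^ (m - s) * (1 - p) ^ s * (m.choose s : ℝ)) •
      (powerSum N 2 ^ s * (powerSum N 1 ^ 2) ^ (m - s)) := by
  rw [stepPoly, add_comm, add_pow]
  refine Finset.sum_congr rfl fun s _ => ?_
  rw [smul_pow, smul_pow, smul_mul_smul_comm, ← nsmul_eq_mul', ← Nat.cast_smul_eq_nsmul ℝ,
    smul_smul]
  congr 1
  ring

theorem chi_eq_omega (μ : YoungDiagram) {N : ℕ} (hN : μ.colLen 0 ≤ N)
    (g : Equiv.Perm (Fin μ.card)) : chi μ g = omega (shifted N μ) g :=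
  spechtChar_eq_omega (filling μ) hN g

theorem omega_involution {N : ℕ} (b : Fin N → ℕ) {n m : ℕ} (hn : n = 2 * m) (s : ℕ)
    (hs : s ≤ m) : omega b (involution n s) =
      coeffAt b (alternant rho * (powerSum N 2 ^ s * (powerSum N 1 ^ 2) ^ (m - s))) := by
  rw [mul_comm] at hn
  subst hn
  rw [omega, fixedPoly_involution N m s hs]

theorem dimIrrep_eq (μ : YoungDiagram) {N m : ℕ} (hN : μ.colLen 0 ≤ N) (hm : μ.card = 2 * m) :
    (dimIrrep μ : ℝ) = coeffAt (shifted N μ) (alternant rho * (powerSum N 1 ^ 2) ^ m) := by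
  have h1 := chi_eq_omega μ hN (involution μ.card 0)
  rw [omega_involution _ hm 0 (Nat.zero_le _)] at h1
  rw [involution, chi, Representation.char_one] at h1
  rw [dimIrrep, h1]
  simp

theorem eigenvalue_eq (p : ℝ) (μ : YoungDiagram) {N m : ℕ} (hN : μ.colLen 0 ≤ N)
    (hm : μ.card = 2 * m) :
    eigenvalue p μ = coeffAt (shifted N μ) (alternant rho * stepPoly N p ^ m) /
      coeffAt (shifted N μ) (alternant rho * (powerSum N 1 ^ 2) ^ m) := by
  have h2 : μ.card / 2 = m := by omega
  rw [eigenvalue, h2, ← dimIrrep_eq μ hN hm, stepPoly_pow, Finset.mul_sum, map_sum,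
    Finset.sum_div]
  refine Finset.sum_congr rfl fun s hs => ?_
  rw [chi_eq_omega μ hN, omega_involution _ hm s (Nat.lt_succ_iff.mp (mem_range.mp hs)),
    mul_smul_comm, map_smul, smul_eq_mul, mul_div_assoc]

end Eigenvalue

end InvolutionWalk

end

noncomputable section

open Finset

namespace InvolutionWalk

/-! ### Recursions on alternating functions of the exponents. -/

section Shift

variable {N : ℕ}

open MvPolynomial in
/-- The coefficient of a polynomial at integer exponents. -/
def coeffZ (g : MvPolynomial (Fin N) ℝ) (b : Fin N → ℤ) : ℝ :=
  if ∀ i, 0 ≤ b i then coeffAt (fun i => (b i).toNat) g else 0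

theorem coeffZ_natCast (g : MvPolynomial (Fin N) ℝ) (b : Fin N → ℕ) :
    coeffZ g (fun i => (b i : ℤ)) = coeffAt b g := by
  simp [coeffZ]

theorem coeffZ_X_mul (g : MvPolynomial (Fin N) ℝ) (i : Fin N) (b : Fin N → ℤ) :
    coeffZ (MvPolynomial.X i * g) b = coeffZ g (b - Pi.single i 1) := by
  have hb : ∀ j, (b - Pi.single i 1 : Fin N → ℤ) j = if j = i then b j - 1 else b j := by
    intro j
    rw [Pi.sub_apply, Pi.single_apply]
    split_ifs <;> simp
  by_cases h : ∀ j, 0 ≤ b j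
  · by_cases hi : b i = 0
    · rw [coeffZ, if_pos h, coeffZ, if_neg, coeffAt, MvPolynomial.lcoeff_apply,
        MvPolynomial.coeff_X_mul', if_neg]
      · simp [hi]
      · intro h2
        have := h2 i
        rw [hb, if_pos rfl, hi] at this
        omega
    · have hi' := h i
      rw [coeffZ, if_pos h, coeffZ, if_pos, coeffAt, MvPolynomial.lcoeff_apply,
        MvPolynomial.coeff_X_mul', if_pos, coeffAt, MvPolynomial.lcoeff_apply]
      · congr 1
        ext j
        simp only [Finsupp.coe_tsub, Pi.sub_apply, Finsupp.equivFunOnFinite_symm_apply_apply,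
          Finsupp.single_apply]
        by_cases hj : j = i
        · subst hj
          simp
        · simp [hj, Ne.symm hj]
      · simp only [Finsupp.mem_support_iff, Finsupp.equivFunOnFinite_symm_apply_apply]
        omega
      · intro j
        rw [hb]
        split_ifs with hj
        · subst hj
          omega
        · exact h j
  · rw [coeffZ, if_neg h, coeffZ, if_neg]
    intro h2
    refine h fun j => ?_
    have := h2 j
    rw [hb] at this
    split_ifs at this <;> omega

theorem coeffZ_add (g h : MvPolynomial (Fin N) ℝ) (b : Fin N → ℤ) :
    coeffZ (g + h) b = coeffZ g b + coeffZ h b := by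
  unfold coeffZ
  split_ifs <;> simp

theorem coeffZ_smul (r : ℝ) (g : MvPolynomial (Fin N) ℝ) (b : Fin N → ℤ) :
    coeffZ (r • g) b = r * coeffZ g b := by
  unfold coeffZ
  split_ifs <;> simp

theorem coeffZ_sum {ι : Type*} (s : Finset ι) (g : ι → MvPolynomial (Fin N) ℝ)
    (b : Fin N → ℤ) : coeffZ (∑ i ∈ s, g i) b = ∑ i ∈ s, coeffZ (g i) b := by
  unfold coeffZ
  split_ifs <;> simp

/-- The sum of a function over all decrements of one coordinate by `k`. -/
def shiftSum (k : ℤ) (h : (Fin N → ℤ) → ℝ) (b : Fin N → ℤ) : ℝ := ∑ i, h (b - Pi.single i k)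

theorem coeffZ_powerSum_one_mul (g : MvPolynomial (Fin N) ℝ) :
    coeffZ (powerSum N 1 * g) = shiftSum 1 (coeffZ g) := by
  ext b
  rw [powerSum, Finset.sum_mul, coeffZ_sum, shiftSum]
  simp_rw [pow_one, coeffZ_X_mul]

theorem single_two_eq (i : Fin N) :
    (Pi.single i 2 : Fin N → ℤ) = Pi.single i 1 + Pi.single i 1 := by
  rw [← Pi.single_add]
  norm_num

theorem coeffZ_powerSum_two_mul (g : MvPolynomial (Fin N) ℝ) :
    coeffZ (powerSum N 2 * g) = shiftSum 2 (coeffZ g) := by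
  ext b
  rw [powerSum, Finset.sum_mul, coeffZ_sum, shiftSum]
  simp_rw [pow_two, mul_assoc, coeffZ_X_mul, single_two_eq, sub_sub]

/-- One step of the recursion for the numerators of the eigenvalues. -/
def stepOp (p : ℝ) (h : (Fin N → ℤ) → ℝ) (b : Fin N → ℤ) : ℝ :=
  p * shiftSum 1 (shiftSum 1 h) b + (1 - p) * shiftSum 2 h b

theorem coeffZ_stepPoly_mul (p : ℝ) (g : MvPolynomial (Fin N) ℝ) :
    coeffZ (stepPoly N p * g) = stepOp p (coeffZ g) := by
  ext b
  rw [stepPoly, add_mul, coeffZ_add, smul_mul_assoc, smul_mul_assoc, coeffZ_smul, coeffZ_smul,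
    pow_two, mul_assoc, coeffZ_powerSum_one_mul, coeffZ_powerSum_one_mul,
    coeffZ_powerSum_two_mul, stepOp]

/-- The coefficients of the Vandermonde alternant. -/
def baseFn (N : ℕ) : (Fin N → ℤ) → ℝ := coeffZ (alternant rho)

/-- The dimension of the irreducible representation indexed by `b - ρ`, extended to an alternating
function. -/
def dimFn (N : ℕ) : ℕ → (Fin N → ℤ) → ℝ
  | 0 => baseFn N
  | k + 1 => shiftSum 1 (dimFn N k)

/-- The dimension times the eigenvalue at `b - ρ`, extended to an alternating function. -/
def eigFn (N : ℕ) (p : ℝ) : ℕ → (Fin N → ℤ) → ℝ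
  | 0 => baseFn N
  | m + 1 => stepOp p (eigFn N p m)

theorem coeffZ_dim (k : ℕ) : coeffZ (alternant rho * powerSum N 1 ^ k) = dimFn N k := by
  induction k with
  | zero => simp [dimFn, baseFn]
  | succ k ih => rw [pow_succ', mul_left_comm, coeffZ_powerSum_one_mul, ih, dimFn]

theorem coeffZ_eig (p : ℝ) (m : ℕ) :
    coeffZ (alternant rho * stepPoly N p ^ m) = eigFn N p m := by
  induction m with
  | zero => simp [eigFn, baseFn]
  | succ k ih => rw [pow_succ', mul_left_comm, coeffZ_stepPoly_mul, ih, eigFn]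

/-- The exponents `λ + ρ`, as integers. -/
def shiftedZ (N : ℕ) (μ : YoungDiagram) : Fin N → ℤ := fun i => (shifted N μ i : ℤ)

theorem eigenvalue_eq_div (p : ℝ) (μ : YoungDiagram) {m : ℕ} (hN : μ.colLen 0 ≤ N)
    (hm : μ.card = 2 * m) :
    eigenvalue p μ = eigFn N p m (shiftedZ N μ) / dimFn N (2 * m) (shiftedZ N μ) := by
  rw [eigenvalue_eq p μ hN hm, ← coeffZ_natCast, ← coeffZ_natCast, ← pow_mul, coeffZ_eig,
    coeffZ_dim]
  rfl

/-- Alternating functions. -/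
def Alternating (h : (Fin N → ℤ) → ℝ) : Prop :=
  ∀ (w : Equiv.Perm (Fin N)) b, h (b ∘ w) = rsign w * h b

theorem Alternating.eq_zero {h : (Fin N → ℤ) → ℝ} (hh : Alternating h) {b : Fin N → ℤ}
    {i j : Fin N} (hij : i ≠ j) (hb : b i = b j) : h b = 0 := by
  have h1 := hh (Equiv.swap i j) b
  have h2 : b ∘ Equiv.swap i j = b := by
    ext k
    rw [Function.comp_apply]
    by_cases hk : k = i
    · rw [hk, Equiv.swap_apply_left, hb]
    by_cases hk' : k = j
    · rw [hk', Equiv.swap_apply_right, hb]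
    rw [Equiv.swap_apply_of_ne_of_ne hk hk']
  rw [h2, rsign_swap hij] at h1
  linarith

theorem Alternating.shiftSum {h : (Fin N → ℤ) → ℝ} (hh : Alternating h) (k : ℤ) :
    Alternating (shiftSum k h) := by
  intro w b
  rw [InvolutionWalk.shiftSum, InvolutionWalk.shiftSum, Finset.mul_sum]
  conv_rhs => rw [← Equiv.sum_comp w]
  refine Finset.sum_congr rfl fun i _ => ?_
  rw [← hh w]
  congr 1
  ext j
  simp only [Pi.sub_apply, Function.comp_apply, Pi.single_apply, w.injective.eq_iff]

theorem Alternating.stepOp {h : (Fin N → ℤ) → ℝ} (hh : Alternating h) (p : ℝ) :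
    Alternating (stepOp p h) := by
  intro w b
  rw [InvolutionWalk.stepOp, InvolutionWalk.stepOp, (hh.shiftSum 1).shiftSum 1 w b,
    hh.shiftSum 2 w b]
  ring

theorem baseFn_eq (b : Fin N → ℤ) :
    baseFn N b = ∑ w : Equiv.Perm (Fin N), rsign w *
      if (fun i => (rho (w i) : ℤ)) = b then 1 else 0 := by
  rw [baseFn, coeffZ]
  split_ifs with h
  · have h1 := coeffAt_alternant_mul_mono (fun i => (b i).toNat) 0
    rw [mono_zero, mul_one] at h1
    rw [h1]
    refine Finset.sum_congr rfl fun w _ => ?_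
    congr 1
    refine if_congr ?_ rfl rfl
    rw [add_zero, funext_iff, funext_iff]
    refine forall_congr' fun i => ?_
    have := h i
    simp only [Function.comp_apply]
    omega
  · symm
    refine Finset.sum_eq_zero fun w _ => ?_
    rw [if_neg, mul_zero]
    rintro rfl
    exact h fun i => Int.natCast_nonneg _

theorem alternating_baseFn : Alternating (baseFn N) := by
  intro w b
  rw [baseFn_eq, baseFn_eq, Finset.mul_sum, ← Equiv.sum_comp (Equiv.mulRight w)]
  refine Finset.sum_congr rfl fun v _ => ?_
  rw [Equiv.coe_mulRight, rsign_mul, mul_comm (rsign v), mul_assoc]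
  congr 2
  refine if_congr ?_ rfl rfl
  constructor
  · intro h
    ext i
    have := congrFun h (w⁻¹ i)
    simpa using this
  · rintro rfl
    ext i
    simp

theorem alternating_dimFn (k : ℕ) : Alternating (dimFn N k) := by
  induction k with
  | zero => exact alternating_baseFn
  | succ k ih => exact ih.shiftSum 1

theorem alternating_eigFn (p : ℝ) (m : ℕ) : Alternating (eigFn N p m) := by
  induction m with
  | zero => exact alternating_baseFn
  | succ k ih => exact ih.stepOp p

theorem dimFn_of_neg (k : ℕ) {b : Fin N → ℤ} {i : Fin N} (hi : b i < 0) : dimFn N k b = 0 := by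
  rw [← coeffZ_dim, coeffZ, if_neg]
  intro h
  exact absurd (h i) (not_le.mpr hi)

theorem eigFn_of_neg (p : ℝ) (m : ℕ) {b : Fin N → ℤ} {i : Fin N} (hi : b i < 0) :
    eigFn N p m b = 0 := by
  rw [← coeffZ_eig, coeffZ, if_neg]
  intro h
  exact absurd (h i) (not_le.mpr hi)

theorem eq_one_of_comp_antitone {b : Fin N → ℤ} (hb : Antitone b) {w : Equiv.Perm (Fin N)}
    (h : (fun i => (rho (w i) : ℤ)) = b) : w = 1 := by
  have h1 : StrictMono w := by
    refine Monotone.strictMono_of_injective (fun i j hij => ?_) w.injective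
    have h2 := hb hij
    rw [← h] at h2
    exact rho_strictAnti.le_iff_ge.mp (Int.ofNat_le.mp h2)
  ext i
  have := congrFun (Subsingleton.elim (h1.orderIsoOfSurjective w w.surjective) (OrderIso.refl _) ▸
    rfl : ⇑(h1.orderIsoOfSurjective w w.surjective) = ⇑(OrderIso.refl (Fin N))) i
  exact congrArg Fin.val this

theorem baseFn_of_antitone {b : Fin N → ℤ} (hb : Antitone b) :
    baseFn N b = if (fun i => (rho i : ℤ)) = b then 1 else 0 := by
  rw [baseFn_eq, Finset.sum_eq_single 1]
  · rw [rsign_one, one_mul]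
    exact if_congr Iff.rfl rfl rfl
  · intro w _ hw
    rw [if_neg, mul_zero]
    exact fun h => hw (eq_one_of_comp_antitone hb h)
  · simp

/-- The double decrement at `i` has weight `p` from `p₁²` and `1 - p` from `p₂`, in total `1`; each
unordered pair of distinct indices occurs twice in `p₁²`. -/
theorem stepOp_eq (p : ℝ) (h : (Fin N → ℤ) → ℝ) (b : Fin N → ℤ) :
    stepOp p h b = ∑ i, (h (b - Pi.single i 2) +
      2 * p * ∑ j ∈ Ioi i, h (b - Pi.single i 1 - Pi.single j 1)) := by
  have h1 := Finset.sum_sum_Ioi_add_eq_sum_sum_off_diag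
    (fun i j => h (b - Pi.single i 1 - Pi.single j 1))
  have h2 : ∀ i, ∑ j, h (b - Pi.single i 1 - Pi.single j 1) = h (b - Pi.single i 2) +
      ∑ j ∈ {i}ᶜ, h (b - Pi.single j 1 - Pi.single i 1) := by
    intro i
    rw [Fintype.sum_eq_add_sum_compl i, single_two_eq, sub_sub]
    congr 1
    refine Finset.sum_congr rfl fun j _ => ?_
    rw [sub_right_comm]
  have h3 : ∀ i, ∑ j ∈ Ioi i, (h (b - Pi.single j 1 - Pi.single i 1) +
      h (b - Pi.single i 1 - Pi.single j 1)) =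
      2 * ∑ j ∈ Ioi i, h (b - Pi.single i 1 - Pi.single j 1) := by
    intro i
    rw [Finset.mul_sum]
    refine Finset.sum_congr rfl fun j _ => ?_
    rw [sub_right_comm]
    ring
  simp only [stepOp, shiftSum]
  simp_rw [h2]
  rw [Finset.sum_add_distrib, ← h1]
  simp_rw [h3]
  rw [Finset.sum_add_distrib, ← Finset.mul_sum, ← Finset.mul_sum]
  ring

theorem antitone_sub_single_sub_single {b : Fin N → ℤ} (hb : StrictAnti b) {i j : Fin N}
    (hij : i ≠ j) : Antitone (b - Pi.single i 1 - Pi.single j 1) := by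
  intro x y hxy
  rcases eq_or_lt_of_le hxy with rfl | hlt
  · exact le_rfl
  have := hb hlt
  simp only [Pi.sub_apply, Pi.single_apply]
  split_ifs <;> omega

theorem antitone_sub_single {b : Fin N → ℤ} (hb : StrictAnti b) (i : Fin N) :
    Antitone (b - Pi.single i 1) := by
  intro x y hxy
  rcases eq_or_lt_of_le hxy with rfl | hlt
  · exact le_rfl
  have := hb hlt
  simp only [Pi.sub_apply, Pi.single_apply]
  split_ifs <;> omega

/-- Exchanging coordinates `i` and `j` carries one argument to the other. -/
theorem Alternating.sub_single_two {h : (Fin N → ℤ) → ℝ} (hh : Alternating h) {b : Fin N → ℤ}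
    {i j : Fin N} (hij : i ≠ j) (hb : b i = b j + 1) :
    h (b - Pi.single i 2) = -h (b - Pi.single i 1 - Pi.single j 1) := by
  have h1 := hh (Equiv.swap i j) (b - Pi.single i 1 - Pi.single j 1)
  rw [rsign_swap hij] at h1
  rw [← neg_one_mul, ← h1]
  congr 1
  ext k
  rw [Function.comp_apply]
  by_cases hk : k = i
  · subst hk
    rw [Equiv.swap_apply_left]
    simp [hij.symm, hb]
    omega
  by_cases hk' : k = j
  · subst hk'
    rw [Equiv.swap_apply_right]
    simp [hij, hij.symm, hb]
  rw [Equiv.swap_apply_of_ne_of_ne hk hk']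
  simp [hk, hk']

/-- A step preserves the alternating functions which are nonnegative on the dominant chamber. -/
theorem stepOp_nonneg {p : ℝ} (hp : 1 / 2 ≤ p) {h : (Fin N → ℤ) → ℝ} (hh : Alternating h)
    (hpos : ∀ b, Antitone b → 0 ≤ h b) (b : Fin N → ℤ) (hb : Antitone b) :
    0 ≤ stepOp p h b := by
  by_cases hb' : Function.Injective b
  · have hs : StrictAnti b := hb.strictAnti_of_injective hb'
    rw [stepOp_eq]
    refine Finset.sum_nonneg fun i _ => ?_
    have h1 : ∀ j ∈ Ioi i, 0 ≤ h (b - Pi.single i 1 - Pi.single j 1) := fun j hj =>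
      hpos _ (antitone_sub_single_sub_single hs (Finset.mem_Ioi.mp hj).ne)
    have h2 := Finset.sum_nonneg h1
    -- Only a later coordinate equal to `b i - 1` can push the double decrement at `i` out of the
    -- chamber. The term is then minus one of the mixed terms, whose weight `2 * p ≥ 1` compensates
    -- for it.
    by_cases h3 : ∃ j, i < j ∧ b i = b j + 1
    · obtain ⟨j, hij, hbj⟩ := h3
      rw [hh.sub_single_two hij.ne hbj]
      have h4 := Finset.single_le_sum h1 (Finset.mem_Ioi.mpr hij)
      nlinarith
    · push Not at h3
      have h4 : Antitone (b - Pi.single i 2) := by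
        intro x y hxy
        rcases eq_or_lt_of_le hxy with rfl | hlt
        · exact le_rfl
        have h5 := hs hlt
        simp only [Pi.sub_apply, Pi.single_apply]
        split_ifs with h6 h7 h7
        · omega
        · omega
        · subst h7
          have := h3 y hlt
          omega
        · omega
      have := hpos _ h4
      positivity
  · simp only [Function.Injective] at hb'
    push Not at hb'
    obtain ⟨i, j, h1, h2⟩ := hb'
    rw [(hh.stepOp p).eq_zero h2 h1]

end Shift

end InvolutionWalk

end

noncomputable section

open Finset

namespace InvolutionWalk

/-! ### The hook length formula and removal of a box from the first row. -/

section Dimension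

variable {N : ℕ}

theorem powerSum_one_pow (N k : ℕ) :
    powerSum N 1 ^ k = ∑ a ∈ piAntidiag univ k, (Nat.multinomial univ a : ℝ) • mono a := by
  rw [powerSum]
  simp_rw [pow_one]
  rw [Finset.sum_pow_eq_sum_piAntidiag]
  refine Finset.sum_congr rfl fun a _ => ?_
  rw [mono_eq_prod, Nat.cast_smul_eq_nsmul, nsmul_eq_mul]

/-- The term of `w` carries the multinomial coefficient `k! / ∏ (bᵢ - ρ_{w i})!`; multiplication by
`∏ bᵢ!` leaves falling factorials. -/
theorem coeffAt_dim_eq_sum (b : Fin N → ℕ) (k : ℕ) (hb : ∑ i, b i = k + ∑ i : Fin N, rho i) :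
    coeffAt b (alternant rho * powerSum N 1 ^ k) * ∏ i, ((b i).factorial : ℝ) =
      k.factorial * ∑ w : Equiv.Perm (Fin N), rsign w * ∏ i, ((b i).descFactorial (rho (w i)) : ℝ) := by
  rw [powerSum_one_pow, Finset.mul_sum, map_sum]
  simp_rw [mul_smul_comm, map_smul, coeffAt_alternant_mul_mono, smul_eq_mul, Finset.mul_sum]
  rw [Finset.sum_comm, Finset.sum_mul]
  refine Finset.sum_congr rfl fun w _ => ?_
  by_cases hw : ∀ i, rho (w i) ≤ b i
  · rw [Finset.sum_eq_single (fun i => b i - rho (w i))]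
    · rw [if_pos]
      · have h1 : ∏ i, ((b i).factorial : ℝ) = (∏ i, ((b i - rho (w i)).factorial : ℝ)) *
            ∏ i, ((b i).descFactorial (rho (w i)) : ℝ) := by
          rw [← Finset.prod_mul_distrib]
          refine Finset.prod_congr rfl fun i _ => ?_
          rw [← Nat.factorial_mul_descFactorial (hw i)]
          push_cast
          rfl
        have h2 : (∏ i, ((b i - rho (w i)).factorial : ℝ)) *
            (Nat.multinomial univ (fun i => b i - rho (w i)) : ℝ) = k.factorial := by
          have h3 := Nat.multinomial_spec univ (fun i => b i - rho (w i))
          have h5 : ∑ i, (b i - rho (w i)) + ∑ i, rho (w i) = ∑ i, b i := by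
            rw [← Finset.sum_add_distrib]
            exact Finset.sum_congr rfl fun i _ => Nat.sub_add_cancel (hw i)
          rw [Equiv.sum_comp w rho] at h5
          have h6 : ∑ i, (b i - rho (w i)) = k := by omega
          rw [h6] at h3
          exact_mod_cast h3
        rw [h1, ← h2]
        ring
      · ext i
        have := hw i
        simp only [Pi.add_apply, Function.comp_apply]
        omega
    · intro a _ ha
      rw [if_neg, mul_zero, mul_zero]
      intro h
      refine ha (funext fun i => ?_)
      have := congrFun h i
      simp only [Pi.add_apply, Function.comp_apply] at this
      omega
    · intro h
      refine absurd ?_ h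
      simp only [mem_piAntidiag, mem_univ, implies_true, and_true]
      have h5 : ∑ i, (b i - rho (w i)) + ∑ i, rho (w i) = ∑ i, b i := by
        rw [← Finset.sum_add_distrib]
        exact Finset.sum_congr rfl fun i _ => Nat.sub_add_cancel (hw i)
      rw [Equiv.sum_comp w rho] at h5
      omega
  · push Not at hw
    obtain ⟨i, hi⟩ := hw
    have h0 : ∏ i, ((b i).descFactorial (rho (w i)) : ℝ) = 0 :=
      Finset.prod_eq_zero (mem_univ i) (by rw [Nat.descFactorial_of_lt hi, Nat.cast_zero])
    rw [h0, mul_zero, mul_zero, Finset.sum_eq_zero, zero_mul]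
    intro a _
    rw [if_neg, mul_zero, mul_zero]
    intro h
    have := congrFun h i
    simp only [Pi.add_apply, Function.comp_apply] at this
    omega

/-- Falling factorials are monic polynomials, so their determinant is Vandermonde's. Both orders of
indices are reversed because `rho` decreases. -/
theorem sum_rsign_descFactorial (b : Fin N → ℕ) :
    ∑ w : Equiv.Perm (Fin N), rsign w * ∏ i, ((b i).descFactorial (rho (w i)) : ℝ) =
      ∏ i, ∏ j ∈ Ioi i, ((b i : ℝ) - b j) := by
  have h1 : ∑ w : Equiv.Perm (Fin N), rsign w * ∏ i, ((b i).descFactorial (rho (w i)) : ℝ) =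
      (Matrix.of fun i j : Fin N => ((b i).descFactorial (rho j) : ℝ)).det := by
    rw [← Matrix.det_transpose, Matrix.det_apply']
    rfl
  have h2 := Matrix.det_eval_matrixOfPolynomials_eq_det_vandermonde
    (fun i : Fin N => (b i.rev : ℝ)) (fun i => descPochhammer ℝ i)
    (fun i => descPochhammer_natDegree ℝ i) (fun i => monic_descPochhammer ℝ i)
  have h3 : (Matrix.of fun i j : Fin N => ((b i).descFactorial (rho j) : ℝ)).det =
      (Matrix.of fun i j : Fin N => ((descPochhammer ℝ (j : ℕ)).eval (b i.rev : ℝ))).det := by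
    rw [← Matrix.det_submatrix_equiv_self Fin.revPerm]
    congr 1
    ext i j
    have := i.2
    have hj : N - (N - ((j : ℕ) + 1) + 1) = j := by omega
    simp [descPochhammer_eval_eq_descFactorial, rho, hj]
  rw [h1, h3, ← h2, Matrix.det_vandermonde]
  rw [Finset.prod_sigma', Finset.prod_sigma']
  refine Finset.prod_bij' (fun x _ => ⟨x.2.rev, x.1.rev⟩) (fun x _ => ⟨x.2.rev, x.1.rev⟩)
    ?_ ?_ ?_ ?_ ?_
  · rintro ⟨i, j⟩ h
    simpa using h
  · rintro ⟨i, j⟩ h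
    simpa using h
  · rintro ⟨i, j⟩ _
    simp
  · rintro ⟨i, j⟩ _
    simp
  · rintro ⟨i, j⟩ _
    simp

/-- The Frobenius form of the hook length formula. -/
theorem dimFn_mul_factorial (b : Fin N → ℕ) (k : ℕ) (hb : ∑ i, b i = k + ∑ i : Fin N, rho i) :
    dimFn N k (fun i => (b i : ℤ)) * ∏ i, ((b i).factorial : ℝ) =
      k.factorial * ∏ i, ∏ j ∈ Ioi i, ((b i : ℝ) - b j) := by
  rw [← sum_rsign_descFactorial, ← coeffAt_dim_eq_sum b k hb, ← coeffZ_natCast, coeffZ_dim]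

theorem dimFn_pos {b : Fin N → ℤ} (hs : StrictAnti b) (h0 : ∀ i, 0 ≤ b i) {k : ℕ}
    (hb : ∑ i, b i = k + ∑ i : Fin N, (rho i : ℤ)) : 0 < dimFn N k b := by
  lift b to Fin N → ℕ using h0
  beta_reduce at hb
  have h1 := dimFn_mul_factorial b k (by exact_mod_cast hb)
  have h2 : 0 < ∏ i, ((b i).factorial : ℝ) := Finset.prod_pos fun i _ => by positivity
  have h3 : 0 < (k.factorial : ℝ) * ∏ i, ∏ j ∈ Ioi i, ((b i : ℝ) - b j) := by
    refine mul_pos (by positivity) (Finset.prod_pos fun i _ => Finset.prod_pos fun j hj => ?_)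
    have h4 : b j < b i := by
      have := hs (mem_Ioi.mp hj)
      beta_reduce at this
      exact_mod_cast this
    exact sub_pos.mpr (by exact_mod_cast h4)
  rw [← h1] at h3
  exact pos_of_mul_pos_left h3 h2.le

theorem dimFn_nonneg {b : Fin N → ℤ} (hs : Antitone b) {k : ℕ}
    (hb : ∑ i, b i = k + ∑ i : Fin N, (rho i : ℤ)) : 0 ≤ dimFn N k b := by
  by_cases h0 : ∀ i, 0 ≤ b i
  · by_cases h1 : Function.Injective b
    · exact (dimFn_pos (hs.strictAnti_of_injective h1) h0 hb).le
    · simp only [Function.Injective] at h1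
      push Not at h1
      obtain ⟨i, j, h2, h3⟩ := h1
      rw [(alternating_dimFn k).eq_zero h3 h2]
  · push Not at h0
    obtain ⟨i, hi⟩ := h0
    rw [dimFn_of_neg k hi]

/-- The ratio of dimensions under removal of a box from the first row. -/
theorem dimFn_sub_first {K : ℕ} {b : Fin (K + 1) → ℤ} (hs : StrictAnti b) (h0 : ∀ i, 0 ≤ b i)
    (hpos : 0 < b 0) {k : ℕ} (hb : ∑ i, b i = (k + 1 : ℕ) + ∑ i : Fin (K + 1), (rho i : ℤ)) :
    dimFn (K + 1) k (b - Pi.single 0 1) * ((k + 1) * ∏ j : Fin K, ((b 0 : ℝ) - b j.succ)) =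
      dimFn (K + 1) (k + 1) b * (b 0 * ∏ j : Fin K, ((b 0 : ℝ) - 1 - b j.succ)) := by
  lift b to Fin (K + 1) → ℕ using h0
  beta_reduce at hb hpos
  have hpos' : 0 < b 0 := by exact_mod_cast hpos
  let b' : Fin (K + 1) → ℕ := fun i => if i = 0 then b 0 - 1 else b i
  have hb' : (fun i => (b' i : ℤ)) = (fun i => (b i : ℤ)) - Pi.single 0 1 := by
    ext i
    simp only [b', Pi.sub_apply, Pi.single_apply]
    split_ifs with h
    · subst h
      push_cast [Nat.cast_sub (Nat.succ_le_of_lt hpos')]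
      rfl
    · simp
  have hsum : ∑ i, b i = (k + 1) + ∑ i : Fin (K + 1), rho i := by exact_mod_cast hb
  have hsum' : ∑ i, b' i = k + ∑ i : Fin (K + 1), rho i := by
    rw [Fin.sum_univ_succ] at hsum ⊢
    simp only [b', if_true, Fin.succ_ne_zero, if_false]
    omega
  have h1 := dimFn_mul_factorial b (k + 1) hsum
  have h2 := dimFn_mul_factorial b' k hsum'
  rw [hb'] at h2
  rw [Fin.prod_univ_succ, Fin.prod_univ_succ (fun i => ∏ j ∈ Ioi i, ((b i : ℝ) - b j)),
    Fin.prod_Ioi_zero] at h1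
  rw [Fin.prod_univ_succ, Fin.prod_univ_succ (fun i => ∏ j ∈ Ioi i, ((b' i : ℝ) - b' j)),
    Fin.prod_Ioi_zero] at h2
  simp_rw [Fin.prod_Ioi_succ] at h1 h2
  simp only [b', if_true, Fin.succ_ne_zero, if_false] at h2
  have h3 : ((b 0).factorial : ℝ) = b 0 * ((b 0 - 1).factorial : ℝ) := by
    rw [← Nat.mul_factorial_pred hpos'.ne']
    push_cast
    rfl
  have h4 : ((b 0 - 1 : ℕ) : ℝ) = (b 0 : ℝ) - 1 := by
    rw [Nat.cast_sub (Nat.succ_le_of_lt hpos'), Nat.cast_one]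
  rw [h4] at h2
  rw [h3, Nat.factorial_succ] at h1
  push_cast at h1
  set P := ∏ i : Fin K, ((b i.succ).factorial : ℝ) with hP
  set V := ∏ i : Fin K, ∏ j ∈ Ioi i, ((b i.succ : ℝ) - b j.succ) with hV
  set F := ((b 0 - 1).factorial : ℝ) with hF
  have hP0 : P ≠ 0 := Finset.prod_ne_zero_iff.mpr fun i _ => by positivity
  have hF0 : F ≠ 0 := by positivity
  have hb0 : (b 0 : ℝ) ≠ 0 := by positivity
  simp only [Int.cast_natCast]
  set A := ∏ j : Fin K, ((b 0 : ℝ) - b j.succ)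
  set B := ∏ j : Fin K, ((b 0 : ℝ) - 1 - b j.succ)
  have hPF : P * F ≠ 0 := mul_ne_zero hP0 hF0
  refine mul_right_cancel₀ hPF ?_
  linear_combination ((k : ℝ) + 1) * A * h2 - B * h1

/-- For `K ≥ 1` the left side is the value of the product at `l = (s, 0, 0, …)`, whose later factors
telescope: concentrating the total in one part is the worst case. The induction step merges `l K`
into that part. -/
theorem prod_ratio_lower_bound {a : ℝ} (ha : 0 < a) (l : ℕ → ℝ) (hl : ∀ j, 0 ≤ l j) (K : ℕ)
    (hs : ∑ j ∈ range K, l j ≤ a) :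
    (a - ∑ j ∈ range K, l j) / (a - ∑ j ∈ range K, l j + 1) * ((a + 1) / (a + K)) ≤
      ∏ j ∈ range K, ((a + j - l j) / (a + j + 1 - l j)) := by
  induction K with
  | zero =>
    simp
    field_simp
    exact le_rfl
  | succ K ih =>
    rw [Finset.sum_range_succ] at hs ⊢
    rw [Finset.prod_range_succ]
    have h1 := ih (by linarith [hl K])
    set s := ∑ j ∈ range K, l j with hsdef
    have hs0 : 0 ≤ s := Finset.sum_nonneg fun j _ => hl j
    set t := l K with ht
    have ht0 : 0 ≤ t := hl K
    have hK : (0 : ℝ) ≤ K := Nat.cast_nonneg K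
    have h2 : 0 ≤ (a + K - t) / (a + K + 1 - t) :=
      div_nonneg (by linarith) (by linarith)
    refine le_trans ?_ (mul_le_mul_of_nonneg_right h1 h2)
    have h3 : 0 < a - s + 1 := by linarith
    have h4 : 0 < a - (s + t) + 1 := by linarith
    have h5 : 0 < a + K := by linarith
    have h6 : 0 < a + K + 1 - t := by linarith
    have h7 : (a - (s + t)) / (a - (s + t) + 1) * ((a + K) / (a + K + 1)) ≤
        (a - s) / (a - s + 1) * ((a + K - t) / (a + K + 1 - t)) := by
      rw [div_mul_div_comm, div_mul_div_comm, div_le_div_iff₀ (by positivity) (by positivity)]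
      have h8 : (a - s) * (a + K - t) * ((a - (s + t) + 1) * (a + K + 1)) -
          (a - (s + t)) * (a + K) * ((a - s + 1) * (a + K + 1 - t)) =
          t * (K + s) * (2 * a + K - s - t + 1) := by
        ring
      have h9 : 0 ≤ t * (K + s) * (2 * a + K - s - t + 1) := by
        refine mul_nonneg (mul_nonneg ht0 (by linarith)) (by linarith)
      linarith
    have h10 := mul_le_mul_of_nonneg_right h7 (by positivity : (0 : ℝ) ≤ (a + 1) / (a + K))
    push_cast
    calc _ = (a - (s + t)) / (a - (s + t) + 1) * ((a + K) / (a + K + 1)) *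
          ((a + 1) / (a + K)) := by
          field_simp
          ring
      _ ≤ _ := h10
      _ = _ := by ring

end Dimension

end InvolutionWalk

end

noncomputable section

open Finset

namespace InvolutionWalk

/-! ### A lower bound for the dimension after removing a box of the first row. -/

section FirstRow

theorem rho_add_val {N : ℕ} (i : Fin N) : rho i + (i : ℕ) + 1 = N := by
  have := i.2
  simp only [rho, Fin.val_rev]
  omega

theorem rho_le_of_strictAnti {N : ℕ} {b : Fin N → ℤ} (hs : StrictAnti b) (h0 : ∀ i, 0 ≤ b i)
    (i : Fin N) : (rho i : ℤ) ≤ b i := by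
  suffices h : ∀ t, ∀ i : Fin N, rho i = t → (t : ℤ) ≤ b i from h _ i rfl
  intro t
  induction t with
  | zero =>
    intro i _
    simpa using h0 i
  | succ t ih =>
    intro i hi
    have h1 := rho_add_val i
    let j : Fin N := ⟨i + 1, by omega⟩
    have h2 : rho j = t := by
      have h3 := rho_add_val j
      have h4 : (j : ℕ) = i + 1 := rfl
      omega
    have h3 := ih j h2
    have h4 : b j < b i := hs (Fin.lt_def.mpr (by simp [j]))
    push_cast
    omega

theorem rho_zero (K : ℕ) : rho (0 : Fin (K + 1)) = K := by
  have := rho_add_val (0 : Fin (K + 1))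
  simpa using this

/-- Here `a` is the first part and `c` the sum of the others; equality holds for `[a, c]`. -/
theorem dimFn_first_row_bound {K : ℕ} {b : Fin (K + 1) → ℤ} (hs : StrictAnti b)
    (h0 : ∀ i, 0 ≤ b i) {k : ℕ} (hb : ∑ i, b i = (k + 1 : ℕ) + ∑ i : Fin (K + 1), (rho i : ℤ))
    {a c : ℝ} (ha : a = b 0 - K) (hc : c = k + 1 - a) (hca : c ≤ a) :
    (a - c) * (a + 1) * dimFn (K + 1) (k + 1) b ≤
      (k + 1) * (a - c + 1) * dimFn (K + 1) k (b - Pi.single 0 1) := by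
  have hk : (0 : ℝ) ≤ k := Nat.cast_nonneg k
  have hK : (0 : ℝ) ≤ K := Nat.cast_nonneg K
  have ha0 : 0 < a := by linarith
  have hbpos : 0 < b 0 := by
    have : (0 : ℝ) < b 0 := by linarith
    exact_mod_cast this
  have h1 := dimFn_sub_first hs h0 hbpos hb
  have hD := dimFn_pos hs h0 hb
  set A := ∏ j : Fin K, ((b 0 : ℝ) - b j.succ) with hA
  set B := ∏ j : Fin K, ((b 0 : ℝ) - 1 - b j.succ) with hB
  have hApos : 0 < A := by
    refine Finset.prod_pos fun j _ => ?_
    have := hs (Fin.succ_pos j)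
    have h2 : (b j.succ : ℝ) < b 0 := by exact_mod_cast this
    linarith
  -- The parts after the first, recovered as `b - ρ`, with value `0` beyond the last index.
  let l : ℕ → ℝ := fun j => if h : j < K then (b (Fin.succ ⟨j, h⟩) : ℝ) - (K - 1 - j) else 0
  have hlj : ∀ j : Fin K, l j = (b j.succ : ℝ) - (K - 1 - j) := by
    intro j
    exact dif_pos j.2
  have hrho : ∀ j : Fin K, (rho j.succ : ℝ) = K - 1 - j := by
    intro j
    have h2 := rho_add_val j.succ
    rw [Fin.val_succ] at h2
    have h3 : (rho j.succ : ℝ) + (j + 1) + 1 = K + 1 := by exact_mod_cast h2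
    linarith
  have hl0 : ∀ j, 0 ≤ l j := by
    intro j
    by_cases h : j < K
    · have h2 := rho_le_of_strictAnti hs h0 (Fin.succ ⟨j, h⟩)
      have h3 : (rho (Fin.succ ⟨j, h⟩) : ℝ) ≤ b (Fin.succ ⟨j, h⟩) := by exact_mod_cast h2
      rw [hrho] at h3
      simp only [l, h, dite_true]
      linarith
    · simp [l, h]
  have hlsum : ∑ j ∈ range K, l j = c := by
    rw [← Fin.sum_univ_eq_sum_range]
    simp_rw [hlj, ← hrho]
    rw [Finset.sum_sub_distrib]
    have h2 : ((∑ i, b i : ℤ) : ℝ) = ((k + 1 : ℕ) + ∑ i : Fin (K + 1), (rho i : ℤ) : ℤ) := by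
      rw [hb]
    push_cast at h2
    rw [Fin.sum_univ_succ, Fin.sum_univ_succ (fun i : Fin (K + 1) => (rho i : ℝ)), rho_zero] at h2
    linarith
  have h2 := prod_ratio_lower_bound ha0 l hl0 K (by rw [hlsum]; exact hca)
  rw [hlsum] at h2
  have h3 : ∏ j ∈ range K, ((a + j - l j) / (a + j + 1 - l j)) = B / A := by
    rw [← Fin.prod_univ_eq_prod_range (fun j => (a + j - l j) / (a + j + 1 - l j)), hA, hB,
      ← Finset.prod_div_distrib]
    refine Finset.prod_congr rfl fun j _ => ?_
    rw [hlj, ha]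
    congr 1 <;> ring
  rw [h3, div_mul_div_comm, div_le_div_iff₀ (by nlinarith) hApos] at h2
  have h4 : (b 0 : ℝ) = a + K := by linarith
  rw [h4] at h1
  have h5 : 0 < a + K := by linarith
  have h6 := mul_le_mul_of_nonneg_left h2 hD.le
  refine le_of_mul_le_mul_right ?_ (mul_pos hApos h5)
  calc _ = (a + K) * 1 * (dimFn (K + 1) (k + 1) b * ((a - c) * (a + 1) * A)) := by ring
    _ ≤ (a + K) * 1 * (dimFn (K + 1) (k + 1) b * (B * ((a - c + 1) * (a + K)))) := by
        exact mul_le_mul_of_nonneg_left h6 (by linarith)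
    _ = (dimFn (K + 1) (k + 1) b * ((a + K) * B)) * ((a - c + 1) * (a + K)) := by ring
    _ = _ := by
        rw [← h1]
        ring

end FirstRow

/-! ### Contents and the character at a transposition. -/

section Content

variable {N : ℕ}

/-- The factor `b i - N` is the content of the last box of row `i`. For distinct entries,
decrementing `b i` can give a rearrangement of `ρ` only if `b i = N`, where the factor vanishes. If
two entries agree, their two terms cancel and the others vanish by alternation. -/
theorem sum_content_baseFn (b : Fin N → ℤ) :
    ∑ i, ((b i : ℝ) - N) * baseFn N (b - Pi.single i 1) = 0 := by
  by_cases hb : Function.Injective b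
  · refine Finset.sum_eq_zero fun i _ => ?_
    by_contra h
    have h1 := right_ne_zero_of_mul h
    rw [baseFn_eq] at h1
    obtain ⟨w, _, hw⟩ := Finset.exists_ne_zero_of_sum_ne_zero h1
    have hw2 : (fun i => (rho (w i) : ℤ)) = b - Pi.single i 1 := by
      by_contra h2
      rw [if_neg h2, mul_zero] at hw
      exact hw rfl
    have h3 : (rho (w i) : ℤ) = b i - 1 := by
      simpa using congrFun hw2 i
    have h4 := rho_add_val (w i)
    by_cases h5 : rho (w i) + 1 < N
    · let t : Fin N := ⟨w i - 1, by omega⟩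
      have h6 : rho t = rho (w i) + 1 := by
        have h7 := rho_add_val t
        have h8 : (t : ℕ) = w i - 1 := rfl
        omega
      have h7 : w.symm t ≠ i := by
        intro h8
        have : w i = t := by rw [← h8]; simp
        rw [← this] at h6
        omega
      have h8 := congrFun hw2 (w.symm t)
      rw [Pi.sub_apply, Pi.single_eq_of_ne h7, sub_zero, Equiv.apply_symm_apply, h6] at h8
      refine h7 (hb ?_)
      rw [← h8]
      push_cast
      omega
    · refine left_ne_zero_of_mul h ?_
      have h6 : b i = N := by omega
      rw [h6]
      simp
  · simp only [Function.Injective] at hb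
    push Not at hb
    obtain ⟨i, j, hbij, hij⟩ := hb
    rw [← Finset.add_sum_erase _ _ (mem_univ i),
      ← Finset.add_sum_erase _ _ (Finset.mem_erase.mpr ⟨hij.symm, mem_univ j⟩)]
    have h1 : baseFn N (b - Pi.single i 1) = -baseFn N (b - Pi.single j 1) := by
      have h2 := alternating_baseFn (Equiv.swap i j) (b - Pi.single j 1)
      rw [rsign_swap hij, neg_one_mul] at h2
      rw [← h2]
      congr 1
      ext k
      rw [Function.comp_apply]
      by_cases hk : k = i
      · subst hk
        rw [Equiv.swap_apply_left]
        simp [hbij]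
      by_cases hk' : k = j
      · subst hk'
        rw [Equiv.swap_apply_right]
        simp [hij, hij.symm, hbij]
      rw [Equiv.swap_apply_of_ne_of_ne hk hk']
      simp [hk, hk']
    rw [h1, hbij, Finset.sum_eq_zero]
    · ring
    · intro l hl
      simp only [mem_erase, mem_univ, and_true] at hl
      rw [alternating_baseFn.eq_zero hij, mul_zero]
      simp [Ne.symm hl.1, Ne.symm hl.2, hbij]

theorem shiftSum_comm (k l : ℤ) (h : (Fin N → ℤ) → ℝ) :
    shiftSum k (shiftSum l h) = shiftSum l (shiftSum k h) := by
  ext b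
  simp only [shiftSum]
  rw [Finset.sum_comm]
  refine Finset.sum_congr rfl fun i _ => Finset.sum_congr rfl fun j _ => ?_
  rw [sub_right_comm]

/-- Commuting the content-weighted removal past a plain removal changes the weight only when both
act on the same coordinate, which leaves `shiftSum 2`. -/
theorem sum_content_recursion (h : (Fin N → ℤ) → ℝ) (b : Fin N → ℤ) :
    ∑ i, ((b i : ℝ) - N) * shiftSum 1 h (b - Pi.single i 1) =
      shiftSum 2 h b + shiftSum 1
        (fun b' => ∑ i, ((b' i : ℝ) - N) * h (b' - Pi.single i 1)) b := by
  have h1 : ∀ j i : Fin N, (((b - Pi.single j 1 : Fin N → ℤ) i : ℤ) : ℝ) =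
      (b i : ℝ) - if i = j then 1 else 0 := by
    intro j i
    rw [Pi.sub_apply, Pi.single_apply]
    split_ifs <;> simp
  simp only [shiftSum]
  simp_rw [h1, Finset.mul_sum]
  rw [Finset.sum_comm, ← Finset.sum_add_distrib]
  refine Finset.sum_congr rfl fun j _ => ?_
  have h2 : h (b - Pi.single j 2) =
      ∑ i, (if i = j then 1 else 0) * h (b - Pi.single j 1 - Pi.single i 1) := by
    simp [single_two_eq, sub_sub]
  rw [h2, ← Finset.sum_add_distrib]
  refine Finset.sum_congr rfl fun i _ => ?_
  rw [sub_right_comm]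
  ring

theorem sum_content_dimFn (k : ℕ) : ∀ b : Fin N → ℤ,
    ∑ i, ((b i : ℝ) - N) * dimFn N (k + 1) (b - Pi.single i 1) =
      (k + 1) * shiftSum 2 (dimFn N k) b := by
  induction k with
  | zero =>
    intro b
    have h := sum_content_recursion (baseFn N) b
    simp_rw [sum_content_baseFn] at h
    change ∑ i, ((b i : ℝ) - N) * shiftSum 1 (baseFn N) (b - Pi.single i 1) =
      (((0 : ℕ) : ℝ) + 1) * shiftSum 2 (baseFn N) b
    rw [h]
    simp [shiftSum]
  | succ k ih =>
    intro b
    have h := sum_content_recursion (dimFn N (k + 1)) b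
    simp_rw [ih] at h
    rw [dimFn, h]
    have h2 : shiftSum 1 (fun b' => ((k : ℝ) + 1) * shiftSum 2 (dimFn N k) b') b =
        (k + 1) * shiftSum 2 (dimFn N (k + 1)) b := by
      rw [dimFn, shiftSum_comm]
      simp only [shiftSum, Finset.mul_sum]
    rw [h2]
    push_cast
    ring

/-- Twice the sum of the contents of the partition `b - ρ`. -/
def twiceContent (b : Fin N → ℤ) : ℝ :=
  ∑ i, ((b i : ℝ) * (b i + 1 - 2 * N) - (rho i : ℝ) * (rho i + 1 - 2 * N))

theorem twiceContent_sub_single (b : Fin N → ℤ) (i : Fin N) :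
    twiceContent b = twiceContent (b - Pi.single i 1) + 2 * ((b i : ℝ) - N) := by
  rw [← sub_eq_iff_eq_add', twiceContent, twiceContent, ← Finset.sum_sub_distrib,
    Finset.sum_eq_single i]
  · simp
    ring
  · intro j _ hj
    simp [hj]
  · simp

theorem twiceContent_mul_baseFn (b : Fin N → ℤ) : twiceContent b * baseFn N b = 0 := by
  by_cases h : baseFn N b = 0
  · rw [h, mul_zero]
  · rw [baseFn_eq] at h
    obtain ⟨w, _, hw⟩ := Finset.exists_ne_zero_of_sum_ne_zero h
    have hw2 : (fun i => (rho (w i) : ℤ)) = b := by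
      by_contra h2
      rw [if_neg h2, mul_zero] at hw
      exact hw rfl
    have h1 : twiceContent b = 0 := by
      rw [← hw2, twiceContent, Finset.sum_sub_distrib, sub_eq_zero]
      simp only [Int.cast_natCast]
      exact Equiv.sum_comp w (fun i => (rho i : ℝ) * (rho i + 1 - 2 * N))
    rw [h1, zero_mul]

theorem twiceContent_mul_dimFn_succ (k : ℕ) (b : Fin N → ℤ) :
    twiceContent b * dimFn N (k + 1) b =
      shiftSum 1 (fun b' => twiceContent b' * dimFn N k b') b +
        2 * ∑ i, ((b i : ℝ) - N) * dimFn N k (b - Pi.single i 1) := by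
  rw [dimFn, shiftSum, shiftSum, Finset.mul_sum, Finset.mul_sum, ← Finset.sum_add_distrib]
  refine Finset.sum_congr rfl fun i _ => ?_
  rw [twiceContent_sub_single b i]
  ring

/-- The character at a transposition in terms of contents. -/
theorem twiceContent_mul_dimFn (k : ℕ) : ∀ b : Fin N → ℤ,
    twiceContent b * dimFn N (k + 2) b = (k + 2) * (k + 1) * shiftSum 2 (dimFn N k) b := by
  induction k with
  | zero =>
    intro b
    have h1 : ∀ b : Fin N → ℤ, twiceContent b * dimFn N 1 b = 0 := by
      intro b
      rw [twiceContent_mul_dimFn_succ, dimFn, sum_content_baseFn]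
      simp [shiftSum, twiceContent_mul_baseFn]
    rw [twiceContent_mul_dimFn_succ, sum_content_dimFn]
    simp only [shiftSum, h1]
    simp
  | succ k ih =>
    intro b
    rw [twiceContent_mul_dimFn_succ, sum_content_dimFn]
    simp_rw [ih]
    have h2 : shiftSum 1 (fun b' => ((k : ℝ) + 2) * (k + 1) * shiftSum 2 (dimFn N k) b') b =
        (k + 2) * (k + 1) * shiftSum 2 (dimFn N (k + 1)) b := by
      rw [dimFn, shiftSum_comm]
      simp only [shiftSum, Finset.mul_sum]
    rw [h2]
    push_cast
    ring

theorem twiceContent_eq (b : Fin N → ℤ) :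
    twiceContent b = ∑ i, ((b i : ℝ) - rho i) * ((b i - rho i) - 1 - 2 * (i : ℕ)) := by
  rw [twiceContent]
  refine Finset.sum_congr rfl fun i _ => ?_
  have h : (rho i : ℝ) + (i : ℕ) + 1 = N := by exact_mod_cast rho_add_val i
  rw [← h]
  ring

end Content

end InvolutionWalk

end

/-! ### Numerators for two-row partitions and their recurrences. -/

noncomputable section

open Finset

namespace InvolutionWalk

/-- The coefficients of `(x + 2 p + x⁻¹) ^ m`. -/
def trinom (p : ℝ) : ℕ → ℤ → ℝ
  | 0, j => if j = 0 then 1 else 0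
  | m + 1, j => trinom p m (j + 1) + 2 * p * trinom p m j + trinom p m (j - 1)

theorem trinom_neg (p : ℝ) (m : ℕ) : ∀ j, trinom p m (-j) = trinom p m j := by
  induction m with
  | zero => intro j; simp [trinom]
  | succ m ih =>
    intro j
    have h1 : trinom p m (-j + 1) = trinom p m (j - 1) := by rw [← ih (j - 1)]; congr 1; ring
    have h2 : trinom p m (-j - 1) = trinom p m (j + 1) := by rw [← ih (j + 1)]; congr 1; ring
    rw [trinom, trinom, h1, h2, ih]
    ring

/-- Coefficient form of `(x + 2p + x⁻¹) · x F' = m (x - x⁻¹) F` for `F = (x + 2p + x⁻¹) ^ m`. -/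
theorem trinom_relation (p : ℝ) (m : ℕ) : ∀ j : ℤ,
    (m + 1 - j) * trinom p m (j - 1) =
      2 * p * j * trinom p m j + (m + 1 + j) * trinom p m (j + 1) := by
  induction m with
  | zero =>
    intro j
    simp only [trinom]
    by_cases h1 : j = 1
    · subst h1
      norm_num
    by_cases h2 : j = 0
    · subst h2
      norm_num
    by_cases h3 : j = -1
    · subst h3
      norm_num
    rw [if_neg (by omega), if_neg (by omega), if_neg (by omega)]
    ring
  | succ m ih =>
    intro j
    have h1 := ih (j + 1)
    have h2 := ih (j - 1)
    have h3 := ih j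
    simp only [trinom]
    rw [show j + 1 - 1 = j by ring] at h1 ⊢
    rw [show j - 1 + 1 = j by ring] at h2 ⊢
    push_cast at h1 h2 h3 ⊢
    linear_combination h1 + h2 + 2 * p * h3

/-- The numerator of the eigenvalue at the partition `[m + k, m - k]`, as an odd function about
`k = -1/2`. -/
def twoRowNum (p : ℝ) (m : ℕ) (j : ℤ) : ℝ := trinom p m j - trinom p m (j + 1)

theorem twoRowNum_succ (p : ℝ) (m : ℕ) (j : ℤ) : twoRowNum p (m + 1) j =
    twoRowNum p m (j + 1) + 2 * p * twoRowNum p m j + twoRowNum p m (j - 1) := by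
  simp only [twoRowNum, trinom]
  rw [show j + 1 - 1 = j by ring, show j - 1 + 1 = j by ring]
  ring

theorem twoRowNum_reflect (p : ℝ) (m : ℕ) (j : ℤ) :
    twoRowNum p m (-1 - j) = -twoRowNum p m j := by
  rw [twoRowNum, twoRowNum, ← trinom_neg p m (-1 - j), ← trinom_neg p m (-1 - j + 1)]
  rw [show -(-1 - j) = j + 1 by ring, show -(-1 - j + 1) = j by ring]
  ring

theorem twoRowNum_succ_zero (p : ℝ) (m : ℕ) :
    twoRowNum p (m + 1) 0 = twoRowNum p m 1 + (2 * p - 1) * twoRowNum p m 0 := by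
  have h := twoRowNum_reflect p m 0
  rw [twoRowNum_succ, show (0 : ℤ) - 1 = -1 - 0 by ring, h]
  norm_num
  ring

/-- At `k = 0` reflection turns the neighbour `-1` into minus the value at `0`, which leaves the
weight `2 * p - 1 ≥ 0`. -/
theorem twoRowNum_nonneg {p : ℝ} (hp : 1 / 2 ≤ p) (m : ℕ) :
    ∀ k : ℕ, 0 ≤ twoRowNum p m k := by
  induction m with
  | zero =>
    intro k
    simp only [twoRowNum, trinom]
    rw [if_neg (by omega : ¬((k : ℤ) + 1 = 0)), sub_zero]
    split_ifs <;> norm_num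
  | succ m ih =>
    intro k
    cases k with
    | zero =>
      have h0 := ih 0
      have h1 := ih 1
      push_cast at h0 h1 ⊢
      rw [twoRowNum_succ_zero]
      have : 0 ≤ (2 * p - 1) * twoRowNum p m 0 := mul_nonneg (by linarith) h0
      linarith
    | succ k =>
      have h0 := ih k
      have h1 := ih (k + 1)
      have h2 := ih (k + 2)
      push_cast at h1 h2 ⊢
      rw [twoRowNum_succ, show (k : ℤ) + 1 + 1 = k + 2 by ring, add_sub_cancel_right]
      positivity

theorem twoRowNum_eq_zero (p : ℝ) (m : ℕ) : ∀ k : ℤ, (m : ℤ) < k → twoRowNum p m k = 0 := by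
  induction m with
  | zero =>
    intro k hk
    simp only [twoRowNum, trinom]
    rw [if_neg (by push_cast at hk; omega), if_neg (by push_cast at hk; omega), sub_zero]
  | succ m ih =>
    intro k hk
    push_cast at hk
    rw [twoRowNum_succ, ih _ (by omega), ih _ (by omega), ih _ (by omega)]
    ring

/-- The three term recurrence for the Motzkin-type numbers `twoRowNum p m 0`. -/
theorem twoRowNum_zero_recurrence (p : ℝ) (m : ℕ) :
    (m + 3) * twoRowNum p (m + 2) 0 =
      (2 * (2 * p - 1) + 4 * p * (m + 1)) * twoRowNum p (m + 1) 0 +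
        (m + 1) * (2 + 2 * p) * (2 - 2 * p) * twoRowNum p m 0 := by
  have h1 := trinom_relation p m 1
  have h2 := trinom_relation p m 2
  rw [twoRowNum_succ_zero, twoRowNum_succ_zero, twoRowNum_succ]
  simp only [twoRowNum]
  norm_num at h1 h2 ⊢
  linear_combination -2 * h1 + h2

theorem twoRowNum_zero_small (p : ℝ) : twoRowNum p 0 0 = 1 ∧ twoRowNum p 1 0 = 2 * p - 1 ∧
    twoRowNum p 2 0 = 1 + (2 * p - 1) ^ 2 ∧
    twoRowNum p 3 0 = 1 + 3 * (2 * p - 1) + (2 * p - 1) ^ 3 := by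
  refine ⟨?_, ?_, ?_, ?_⟩ <;> norm_num [twoRowNum, trinom] <;> ring

/-- The constant `2 + 2 * p` is the value of `x + 2p + x⁻¹` at `x = 1`. The recurrence carries the
bound from `m - 1` to `m + 1`, so two chains are needed; they start at `m = 0` and `m = 3`, since at
`m = 1` the bound fails for `p < 2/3`. -/
theorem twoRowNum_zero_succ_le {p : ℝ} (hp : 1 / 2 ≤ p) (hp1 : p ≤ 1) (m : ℕ) (hm : m ≠ 1) :
    twoRowNum p (m + 1) 0 ≤ (2 + 2 * p) * twoRowNum p m 0 := by
  have key : ∀ m : ℕ, 1 ≤ m → twoRowNum p m 0 ≤ (2 + 2 * p) * twoRowNum p (m - 1) 0 →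
      twoRowNum p (m + 2) 0 ≤ (2 + 2 * p) * twoRowNum p (m + 1) 0 := by
    intro m hm1 h
    obtain ⟨l, rfl⟩ : ∃ l, m = l + 1 := ⟨m - 1, by omega⟩
    rw [Nat.add_sub_cancel] at h
    have h1 := twoRowNum_zero_recurrence p l
    have h2 := twoRowNum_zero_recurrence p (l + 1)
    have hI0 := twoRowNum_nonneg hp (l + 1) 0
    push_cast at h2 hI0
    set x := twoRowNum p (l + 1) 0
    set y := twoRowNum p (l + 1 + 1) 0
    set z := twoRowNum p (l + 1 + 2) 0
    set w := twoRowNum p l 0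
    have hl : (0 : ℝ) ≤ l := Nat.cast_nonneg l
    have h3 : ((2 + 2 * p) * (l + 1) + 2 * (2 * p - 1)) * x ≤ (l + 3) * y := by
      have : 0 ≤ (l + 1 : ℝ) * (2 - 2 * p) * ((2 + 2 * p) * w - x) :=
        mul_nonneg (mul_nonneg (by positivity) (by linarith)) (by linarith)
      nlinarith
    have h5 : 0 ≤ (l + 2 : ℝ) * (2 - 2 * p) + 6 := by nlinarith
    have h6 := mul_le_mul_of_nonneg_left h3 h5
    have h7 : 0 ≤ (((l + 2 : ℝ) * (2 - 2 * p) + 6) * ((2 + 2 * p) * (l + 1) + 2 * (2 * p - 1)) -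
        (l + 3) * ((l + 2) * (2 + 2 * p) * (2 - 2 * p))) * x := by
      refine mul_nonneg ?_ hI0
      have e : (((l + 2 : ℝ) * (2 - 2 * p) + 6) * ((2 + 2 * p) * (l + 1) + 2 * (2 * p - 1)) -
        (l + 3) * ((l + 2) * (2 + 2 * p) * (2 - 2 * p))) =
        6 * (4 * p * l + (10 * p - 4)) := by ring
      rw [e]
      have : 0 ≤ 4 * p * l := by positivity
      linarith
    change z ≤ (2 + 2 * p) * y
    have h8 : (l + 3 : ℝ) * (l + 4) * ((2 + 2 * p) * y - z) =
        (((l + 2 : ℝ) * (2 - 2 * p) + 6) * ((l + 3) * y) - ((l + 2 : ℝ) * (2 - 2 * p) + 6) *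
        (((2 + 2 * p) * (l + 1) + 2 * (2 * p - 1)) * x)) +
        ((((l + 2 : ℝ) * (2 - 2 * p) + 6) * ((2 + 2 * p) * (l + 1) + 2 * (2 * p - 1)) -
        (l + 3) * ((l + 2) * (2 + 2 * p) * (2 - 2 * p))) * x) := by
      linear_combination -(l + 3 : ℝ) * h2
    have h9 : 0 ≤ (l + 3 : ℝ) * (l + 4) * ((2 + 2 * p) * y - z) := by
      rw [h8]
      linarith
    have h10 := nonneg_of_mul_nonneg_right h9 (by positivity)
    linarith
  obtain ⟨s0, s1, s2, s3⟩ := twoRowNum_zero_small p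
  have s4 := twoRowNum_zero_recurrence p 2
  have main : ∀ t : ℕ, twoRowNum p (2 * t + 1) 0 ≤ (2 + 2 * p) * twoRowNum p (2 * t) 0 ∧
      twoRowNum p (2 * t + 4) 0 ≤ (2 + 2 * p) * twoRowNum p (2 * t + 3) 0 := by
    intro t
    induction t with
    | zero =>
      norm_num at s4 ⊢
      constructor
      · rw [s0, s1]
        linarith
      · rw [s2, s3] at s4
        rw [s3]
        nlinarith [mul_nonneg (mul_nonneg (by linarith : (0 : ℝ) ≤ 2 * p - 1)
          (by linarith : (0 : ℝ) ≤ 2 - 2 * p)) (by linarith : (0 : ℝ) ≤ 2 * p - 1),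
          mul_nonneg (by linarith : (0 : ℝ) ≤ 2 * p - 1)
          (by linarith : (0 : ℝ) ≤ 2 - 2 * p),
          pow_nonneg (by linarith : (0 : ℝ) ≤ 2 * p - 1) 3]
    | succ t ih =>
      exact ⟨key (2 * t + 1) (by omega) ih.1, key (2 * t + 4) (by omega) ih.2⟩
  rcases Nat.even_or_odd' m with ⟨t, rfl | rfl⟩
  · exact (main t).1
  · obtain ⟨s, rfl⟩ : ∃ s, t = s + 1 := ⟨t - 1, by omega⟩
    exact (main s).2

end InvolutionWalk

end

/-! ### Two-row eigenvalues and their monotonicity in the first row. -/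

noncomputable section

open Finset

namespace InvolutionWalk

/-- The eigenvalue at the partition `[m + k, m - k]` (and `1` for `k > m`), by its recursion. -/
def psi (p : ℝ) : ℕ → ℕ → ℝ
  | 0, _ => 1
  | m + 1, 0 => (3 * (m + 1) * m * psi p m 1 + (2 * p - 1) * (m + 1) * (m + 2) * psi p m 0) /
      ((2 * m + 2) * (2 * m + 1))
  | m + 1, k + 1 =>
    if k ≤ m then
      (((m : ℝ) - k) * (m - k - 1) * (2 * k + 5) * psi p m (k + 2) +
        2 * p * ((m : ℝ) - k) * (m + k + 3) * (2 * k + 3) * psi p m (k + 1) +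
        (m + k + 3) * (m + k + 2) * (2 * k + 1) * psi p m k) /
      ((2 * m + 2) * (2 * m + 1) * (2 * k + 3))
    else 1

theorem psi_succ_zero (p : ℝ) (m : ℕ) : (2 * m + 2) * (2 * m + 1) * psi p (m + 1) 0 =
    3 * (m + 1) * m * psi p m 1 + (2 * p - 1) * (m + 1) * (m + 2) * psi p m 0 := by
  rw [psi]
  field_simp

theorem psi_succ_succ (p : ℝ) {m k : ℕ} (hk : k ≤ m) :
    (2 * m + 2) * (2 * m + 1) * (2 * k + 3) * psi p (m + 1) (k + 1) =
      ((m : ℝ) - k) * (m - k - 1) * (2 * k + 5) * psi p m (k + 2) +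
        2 * p * ((m : ℝ) - k) * (m + k + 3) * (2 * k + 3) * psi p m (k + 1) +
        (m + k + 3) * (m + k + 2) * (2 * k + 1) * psi p m k := by
  rw [psi, if_pos hk]
  field_simp

theorem psi_of_le (p : ℝ) (m : ℕ) : ∀ k, m ≤ k → psi p m k = 1 := by
  induction m with
  | zero => intro k _; rw [psi]
  | succ m ih =>
    intro k hk
    obtain ⟨k, rfl⟩ : ∃ l, k = l + 1 := ⟨k - 1, by omega⟩
    by_cases hkm : k ≤ m
    · obtain rfl : k = m := by omega
      have h := psi_succ_succ p hkm
      rw [ih k le_rfl] at h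
      have h1 : (0 : ℝ) < (2 * k + 2) * (2 * k + 1) * (2 * k + 3) := by positivity
      refine mul_left_cancel₀ h1.ne' ?_
      rw [h]
      ring
    · rw [psi, if_neg hkm]

theorem sub_mul_sub_one_nonneg {m k : ℕ} (hk : k ≤ m) : (0 : ℝ) ≤ ((m : ℝ) - k) * (m - k - 1) := by
  obtain ⟨d, rfl⟩ := Nat.exists_eq_add_of_le hk
  rcases d with _ | d
  · simp
  · push_cast
    rw [show (k : ℝ) + (d + 1) - k = d + 1 by ring, add_sub_cancel_right]
    positivity

theorem psi_nonneg {p : ℝ} (hp : 1 / 2 ≤ p) (m : ℕ) : ∀ k, 0 ≤ psi p m k := by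
  induction m with
  | zero => intro k; rw [psi]; norm_num
  | succ m ih =>
    intro k
    rcases k with _ | k
    · rw [psi]
      have h0 := ih 0
      have h1 := ih 1
      have : (0 : ℝ) ≤ (2 * p - 1) := by linarith
      positivity
    · rw [psi]
      split_ifs with hk
      · have h1 := sub_mul_sub_one_nonneg hk
        have h2 : (0 : ℝ) ≤ (m : ℝ) - k := sub_nonneg.mpr (by exact_mod_cast hk)
        have h3 := ih k
        have h4 := ih (k + 1)
        have h5 := ih (k + 2)
        positivity
      · norm_num

/-- By the hook length formula `[m + k, m - k]` has dimension `(2m)! (2k + 1) / ((2k + d + 1)! d!)`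
with `d = m - k`, so this identifies `psi` as numerator over dimension. -/
theorem twoRowNum_mul_factorial (p : ℝ) (m : ℕ) : ∀ k d : ℕ, m = k + d →
    twoRowNum p m k * ((2 * k + d + 1).factorial * d.factorial) =
      (2 * m).factorial * (2 * k + 1) * psi p m k := by
  induction m with
  | zero =>
    intro k d h
    obtain rfl : k = 0 := by omega
    obtain rfl : d = 0 := by omega
    norm_num [twoRowNum, trinom, psi]
  | succ m ih =>
    intro k d h
    have hf : ((2 * (m + 1)).factorial : ℝ) = (2 * m + 2) * (2 * m + 1) * (2 * m).factorial := by
      rw [show 2 * (m + 1) = 2 * m + 1 + 1 by ring, Nat.factorial_succ, Nat.factorial_succ]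
      push_cast
      ring
    rw [hf]
    rcases k with _ | k
    · obtain rfl : d = m + 1 := by omega
      have h0 := ih 0 m (by omega)
      have e0 : ((2 * 0 + (m + 1) + 1).factorial : ℝ) =
          (m + 2) * (2 * 0 + m + 1).factorial := by
        rw [show 2 * 0 + (m + 1) + 1 = 2 * 0 + m + 1 + 1 by ring, Nat.factorial_succ]
        push_cast
        ring
      have e1 : ((m + 1).factorial : ℝ) = (m + 1) * m.factorial := by
        rw [Nat.factorial_succ]
        push_cast
        ring
      have h1 : twoRowNum p m 1 * ((2 * 0 + (m + 1) + 1).factorial * (m + 1).factorial) =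
          3 * (m + 1) * m * (2 * m).factorial * psi p m 1 := by
        rcases m with _ | m
        · rw [twoRowNum_eq_zero p 0 1 (by norm_num)]
          norm_num
        · have h := ih 1 m (by ring)
          have e1 : ((m + 1 + 1).factorial : ℝ) = (m + 2) * (m + 1) * m.factorial := by
            rw [Nat.factorial_succ, Nat.factorial_succ]
            push_cast
            ring
          have e2 : (2 * 0 + (m + 1 + 1) + 1) = 2 * 1 + m + 1 := by ring
          rw [e1, e2]
          push_cast at h ⊢
          linear_combination ((m : ℝ) + 2) * (m + 1) * h
      have hs := psi_succ_zero p m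
      push_cast at h0 ⊢
      rw [twoRowNum_succ_zero, add_mul, h1, e0, e1]
      linear_combination (2 * p - 1) * (m + 2) * (m + 1) * h0 - ((2 * m).factorial : ℝ) * hs
    · have hk : k ≤ m := by omega
      have hs := psi_succ_succ p hk
      have hd : (d : ℝ) = m - k := by
        have : ((m + 1 : ℕ) : ℝ) = ((k + 1 + d : ℕ) : ℝ) := by rw [h]
        push_cast at this
        linarith
      have h0 := ih k d (by omega)
      have e0 : ((2 * (k + 1) + d + 1).factorial : ℝ) =
          (m + k + 3) * (m + k + 2) * (2 * k + d + 1).factorial := by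
        rw [show 2 * (k + 1) + d + 1 = 2 * k + d + 1 + 1 + 1 by ring, Nat.factorial_succ,
          Nat.factorial_succ]
        push_cast
        rw [hd]
        ring
      have h1 : twoRowNum p m (k + 1) * ((2 * (k + 1) + d + 1).factorial * d.factorial) =
          (m - k) * (m + k + 3) * (2 * m).factorial * (2 * k + 3) * psi p m (k + 1) := by
        rcases d with _ | d
        · rw [twoRowNum_eq_zero p m (k + 1) (by omega), ← hd]
          norm_num
        · have h := ih (k + 1) d (by omega)
          rw [show 2 * (k + 1) + (d + 1) + 1 = 2 * (k + 1) + d + 1 + 1 by ring,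
            Nat.factorial_succ (2 * (k + 1) + d + 1), Nat.factorial_succ d, ← hd]
          have e : (m : ℝ) + k + 3 = 2 * (k + 1) + d + 1 + 1 := by
            push_cast at hd
            linarith
          rw [e]
          push_cast at h ⊢
          linear_combination (2 * (k + 1) + (d : ℝ) + 1 + 1) * (d + 1) * h
      have h2 : twoRowNum p m (k + 2) * ((2 * (k + 1) + d + 1).factorial * d.factorial) =
          (m - k) * (m - k - 1) * (2 * m).factorial * (2 * k + 5) * psi p m (k + 2) := by
        rcases d with _ | _ | d
        · rw [twoRowNum_eq_zero p m (k + 2) (by omega), ← hd]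
          norm_num
        · rw [twoRowNum_eq_zero p m (k + 2) (by omega), ← hd]
          norm_num
        · have h := ih (k + 2) d (by omega)
          rw [show 2 * (k + 1) + (d + 1 + 1) + 1 = 2 * (k + 2) + d + 1 by ring,
            Nat.factorial_succ (d + 1), Nat.factorial_succ d, ← hd]
          push_cast at h ⊢
          linear_combination ((d : ℝ) + 1) * (d + 2) * h
      push_cast at h0 ⊢
      rw [twoRowNum_succ, show (k : ℤ) + 1 + 1 = k + 2 by ring, add_sub_cancel_right, add_mul,
        add_mul, mul_assoc (2 * p), h1, h2, e0]
      linear_combination ((m : ℝ) + k + 3) * (m + k + 2) * h0 - ((2 * m).factorial : ℝ) * hs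

/-- Cleared of dimensions, the claim is `h6`. By the three-term recurrence the difference of its
sides is `(m + 1)(2 - 2p)` times the slack in `twoRowNum_zero_succ_le`. -/
theorem psi_zero_le_psi_one {p : ℝ} (hp : 1 / 2 ≤ p) (hp1 : p ≤ 1) {m : ℕ} (hm : m ≠ 2) :
    psi p m 0 ≤ psi p m 1 := by
  rcases m with _ | m
  · rw [psi, psi]
  have h1 := twoRowNum_mul_factorial p (m + 1) 0 (m + 1) (by ring)
  have h2 := twoRowNum_mul_factorial p (m + 1) 1 m (by ring)
  have h3 := twoRowNum_zero_succ_le hp hp1 m (by omega)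
  have h4 := twoRowNum_zero_recurrence p m
  have h5 := twoRowNum_succ_zero p (m + 1)
  have e0 : ((2 * 1 + m + 1).factorial : ℝ) = (m + 3) * (2 * 0 + (m + 1) + 1).factorial := by
    rw [show 2 * 1 + m + 1 = 2 * 0 + (m + 1) + 1 + 1 by ring, Nat.factorial_succ]
    push_cast
    ring
  have e1 : ((m + 1).factorial : ℝ) = (m + 1) * m.factorial := by
    rw [Nat.factorial_succ]
    push_cast
    ring
  rw [e1] at h1
  rw [e0] at h2
  have hA : (0 : ℝ) < (2 * 0 + (m + 1) + 1).factorial := by positivity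
  have hB : (0 : ℝ) < m.factorial := by positivity
  have hC : (0 : ℝ) < (2 * (m + 1)).factorial := by positivity
  generalize ((2 * 0 + (m + 1) + 1).factorial : ℝ) = A at *
  generalize (m.factorial : ℝ) = B at *
  generalize ((2 * (m + 1)).factorial : ℝ) = C at *
  push_cast at h1 h2
  have h6 : 3 * (m + 1) * twoRowNum p (m + 1) 0 ≤ (m + 3) * twoRowNum p (m + 1) 1 := by
    have : 0 ≤ (m + 1 : ℝ) * (2 - 2 * p) *
        ((2 + 2 * p) * twoRowNum p m 0 - twoRowNum p (m + 1) 0) :=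
      mul_nonneg (mul_nonneg (by positivity) (by linarith)) (by linarith)
    have e : twoRowNum p (m + 2) 0 = twoRowNum p (m + 1 + 1) 0 := rfl
    rw [e, h5] at h4
    nlinarith
  have h7 := mul_le_mul_of_nonneg_left h6 (mul_pos hA hB).le
  have h8 : 3 * C * psi p (m + 1) 0 ≤ 3 * C * psi p (m + 1) 1 := by
    nlinarith
  exact le_of_mul_le_mul_left h8 (by positivity)

/-- For positive second index, the increment at level `m + 1` is, up to a positive factor, a
combination of three consecutive increments at level `m` and a multiple of `1 - p`, all with
nonnegative coefficients; this is `key`. -/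
theorem psi_le_psi_succ {p : ℝ} (hp : 1 / 2 ≤ p) (hp1 : p ≤ 1) (m : ℕ) :
    ∀ k, (m = 2 → 1 ≤ k) → psi p m k ≤ psi p m (k + 1) := by
  induction m with
  | zero => intro k _; rw [psi, psi]
  | succ m ih =>
    intro k hmk
    rcases k with _ | k
    · exact psi_zero_le_psi_one hp hp1 fun h => absurd (hmk h) (by norm_num)
    by_cases hkm : m ≤ k
    · rw [psi_of_le p _ _ (by omega), psi_of_le p _ _ (by omega)]
    push Not at hkm
    have hk1 := psi_succ_succ p hkm.le
    have hk2 := psi_succ_succ p (show k + 1 ≤ m from hkm)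
    have hy := psi_nonneg hp m (k + 1)
    have h3 := ih (k + 1) (by omega)
    have h4 := ih (k + 2) (by omega)
    -- This case would use the increment at `m = 2`, `k = 0`, which can be negative.
    by_cases h2 : m = 2 ∧ k = 0
    · obtain ⟨rfl, rfl⟩ := h2
      norm_num [psi]
      nlinarith [mul_nonneg (by linarith : (0 : ℝ) ≤ 1 - p) (by linarith : (0 : ℝ) ≤ 2 * p - 1)]
    have h5 := ih k (by omega)
    obtain ⟨b, rfl⟩ : ∃ b, m = k + (b + 1) := ⟨m - k - 1, by omega⟩
    push_cast at hk1 hk2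
    rw [show k + 1 + 2 = k + 3 by ring, show k + 1 + 1 = k + 2 by ring] at *
    rw [show k + 2 + 1 = k + 3 by ring] at *
    have hK : (0 : ℝ) ≤ k := Nat.cast_nonneg k
    have hB : (0 : ℝ) ≤ b := Nat.cast_nonneg b
    have hbb : (0 : ℝ) ≤ (b : ℝ) * (b - 1) := by
      have := sub_mul_sub_one_nonneg (Nat.zero_le b)
      simpa using this
    generalize psi p (k + (b + 1) + 1) (k + 1) = s at *
    generalize psi p (k + (b + 1) + 1) (k + 2) = t at *
    generalize psi p (k + (b + 1)) k = y0 at *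
    generalize psi p (k + (b + 1)) (k + 1) = y1 at *
    generalize psi p (k + (b + 1)) (k + 2) = y2 at *
    generalize psi p (k + (b + 1)) (k + 3) = y3 at *
    generalize (k : ℝ) = K at *
    generalize (b : ℝ) = B at *
    have t1 : 0 ≤ B * (B - 1) * ((2 * K + 7) * (2 * K + 3)) * (y3 - y2) :=
      mul_nonneg (mul_nonneg hbb (by positivity)) (by linarith)
    have t2 : 0 ≤ (B * (B * (4 * K ^ 2 + 16 * K + 11) +
        (4 * K ^ 2 + 16 * K + 11 + (2 * K + 3) * (4 * K ^ 2 + 14 * K + 6)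
          + (2 * p - 1) * ((2 * K + B + 5) * (2 * K + 5) * (2 * K + 3)) ))) * (y2 - y1) := by
      refine mul_nonneg ?_ (by linarith)
      have : 0 ≤ 2 * p - 1 := by linarith
      positivity
    have t3 : 0 ≤ ((2 * K + B + 4) * (2 * K + B + 3) * (2 * K + 1) * (2 * K + 5)) * (y1 - y0) :=
      mul_nonneg (by positivity) (by linarith)
    have t4 : 0 ≤ ((2 * K + 3) * (2 * K + 5) * (1 - p) * (4 * K + 8)) * y1 := by
      have : 0 ≤ 1 - p := by linarith
      positivity
    have key : (2 * (K + (B + 1)) + 2) * (2 * (K + (B + 1)) + 1) * (2 * K + 3) * (2 * K + 5) *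
        (t - s) =
        B * (B - 1) * ((2 * K + 7) * (2 * K + 3)) * (y3 - y2) +
        (B * (B * (4 * K ^ 2 + 16 * K + 11) +
        (4 * K ^ 2 + 16 * K + 11 + (2 * K + 3) * (4 * K ^ 2 + 14 * K + 6)
          + (2 * p - 1) * ((2 * K + B + 5) * (2 * K + 5) * (2 * K + 3)) ))) * (y2 - y1) +
        ((2 * K + B + 4) * (2 * K + B + 3) * (2 * K + 1) * (2 * K + 5)) * (y1 - y0) +
        ((2 * K + 3) * (2 * K + 5) * (1 - p) * (4 * K + 8)) * y1 := by
      linear_combination (2 * K + 3) * hk2 - (2 * K + 5) * hk1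
    have h6 := nonneg_of_mul_nonneg_right (a := (2 * (K + (B + 1)) + 2) *
      (2 * (K + (B + 1)) + 1) * (2 * K + 3) * (2 * K + 5)) (b := t - s)
      (by rw [key]; linarith) (by positivity)
    linarith

end InvolutionWalk

end

/-! ### Explicit values for partitions with two or three rows. -/

noncomputable section

open Finset

namespace InvolutionWalk

theorem stepOp_two (p : ℝ) (h : (Fin 2 → ℤ) → ℝ) (x y : ℤ) :
    stepOp p h ![x, y] = h ![x - 2, y] + h ![x, y - 2] + 2 * p * h ![x - 1, y - 1] := by
  have e : ∀ x y x' y' : ℤ, (![x, y] : Fin 2 → ℤ) - ![x', y'] = ![x - x', y - y'] := by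
    intro x y x' y'
    simp
  have s0 : ∀ k : ℤ, (Pi.single 0 k : Fin 2 → ℤ) = ![k, 0] := by
    intro k; ext i; fin_cases i <;> simp
  have s1 : ∀ k : ℤ, (Pi.single 1 k : Fin 2 → ℤ) = ![0, k] := by
    intro k; ext i; fin_cases i <;> simp
  rw [stepOp_eq, Fin.sum_univ_two, show Ioi (0 : Fin 2) = {1} by decide,
    show Ioi (1 : Fin 2) = ∅ by decide, sum_singleton, sum_empty, s0, s0, s1, s1, e, e, e, e]
  simp only [sub_zero]
  ring

theorem stepOp_three (p : ℝ) (h : (Fin 3 → ℤ) → ℝ) (x y z : ℤ) :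
    stepOp p h ![x, y, z] = h ![x - 2, y, z] + h ![x, y - 2, z] + h ![x, y, z - 2] +
      2 * p * (h ![x - 1, y - 1, z] + h ![x - 1, y, z - 1] + h ![x, y - 1, z - 1]) := by
  have e : ∀ x y z x' y' z' : ℤ, (![x, y, z] : Fin 3 → ℤ) - ![x', y', z'] =
      ![x - x', y - y', z - z'] := by
    intro x y z x' y' z'
    simp
  have s0 : ∀ k : ℤ, (Pi.single 0 k : Fin 3 → ℤ) = ![k, 0, 0] := by
    intro k; ext i; fin_cases i <;> simp
  have s1 : ∀ k : ℤ, (Pi.single 1 k : Fin 3 → ℤ) = ![0, k, 0] := by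
    intro k; ext i; fin_cases i <;> simp
  have s2 : ∀ k : ℤ, (Pi.single 2 k : Fin 3 → ℤ) = ![0, 0, k] := by
    intro k; ext i; fin_cases i <;> simp
  rw [stepOp_eq, Fin.sum_univ_three, show Ioi (0 : Fin 3) = {1, 2} by decide,
    show Ioi (1 : Fin 3) = {2} by decide, show Ioi (2 : Fin 3) = ∅ by decide,
    sum_pair (by decide), sum_singleton, sum_empty, s0, s0, s1, s1, s2, s2]
  simp only [e, sub_zero]
  ring

theorem Alternating.swap_two {h : (Fin 2 → ℤ) → ℝ} (hh : Alternating h) (x y : ℤ) :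
    h ![y, x] = -h ![x, y] := by
  have h1 := hh (Equiv.swap 0 1) ![x, y]
  rw [rsign_swap (by decide), neg_one_mul] at h1
  rw [← h1]
  congr 1
  ext i
  fin_cases i <;> simp

theorem Alternating.swap_three {h : (Fin 3 → ℤ) → ℝ} (hh : Alternating h) (x y z : ℤ) :
    h ![y, x, z] = -h ![x, y, z] ∧ h ![x, z, y] = -h ![x, y, z] := by
  constructor
  · have h1 := hh (Equiv.swap 0 1) ![x, y, z]
    rw [rsign_swap (by decide), neg_one_mul] at h1
    rw [← h1]
    congr 1
    ext i
    fin_cases i <;> simp [Equiv.swap_apply_of_ne_of_ne]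
  · have h1 := hh (Equiv.swap 1 2) ![x, y, z]
    rw [rsign_swap (by decide), neg_one_mul] at h1
    rw [← h1]
    congr 1
    ext i
    fin_cases i <;> simp [Equiv.swap_apply_of_ne_of_ne]

/-- For `[m + k, m - k]` the first exponent is `x = m + k + 1`. The reflection symmetry of
`twoRowNum` matches the alternation in `x` and `y`. -/
theorem eigFn_two (p : ℝ) (m : ℕ) : ∀ x y : ℤ, x + y = 2 * m + 1 →
    eigFn 2 p m ![x, y] = twoRowNum p m (x - m - 1) := by
  induction m with
  | zero =>
    have h0 : ∀ x y : ℤ, x + y = 1 → y < x →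
        eigFn 2 p 0 ![x, y] = twoRowNum p 0 (x - 0 - 1) := by
      intro x y h hlt
      have ha : Antitone ![x, y] := by
        rw [Fin.antitone_iff_succ_le]
        intro i
        fin_cases i
        simpa using hlt.le
      rw [eigFn, baseFn_of_antitone ha]
      simp only [twoRowNum, trinom]
      rw [if_neg (by omega : ¬(x - 0 - 1 + 1 = 0)), sub_zero]
      refine if_congr ?_ rfl rfl
      constructor
      · intro h2
        have := congrFun h2 0
        simp [rho] at this
        omega
      · intro h2
        obtain rfl : x = 1 := by omega
        obtain rfl : y = 0 := by omega
        ext i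
        fin_cases i <;> simp [rho]
    intro x y h
    push_cast at h ⊢
    rcases lt_or_ge y x with hlt | hge
    · exact h0 x y (by omega) hlt
    · rw [(alternating_eigFn p 0).swap_two y x, h0 y x (by omega) (by omega),
        ← twoRowNum_reflect]
      congr 1
      omega
  | succ m ih =>
    intro x y h
    push_cast at h ⊢
    rw [eigFn, stepOp_two, ih _ _ (by omega), ih _ _ (by omega), ih _ _ (by omega),
      twoRowNum_succ]
    ring_nf

theorem eigFn_two_eq_psi (p : ℝ) (k d : ℕ) :
    eigFn 2 p (k + d) ![((2 * k + d + 1 : ℕ) : ℤ), (d : ℤ)] =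
      psi p (k + d) k * dimFn 2 (2 * (k + d)) ![((2 * k + d + 1 : ℕ) : ℤ), (d : ℤ)] := by
  have h1 := dimFn_mul_factorial (N := 2) ![2 * k + d + 1, d] (2 * (k + d)) (by
    simp [Fin.sum_univ_two, rho]; ring)
  have e : (fun i => ((![2 * k + d + 1, d] : Fin 2 → ℕ) i : ℤ)) =
      ![((2 * k + d + 1 : ℕ) : ℤ), (d : ℤ)] := by
    ext i
    fin_cases i <;> simp
  rw [e, Fin.prod_univ_two, Fin.prod_univ_two, show Ioi (0 : Fin 2) = {1} by decide,
    show Ioi (1 : Fin 2) = ∅ by decide, prod_singleton, prod_empty] at h1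
  simp only [Matrix.cons_val_zero, Matrix.cons_val_one] at h1
  have h2 := twoRowNum_mul_factorial p (k + d) k d rfl
  rw [eigFn_two p (k + d) _ _ (by push_cast; ring)]
  have e2 : ((2 * k + d + 1 : ℕ) : ℤ) - ((k + d : ℕ) : ℤ) - 1 = k := by push_cast; ring
  rw [e2]
  have h3 : (0 : ℝ) < (2 * k + d + 1).factorial * d.factorial := by positivity
  refine mul_right_cancel₀ h3.ne' ?_
  rw [h2, mul_assoc (psi _ _ _), h1]
  push_cast
  ring

theorem dimFn_three {m x y z : ℕ} (h : x + y + z = m + 3) :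
    dimFn 3 m ![(x : ℤ), y, z] * (x.factorial * y.factorial * z.factorial) =
      m.factorial * (((x : ℝ) - y) * (x - z) * (y - z)) := by
  have h1 := dimFn_mul_factorial (N := 3) ![x, y, z] m (by
    simp [Fin.sum_univ_three, rho, h])
  have e : (fun i => ((![x, y, z] : Fin 3 → ℕ) i : ℤ)) = ![(x : ℤ), y, z] := by
    ext i
    fin_cases i <;> simp
  rw [e, Fin.prod_univ_three, Fin.prod_univ_three, show Ioi (0 : Fin 3) = {1, 2} by decide,
    show Ioi (1 : Fin 3) = {2} by decide, show Ioi (2 : Fin 3) = ∅ by decide,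
    prod_pair (by decide), prod_singleton, prod_empty] at h1
  simp at h1
  linarith

/-- The exponents `(5, 3, 1)` and `(6, 2, 1)` are `μ + ρ` for `[3, 2, 1]` and `[4, 1, 1]`, the two
partitions of `6` that need an exact value. -/
theorem dimFn_three_six : dimFn 3 6 ![5, 3, 1] = 16 ∧ dimFn 3 6 ![6, 2, 1] = 10 := by
  have h1 := dimFn_three (m := 6) (x := 5) (y := 3) (z := 1) rfl
  have h2 := dimFn_three (m := 6) (x := 6) (y := 2) (z := 1) rfl
  norm_num [Nat.factorial] at h1 h2
  constructor <;> linarith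

theorem eigFn_three_three (p : ℝ) : eigFn 3 p 3 ![5, 3, 1] = 2 * (2 * p) ^ 3 ∧
    eigFn 3 p 3 ![6, 2, 1] = 1 + 6 * (2 * p - 1) + 3 * (2 * p - 1) ^ 2 := by
  have z01 : ∀ m (x z : ℤ), eigFn 3 p m ![x, x, z] = 0 := fun m x z =>
    (alternating_eigFn p m).eq_zero (show (0 : Fin 3) ≠ 1 by decide) rfl
  have z12 : ∀ m (x z : ℤ), eigFn 3 p m ![z, x, x] = 0 := fun m x z =>
    (alternating_eigFn p m).eq_zero (show (1 : Fin 3) ≠ 2 by decide) rfl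
  have n1 : ∀ m (x z : ℤ), eigFn 3 p m ![x, -1, z] = 0 := fun m x z =>
    eigFn_of_neg (i := (1 : Fin 3)) p m (by simp)
  have n2 : ∀ m (x z : ℤ), eigFn 3 p m ![x, z, -1] = 0 := fun m x z =>
    eigFn_of_neg (i := (2 : Fin 3)) p m (by simp)
  have n3 : ∀ m (x z : ℤ), eigFn 3 p m ![x, z, -2] = 0 := fun m x z =>
    eigFn_of_neg (i := (2 : Fin 3)) p m (by simp)
  have b0 : eigFn 3 p 0 ![2, 1, 0] = 1 := by
    have ha : Antitone (![2, 1, 0] : Fin 3 → ℤ) := by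
      rw [Fin.antitone_iff_succ_le]
      intro i
      fin_cases i <;> simp
    rw [eigFn, baseFn_of_antitone ha, if_pos]
    ext i
    fin_cases i <;> simp [rho]
  have b1 := ((alternating_eigFn p 0).swap_three 2 1 0).1
  have c0 : eigFn 3 p 1 ![3, 2, 0] = 2 * p - 1 := by
    rw [eigFn, stepOp_three]
    norm_num
    rw [b1, z12, n3, b0, n2, n2]
    ring
  have c1 : eigFn 3 p 1 ![4, 1, 0] = 1 := by
    rw [eigFn, stepOp_three]
    norm_num
    rw [b0, n1, n3, z12, n2, n2]
    ring
  have c2 := ((alternating_eigFn p 1).swap_three 4 1 0).2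
  have d0 : eigFn 3 p 2 ![4, 2, 1] = 2 * p * (2 * p - 1) + (2 * p - 1) := by
    rw [eigFn, stepOp_three]
    norm_num
    rw [z01, c2, n2, z12, c0, c1]
    ring
  have c3 := ((alternating_eigFn p 1).swap_three 3 2 0).1
  have d1 : eigFn 3 p 2 ![4, 3, 0] = 2 * p * (2 * p - 1) - (2 * p - 1) + 1 := by
    rw [eigFn, stepOp_three]
    norm_num
    rw [c3, c1, n3, n2, n2, c0]
    ring
  have d2 : eigFn 3 p 2 ![5, 2, 0] = 2 * p * 1 + (2 * p - 1) := by
    rw [eigFn, stepOp_three]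
    norm_num
    rw [c0, z12, n3, n2, n2, c1]
    ring
  have c4 := ((alternating_eigFn p 2).swap_three 6 1 0).2
  have d3 : eigFn 3 p 2 ![6, 1, 0] = 1 := by
    rw [eigFn, stepOp_three]
    norm_num
    rw [c1, n1, n3, z12, n2, n2]
    ring
  constructor
  · rw [eigFn, stepOp_three]
    norm_num
    rw [z01, z12, n2, d0, d1, d2]
    ring
  · rw [eigFn, stepOp_three]
    norm_num
    rw [d0, c4, n2, z12, d2, d3]
    ring

theorem shiftedZ_strictAnti (N : ℕ) (μ : YoungDiagram) : StrictAnti (shiftedZ N μ) := by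
  intro i j h
  have := shifted_strictAnti N μ h
  simp only [shiftedZ]
  exact_mod_cast this

theorem shiftedZ_nonneg (N : ℕ) (μ : YoungDiagram) (i : Fin N) : 0 ≤ shiftedZ N μ i :=
  Int.natCast_nonneg _

theorem sum_shiftedZ {N : ℕ} {μ : YoungDiagram} {n : ℕ} (hn : μ.card = n) (hN : μ.colLen 0 ≤ N) :
    ∑ i, shiftedZ N μ i = n + ∑ i : Fin N, (rho i : ℤ) := by
  subst hn
  have := sum_shifted (filling μ) hN
  simp only [shiftedZ]
  exact_mod_cast this

/-- It lets a bound over all partitions be used at every strictly decreasing exponent. -/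
theorem exists_shiftedZ_eq {N : ℕ} {b : Fin N → ℤ} (hs : StrictAnti b) (h0 : ∀ i, 0 ≤ b i) :
    ∃ μ : YoungDiagram, μ.colLen 0 ≤ N ∧ shiftedZ N μ = b := by
  have hr := rho_le_of_strictAnti hs h0
  set w : List ℕ := List.ofFn fun i => (b i - rho i).toNat with hw
  have hsort : w.SortedGE := by
    rw [List.sortedGE_iff_pairwise, hw, List.pairwise_ofFn]
    intro i j hij
    have h1 := rho_add_val i
    have h2 := rho_add_val j
    have h4 : ∀ t : ℕ, ∀ i j : Fin N, (j : ℕ) = i + t → b j + t ≤ b i := by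
      intro t
      induction t with
      | zero =>
        intro i j h
        obtain rfl : j = i := Fin.ext (by omega)
        simp
      | succ t ih =>
        intro i j h
        have h5 := ih i ⟨i + t, by omega⟩ rfl
        have h6 := hs (show (⟨i + t, by omega⟩ : Fin N) < j by rw [Fin.lt_def]; simp; omega)
        push_cast
        omega
    have h3 := h4 (j - i) i j (by rw [Fin.lt_def] at hij; omega)
    rw [Fin.lt_def] at hij
    omega
  refine ⟨YoungDiagram.ofRowLens w hsort, ?_, ?_⟩
  · by_contra h
    push Not at h
    rw [← YoungDiagram.mem_iff_lt_colLen, YoungDiagram.mem_ofRowLens] at h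
    obtain ⟨h, -⟩ := h
    simp [hw] at h
  · ext i
    have h1 := YoungDiagram.rowLen_ofRowLens (hw := hsort) ⟨i, by simp [hw]⟩
    have h2 := hr i
    rw [shiftedZ, shifted, h1]
    simp [hw]
    omega

theorem sum_rowLen {N : ℕ} {μ : YoungDiagram} (hN : μ.colLen 0 ≤ N) :
    ∑ i : Fin N, μ.rowLen i = μ.card := by
  have h := sum_shifted (filling μ) hN
  simp only [shifted, Finset.sum_add_distrib] at h
  omega

theorem eigenvalue_of_colLen_le_two (p : ℝ) {μ : YoungDiagram} {m : ℕ} (hN : μ.colLen 0 ≤ 2)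
    (hm : μ.card = 2 * m) : eigenvalue p μ = psi p m (μ.rowLen 0 - m) := by
  have h1 := sum_rowLen hN
  have h2 := μ.rowLen_anti 0 1 (by norm_num)
  rw [Fin.sum_univ_two, hm] at h1
  simp only [Fin.val_zero, Fin.val_one] at h1
  obtain ⟨k, hk⟩ : ∃ k, μ.rowLen 0 = μ.rowLen 1 + 2 * k := ⟨m - μ.rowLen 1, by omega⟩
  obtain rfl : m = k + μ.rowLen 1 := by omega
  have e : shiftedZ 2 μ = ![((2 * k + μ.rowLen 1 + 1 : ℕ) : ℤ), (μ.rowLen 1 : ℤ)] := by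
    ext i
    fin_cases i
    · simp [shiftedZ, shifted, rho, hk]
      ring
    · simp [shiftedZ, shifted, rho]
  have h3 := dimFn_pos (shiftedZ_strictAnti 2 μ) (shiftedZ_nonneg 2 _) (sum_shiftedZ hm hN)
  rw [eigenvalue_eq_div p _ hN hm]
  rw [e] at h3 ⊢
  rw [eigFn_two_eq_psi, mul_div_assoc, div_self h3.ne', mul_one, hk]
  congr 1
  omega

theorem eigenvalue_twoRows (p : ℝ) (m : ℕ) : eigenvalue p (twoRows m) = psi p m 0 := by
  have hcol : (twoRows m).colLen 0 ≤ 2 := by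
    by_contra h
    push Not at h
    rw [← YoungDiagram.mem_iff_lt_colLen, twoRows, YoungDiagram.mem_ofRowLens] at h
    obtain ⟨h, -⟩ := h
    simp at h
  have h0 : (twoRows m).rowLen 0 = m :=
    YoungDiagram.rowLen_ofRowLens (w := [m, m]) (hw := by simp [List.sortedGE_iff_pairwise])
      ⟨0, by simp⟩
  rw [eigenvalue_of_colLen_le_two p hcol (card_twoRows m), h0, Nat.sub_self]

end InvolutionWalk

end

noncomputable section

open Finset

namespace InvolutionWalk

/-! ### Propagating a bound that depends only on the first row. -/

section FirstRowSplit

variable {K : ℕ}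

theorem iSup_eq_of_forall_le {b : Fin (K + 1) → ℤ} {x : ℤ} (i : Fin (K + 1)) (hi : b i = x)
    (h : ∀ j, b j ≤ x) : ⨆ j, b j = x :=
  le_antisymm (ciSup_le h) (hi ▸ le_ciSup (Set.finite_range b).bddAbove i)

/-- The terms of a step which decrement the first coordinate once. -/
def mixedSum (h : (Fin (K + 1) → ℤ) → ℝ) (b : Fin (K + 1) → ℤ) : ℝ :=
  ∑ j : Fin K, h (b - Pi.single 0 1 - Pi.single j.succ 1)

/-- The terms of a step which do not decrement the first coordinate. -/
def restSum (p : ℝ) (h : (Fin (K + 1) → ℤ) → ℝ) (b : Fin (K + 1) → ℤ) : ℝ :=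
  ∑ i : Fin K, (h (b - Pi.single i.succ 2) +
    2 * p * ∑ j ∈ Ioi i.succ, h (b - Pi.single i.succ 1 - Pi.single j 1))

theorem stepOp_split (p : ℝ) (h : (Fin (K + 1) → ℤ) → ℝ) (b : Fin (K + 1) → ℤ) :
    stepOp p h b = h (b - Pi.single 0 2) + 2 * p * mixedSum h b + restSum p h b := by
  rw [stepOp_eq, Fin.sum_univ_succ, Fin.sum_Ioi_zero, mixedSum, restSum]

/-- The supremum of the coordinates is the symmetric extension of the first coordinate, so
multiplying by a function of it keeps a function alternating. Only after the double decrement at `0`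
can another coordinate be the largest, hence the separate `x`. -/
theorem stepOp_iSup_mul (p : ℝ) (φ : ℤ → ℝ) (h : (Fin (K + 1) → ℤ) → ℝ)
    {b : Fin (K + 1) → ℤ} (hb : StrictAnti b) {x : ℤ}
    (hx : ⨆ i, (b - Pi.single 0 2 : Fin (K + 1) → ℤ) i = x) :
    stepOp p (fun b' => φ (⨆ i, b' i) * h b') b =
      φ x * h (b - Pi.single 0 2) + φ (b 0 - 1) * (2 * p * mixedSum h b) +
        φ (b 0) * restSum p h b := by
  have h1 : ∀ j : Fin K,
      ⨆ i, (b - Pi.single 0 1 - Pi.single j.succ 1 : Fin (K + 1) → ℤ) i = b 0 - 1 := by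
    intro j
    have h2 : (b - Pi.single 0 1 - Pi.single j.succ 1 : Fin (K + 1) → ℤ) 0 = b 0 - 1 := by
      simp [(Fin.succ_ne_zero j).symm]
    refine iSup_eq_of_forall_le 0 h2 fun i => ?_
    rw [← h2]
    exact antitone_sub_single_sub_single hb (Fin.succ_ne_zero j).symm (Fin.zero_le i)
  have h3 : ∀ (i : Fin K) (j : Fin (K + 1)), j ∈ Ioi i.succ →
      ⨆ k, (b - Pi.single i.succ 1 - Pi.single j 1 : Fin (K + 1) → ℤ) k = b 0 := by
    intro i j hj
    rw [Finset.mem_Ioi] at hj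
    have hj0 : j ≠ 0 := ((Fin.succ_pos i).trans hj).ne'
    refine iSup_eq_of_forall_le 0 ?_ fun k => ?_
    · simp [(Fin.succ_ne_zero i).symm, hj0.symm]
    · refine le_trans ?_ (hb.antitone (Fin.zero_le k))
      simp only [Pi.sub_apply, Pi.single_apply]
      split_ifs <;> omega
  have h4 : ∀ i : Fin K, ⨆ k, (b - Pi.single i.succ 2 : Fin (K + 1) → ℤ) k = b 0 := by
    intro i
    refine iSup_eq_of_forall_le 0 ?_ fun k => ?_
    · simp [(Fin.succ_ne_zero i).symm]
    · refine le_trans ?_ (hb.antitone (Fin.zero_le k))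
      simp only [Pi.sub_apply, Pi.single_apply]
      split_ifs <;> omega
  rw [stepOp_split, mixedSum, restSum, hx]
  simp_rw [h1, h4]
  rw [mixedSum, restSum, Finset.mul_sum univ _ (φ (b 0)), ← Finset.mul_sum univ _ (φ (b 0 - 1))]
  have h5 : ∀ i : Fin K, (φ (b 0) * h (b - Pi.single i.succ 2) + 2 * p *
      ∑ j ∈ Ioi i.succ, φ (⨆ k, (b - Pi.single i.succ 1 - Pi.single j 1 : Fin (K + 1) → ℤ) k) *
        h (b - Pi.single i.succ 1 - Pi.single j 1)) =
      φ (b 0) * (h (b - Pi.single i.succ 2) +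
        2 * p * ∑ j ∈ Ioi i.succ, h (b - Pi.single i.succ 1 - Pi.single j 1)) := by
    intro i
    have : ∀ j ∈ Ioi i.succ,
        φ (⨆ k, (b - Pi.single i.succ 1 - Pi.single j 1 : Fin (K + 1) → ℤ) k) *
        h (b - Pi.single i.succ 1 - Pi.single j 1) =
        φ (b 0) * h (b - Pi.single i.succ 1 - Pi.single j 1) := by
      intro j hj
      rw [h3 i j hj]
    rw [Finset.sum_congr rfl this, ← Finset.mul_sum]
    ring
  rw [Finset.sum_congr rfl fun i _ => h5 i]
  ring

theorem sum_sub_single (b : Fin (K + 1) → ℤ) (i : Fin (K + 1)) (k : ℤ) :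
    ∑ j, (b - Pi.single i k : Fin (K + 1) → ℤ) j = ∑ j, b j - k := by
  simp [Finset.sum_sub_distrib]

theorem stepOp_congr (p : ℝ) {h h' : (Fin (K + 1) → ℤ) → ℝ} {b : Fin (K + 1) → ℤ}
    (hh : ∀ b' : Fin (K + 1) → ℤ, ∑ i, b' i = ∑ i, b i - 2 → h b' = h' b') :
    stepOp p h b = stepOp p h' b := by
  rw [stepOp_eq, stepOp_eq]
  refine Finset.sum_congr rfl fun i _ => ?_
  congr 1
  · exact hh _ (sum_sub_single b i 2)
  · congr 1
    refine Finset.sum_congr rfl fun j _ => hh _ ?_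
    rw [sum_sub_single, sum_sub_single]
    ring

theorem stepOp_sub (p : ℝ) (h h' : (Fin (K + 1) → ℤ) → ℝ) (b : Fin (K + 1) → ℤ) :
    stepOp p (fun b' => h b' - h' b') b = stepOp p h b - stepOp p h' b := by
  simp only [stepOp, shiftSum, Finset.sum_sub_distrib]
  ring

/-- An upper bound for the eigenvalues depending only on the first row passes to the next step. -/
theorem eigFn_succ_le {p : ℝ} (hp : 1 / 2 ≤ p) {m : ℕ} {φ : ℤ → ℝ}
    (hφ : ∀ b : Fin (K + 1) → ℤ, Antitone b →
      ∑ i, b i = (2 * m : ℕ) + ∑ i : Fin (K + 1), (rho i : ℤ) →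
      eigFn (K + 1) p m b ≤ φ (b 0) * dimFn (K + 1) (2 * m) b)
    {b : Fin (K + 1) → ℤ} (hb : Antitone b)
    (hsum : ∑ i, b i = (2 * m + 2 : ℕ) + ∑ i : Fin (K + 1), (rho i : ℤ)) :
    eigFn (K + 1) p (m + 1) b ≤
      stepOp p (fun b' => φ (⨆ i, b' i) * dimFn (K + 1) (2 * m) b') b := by
  classical
  set S : ℤ := (2 * m : ℕ) + ∑ i : Fin (K + 1), (rho i : ℤ) with hS
  -- The slack in the assumed bound, set to `0` off the level `S` so that it is nonnegative on the
  -- whole chamber.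
  set h : (Fin (K + 1) → ℤ) → ℝ := fun b' => if ∑ i, b' i = S then
    φ (⨆ i, b' i) * dimFn (K + 1) (2 * m) b' - eigFn (K + 1) p m b' else 0 with hh
  have halt : Alternating h := by
    intro w b'
    have h1 : ∑ i, (b' ∘ w) i = ∑ i, b' i := Equiv.sum_comp w b'
    have h2 : ⨆ i, (b' ∘ w) i = ⨆ i, b' i := Equiv.iSup_comp (g := b') w
    simp only [hh]
    rw [h1, h2, alternating_dimFn (2 * m) w, alternating_eigFn p m w]
    split_ifs <;> ring
  have hpos : ∀ b', Antitone b' → 0 ≤ h b' := by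
    intro b' hb'
    simp only [hh]
    split_ifs with h1
    · rw [iSup_eq_of_forall_le 0 rfl fun j => hb' (Fin.zero_le j)]
      exact sub_nonneg.mpr (hφ b' hb' h1)
    · exact le_rfl
  have h1 := stepOp_nonneg hp halt hpos b hb
  rw [stepOp_congr p (h' := fun b' => φ (⨆ i, b' i) * dimFn (K + 1) (2 * m) b' -
    eigFn (K + 1) p m b'), stepOp_sub] at h1
  · rw [eigFn]
    linarith
  · intro b' hb'
    simp only [hh]
    rw [if_pos]
    rw [hb', hsum, hS]
    push_cast
    ring

end FirstRowSplit

end InvolutionWalk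

end

noncomputable section

open Finset

namespace InvolutionWalk

/-! ### Estimates of the three parts of a step applied to dimensions. -/

section StepBounds

variable {K : ℕ}

theorem stepOp_dimFn {N : ℕ} (p : ℝ) (k : ℕ) (b : Fin N → ℤ) :
    (k + 2) * (k + 1) * stepOp p (dimFn N k) b =
      (p * ((k + 2) * (k + 1)) + (1 - p) * twiceContent b) * dimFn N (k + 2) b := by
  have h := twiceContent_mul_dimFn k b
  have h1 : stepOp p (dimFn N k) b =
    p * dimFn N (k + 2) b + (1 - p) * shiftSum 2 (dimFn N k) b := rfl
  rw [h1]
  linear_combination (p - 1) * h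

theorem restSum_le_one {p : ℝ} (hp1 : p ≤ 1) {b : Fin (K + 1) → ℤ} (hs : StrictAnti b) {k : ℕ}
    (hsum : ∑ i, b i = (k + 2 : ℕ) + ∑ i : Fin (K + 1), (rho i : ℤ)) :
    restSum p (dimFn (K + 1) k) b ≤ restSum 1 (dimFn (K + 1) k) b := by
  refine Finset.sum_le_sum fun i _ => ?_
  have h1 : 0 ≤ ∑ j ∈ Ioi i.succ,
      dimFn (K + 1) k (b - Pi.single i.succ 1 - Pi.single j 1) := by
    refine Finset.sum_nonneg fun j hj => dimFn_nonneg
      (antitone_sub_single_sub_single hs (Finset.mem_Ioi.mp hj).ne) ?_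
    rw [sum_sub_single, sum_sub_single, hsum]
    push_cast
    ring
  nlinarith

/-- For `p = 1` a step removes two boxes in succession. Those that avoid the first row are the
removals starting outside it, less those ending in it. -/
theorem restSum_one_eq (k : ℕ) (b : Fin (K + 1) → ℤ) :
    restSum 1 (dimFn (K + 1) k) b = ∑ i : Fin K, (dimFn (K + 1) (k + 1) (b - Pi.single i.succ 1) -
      dimFn (K + 1) k (b - Pi.single i.succ 1 - Pi.single 0 1)) := by
  have h1 : stepOp 1 (dimFn (K + 1) k) b = dimFn (K + 1) (k + 2) b := by
    have : stepOp 1 (dimFn (K + 1) k) b =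
      1 * dimFn (K + 1) (k + 2) b + (1 - 1) * shiftSum 2 (dimFn (K + 1) k) b := rfl
    rw [this]
    ring
  have h2 : dimFn (K + 1) (k + 2) b = dimFn (K + 1) (k + 1) (b - Pi.single 0 1) +
      ∑ i : Fin K, dimFn (K + 1) (k + 1) (b - Pi.single i.succ 1) := by
    rw [dimFn, shiftSum, Fin.sum_univ_succ]
  have h3 : dimFn (K + 1) (k + 1) (b - Pi.single 0 1) =
      dimFn (K + 1) k (b - Pi.single 0 2) + mixedSum (dimFn (K + 1) k) b := by
    rw [dimFn, shiftSum, Fin.sum_univ_succ, mixedSum, single_two_eq, sub_sub]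
  have h4 : mixedSum (dimFn (K + 1) k) b =
      ∑ i : Fin K, dimFn (K + 1) k (b - Pi.single i.succ 1 - Pi.single 0 1) := by
    rw [mixedSum]
    exact Finset.sum_congr rfl fun i _ => by rw [sub_right_comm]
  rw [stepOp_split] at h1
  rw [Finset.sum_sub_distrib, ← h4]
  linarith

theorem dimFn_not_first_row_bound {b : Fin (K + 1) → ℤ} (hs : StrictAnti b) (h0 : ∀ i, 0 ≤ b i)
    {k : ℕ} (hb : ∑ i, b i = (k + 1 : ℕ) + ∑ i : Fin (K + 1), (rho i : ℤ))
    {a c : ℝ} (ha : a = b 0 - K) (hc : c = k + 1 - a) (hca : c ≤ a) :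
    (k + 1) * (a - c + 1) *
      (dimFn (K + 1) (k + 1) b - dimFn (K + 1) k (b - Pi.single 0 1)) ≤
      c * (a - c + 2) * dimFn (K + 1) (k + 1) b := by
  have h := dimFn_first_row_bound hs h0 hb ha hc hca
  have e : (k : ℝ) + 1 = a + c := by linarith
  rw [e] at h ⊢
  linarith

/-- `dimFn_not_first_row_bound` is used twice: for the second box, with `c - 1` boxes outside the
first row, and for the first box, with `c`. Equality holds for `[a, c]`. -/
theorem restSum_bound {b : Fin (K + 1) → ℤ} (hs : StrictAnti b) (h0 : ∀ i, 0 ≤ b i)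
    {k : ℕ} (hb : ∑ i, b i = (k + 2 : ℕ) + ∑ i : Fin (K + 1), (rho i : ℤ))
    {a c : ℕ} (ha : b 0 = a + K) (hac : a + c = k + 2) (hca : c ≤ a) :
    (k + 2) * (k + 1) * ((a : ℝ) - c + 1) * restSum 1 (dimFn (K + 1) k) b ≤
      c * (c - 1) * (a - c + 3) * dimFn (K + 1) (k + 2) b := by
  have haR : (a : ℝ) = b 0 - K := by
    rw [ha]
    push_cast
    ring
  have hacR : (a : ℝ) + c = k + 2 := by exact_mod_cast hac
  have hcaR : (c : ℝ) ≤ a := by exact_mod_cast hca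
  have hsum1 : ∀ i : Fin (K + 1), ∑ j, (b - Pi.single i 1 : Fin (K + 1) → ℤ) j =
      (k + 1 : ℕ) + ∑ i : Fin (K + 1), (rho i : ℤ) := by
    intro i
    rw [sum_sub_single, hb]
    push_cast
    ring
  have hi : ∀ i : Fin K, (k + 1) * ((a : ℝ) - c + 2) *
      (dimFn (K + 1) (k + 1) (b - Pi.single i.succ 1) -
        dimFn (K + 1) k (b - Pi.single i.succ 1 - Pi.single 0 1)) ≤
      (c - 1) * (a - c + 3) * dimFn (K + 1) (k + 1) (b - Pi.single i.succ 1) := by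
    intro i
    have hanti := antitone_sub_single hs i.succ
    by_cases hinj : Function.Injective (b - Pi.single i.succ 1)
    · by_cases hneg : ∀ j, 0 ≤ (b - Pi.single i.succ 1 : Fin (K + 1) → ℤ) j
      · have h := dimFn_not_first_row_bound (hanti.strictAnti_of_injective hinj) hneg
          (hsum1 i.succ) (a := a) (c := c - 1) (by
            rw [haR]
            simp [(Fin.succ_ne_zero i).symm]) (by linarith) (by linarith)
        rw [show (a : ℝ) - (c - 1) + 1 = a - c + 2 by ring,
          show (a : ℝ) - (c - 1) + 2 = a - c + 3 by ring] at h
        exact h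
      · push Not at hneg
        obtain ⟨j, hj⟩ := hneg
        have hj2 : (b - Pi.single i.succ 1 - Pi.single 0 1 : Fin (K + 1) → ℤ) j < 0 := by
          refine lt_of_le_of_lt ?_ hj
          rw [Pi.sub_apply _ (Pi.single 0 1), Pi.single_apply]
          split_ifs <;> omega
        rw [dimFn_of_neg _ hj, dimFn_of_neg _ hj2]
        simp
    -- Equal coordinates can only be `i.succ` and a later one. Neither is `0`, so decrementing
    -- coordinate `0` keeps them equal and both terms vanish.
    · simp only [Function.Injective] at hinj
      push Not at hinj
      obtain ⟨x, y, hxy, hne⟩ := hinj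
      wlog hlt : x < y generalizing x y
      · exact this y x hxy.symm hne.symm (lt_of_le_of_ne (not_lt.mp hlt) hne.symm)
      have hx : x = i.succ := by
        by_contra hx
        have := hs hlt
        simp only [Pi.sub_apply, Pi.single_apply, if_neg hx] at hxy
        split_ifs at hxy <;> omega
      have hx0 : x ≠ 0 := hx ▸ Fin.succ_ne_zero i
      have hy0 : y ≠ 0 := ((Fin.zero_le x).trans_lt hlt).ne'
      rw [(alternating_dimFn (k + 1)).eq_zero hne hxy, (alternating_dimFn k).eq_zero hne]
      · simp
      · rw [Pi.sub_apply _ (Pi.single 0 1), Pi.sub_apply _ (Pi.single 0 1), hxy]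
        simp [hx0, hy0]
  have hR := restSum_one_eq k b
  set R := restSum 1 (dimFn (K + 1) k) b
  set S := ∑ i : Fin K, dimFn (K + 1) (k + 1) (b - Pi.single i.succ 1) with hS
  have h1 : (k + 1) * ((a : ℝ) - c + 2) * R ≤ (c - 1) * (a - c + 3) * S := by
    rw [hR, hS, Finset.mul_sum, Finset.mul_sum]
    exact Finset.sum_le_sum fun i _ => hi i
  have h2 : S = dimFn (K + 1) (k + 2) b - dimFn (K + 1) (k + 1) (b - Pi.single 0 1) := by
    have : dimFn (K + 1) (k + 2) b = dimFn (K + 1) (k + 1) (b - Pi.single 0 1) + S := by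
      rw [hS, dimFn, shiftSum, Fin.sum_univ_succ]
    linarith
  have h3 := dimFn_not_first_row_bound hs h0 (k := k + 1) (by rw [hb]) haR
    (by push_cast; linarith) hcaR
  rw [← h2] at h3
  push_cast at h3
  rw [show (k : ℝ) + 1 + 1 = k + 2 by ring] at h3
  -- For `c = 0` the factor `c - 1` is negative and the two inequalities cannot be multiplied.
  rcases Nat.eq_zero_or_pos c with rfl | hc
  · have hS0 : 0 ≤ S := Finset.sum_nonneg fun i _ =>
      dimFn_nonneg (antitone_sub_single hs i.succ) (hsum1 i.succ)
    push_cast at h1 h3 ⊢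
    have hA : (0 : ℝ) ≤ a := Nat.cast_nonneg a
    have h4 : R ≤ 0 := by
      by_contra h
      push Not at h
      have h5 : 0 < (k + 1) * ((a : ℝ) - 0 + 2) * R := by
        rw [sub_zero]
        positivity
      have h6 : 0 ≤ ((a : ℝ) - 0 + 3) * S := by
        rw [sub_zero]
        positivity
      nlinarith
    have h5 : 0 ≤ ((k : ℝ) + 2) * (k + 1) * (a - 0 + 1) := by
      rw [sub_zero]
      positivity
    nlinarith
  · have hc1 : (1 : ℝ) ≤ c := by exact_mod_cast hc
    have h4 : 0 ≤ ((c : ℝ) - 1) * (a - c + 3) := mul_nonneg (by linarith) (by linarith)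
    have h5 : 0 ≤ ((k : ℝ) + 2) * (a - c + 1) := mul_nonneg (by positivity) (by linarith)
    have h6 := mul_le_mul_of_nonneg_left h1 h5
    have h7 := mul_le_mul_of_nonneg_left h3 h4
    have h8 : (0 : ℝ) < a - c + 2 := by linarith
    refine le_of_mul_le_mul_left ?_ h8
    linarith

/-- The two boxes are removed one after the other; `hgap` keeps the exponents strictly decreasing in
between. Equality holds for `[a, c]`. -/
theorem dimFn_sub_two_bound {b : Fin (K + 1) → ℤ} (hs : StrictAnti b) (h0 : ∀ i, 0 ≤ b i)
    {k : ℕ} (hb : ∑ i, b i = (k + 2 : ℕ) + ∑ i : Fin (K + 1), (rho i : ℤ))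
    {a c : ℕ} (ha : b 0 = a + K) (hac : a + c = k + 2) (hca : c < a)
    (hgap : ∀ j : Fin K, b j.succ < b 0 - 1) :
    ((a : ℝ) - c - 1) * (a + 1) * a * dimFn (K + 1) (k + 2) b ≤
      (k + 2) * (k + 1) * ((a : ℝ) - c + 1) * dimFn (K + 1) k (b - Pi.single 0 2) := by
  have haR : (a : ℝ) = b 0 - K := by
    rw [ha]
    push_cast
    ring
  have hacR : (a : ℝ) + c = k + 2 := by exact_mod_cast hac
  have hcaR : (c : ℝ) + 1 ≤ a := by exact_mod_cast hca
  have hc0 : (0 : ℝ) ≤ c := Nat.cast_nonneg c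
  have h1 := dimFn_first_row_bound hs h0 (k := k + 1) (c := c) (by rw [hb]) haR
    (by push_cast; linarith) (by linarith)
  have hs' : StrictAnti (b - Pi.single 0 1) := by
    intro x y hxy
    have := hs hxy
    obtain ⟨y, rfl⟩ := Fin.exists_succ_eq.mpr ((Fin.zero_le x).trans_lt hxy).ne'
    have hy := hgap y
    simp only [Pi.sub_apply, Pi.single_apply, Fin.succ_ne_zero, if_false]
    split_ifs with h
    · subst h
      omega
    · omega
  have h0' : ∀ i, 0 ≤ (b - Pi.single 0 1 : Fin (K + 1) → ℤ) i := by
    intro i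
    have := h0 i
    simp only [Pi.sub_apply, Pi.single_apply]
    split_ifs with h
    · subst h
      omega
    · omega
  have h2 := dimFn_first_row_bound hs' h0' (k := k) (a := a - 1) (c := c) (by
    rw [sum_sub_single, hb]
    push_cast
    ring) (by rw [haR]; simp; ring) (by linarith) (by linarith)
  have e : b - Pi.single 0 1 - Pi.single 0 1 = (b - Pi.single 0 2 : Fin (K + 1) → ℤ) := by
    rw [single_two_eq, sub_sub]
  rw [e] at h2
  push_cast at h1
  have h3 : (0 : ℝ) ≤ (a - 1 - c) * (a - 1 + 1) := mul_nonneg (by linarith) (by linarith)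
  have h4 : (0 : ℝ) ≤ (k + 2) * (a - c + 1) := mul_nonneg (by positivity) (by linarith)
  have h5 := mul_le_mul_of_nonneg_left h1 h3
  have h6 := mul_le_mul_of_nonneg_left h2 h4
  refine le_of_mul_le_mul_left (a := (a : ℝ) - c) ?_ (by linarith)
  linarith

theorem twiceContent_shiftedZ (N : ℕ) (μ : YoungDiagram) :
    twiceContent (shiftedZ N μ) =
      ∑ i : Fin N, (μ.rowLen i : ℝ) * ((μ.rowLen i : ℝ) - 1 - 2 * (i : ℕ)) := by
  rw [twiceContent_eq]
  refine Finset.sum_congr rfl fun i _ => ?_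
  have : ((shiftedZ N μ i : ℤ) : ℝ) - rho i = μ.rowLen i := by
    simp [shiftedZ, shifted]
  rw [this]

/-- In row `i ≥ 1` the factor `μᵢ - 1 - 2i` is at most `l - 3`, with equality for a single lower row
of length `l`. -/
theorem twiceContent_le {μ : YoungDiagram} (hN : μ.colLen 0 ≤ K + 1) {l : ℕ}
    (hl : μ.rowLen 1 ≤ l) :
    twiceContent (shiftedZ (K + 1) μ) ≤
      (μ.rowLen 0 : ℝ) * (μ.rowLen 0 - 1) + (μ.card - μ.rowLen 0) * (l - 3) := by
  have h1 := sum_rowLen hN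
  rw [Fin.sum_univ_succ] at h1
  have h2 : (μ.card : ℝ) - μ.rowLen 0 = ∑ i : Fin K, (μ.rowLen (i.succ : Fin (K + 1)) : ℝ) := by
    rw [← h1]
    push_cast
    simp
  rw [twiceContent_shiftedZ, Fin.sum_univ_succ, h2, Finset.sum_mul]
  refine add_le_add (by simp) (Finset.sum_le_sum fun i _ => ?_)
  refine mul_le_mul_of_nonneg_left ?_ (Nat.cast_nonneg _)
  have h3 : μ.rowLen (i.succ : Fin (K + 1)) ≤ l :=
    (μ.rowLen_anti 1 _ (by simp)).trans hl
  have h3' : (μ.rowLen (i.succ : Fin (K + 1)) : ℝ) ≤ l := by exact_mod_cast h3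
  have h4 : (0 : ℝ) ≤ (i : ℕ) := Nat.cast_nonneg _
  rw [Fin.val_succ] at *
  push_cast
  linarith

end StepBounds

end InvolutionWalk

end

noncomputable section

open Finset

namespace InvolutionWalk

/-! ### The induction step. -/

section Induction

variable {K m : ℕ} {p : ℝ} {μ : YoungDiagram}

theorem rowLen_zero_add_rowLen_one_le (μ : YoungDiagram) : μ.rowLen 0 + μ.rowLen 1 ≤ μ.card := by
  have h := sum_rowLen (N := μ.colLen 0 + 2) (μ := μ) (by omega)
  rw [Fin.sum_univ_succ, Fin.sum_univ_succ] at h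
  simp only [Fin.val_zero, Fin.val_succ, zero_add] at h
  omega

theorem rowLen_zero_pos (h : 0 < μ.card) : 0 < μ.rowLen 0 := by
  by_contra h0
  have h1 := sum_rowLen (N := μ.colLen 0) (μ := μ) le_rfl
  rw [Finset.sum_eq_zero] at h1
  · omega
  · intro i _
    have := μ.rowLen_anti 0 i (Nat.zero_le _)
    omega

theorem shiftedZ_apply (μ : YoungDiagram) (i : Fin (K + 1)) :
    shiftedZ (K + 1) μ i = μ.rowLen i + (K - (i : ℕ)) := by
  have := rho_add_val i
  simp only [shiftedZ, shifted]
  push_cast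
  omega

theorem eigFn_le_of_eigenvalue_le {φ : ℕ → ℝ}
    (h : ∀ μ : YoungDiagram, μ.card = 2 * m → eigenvalue p μ ≤ φ (μ.rowLen 0))
    {b : Fin (K + 1) → ℤ} (hb : Antitone b)
    (hsum : ∑ i, b i = (2 * m : ℕ) + ∑ i : Fin (K + 1), (rho i : ℤ)) :
    eigFn (K + 1) p m b ≤ φ (b 0 - K).toNat * dimFn (K + 1) (2 * m) b := by
  by_cases hinj : Function.Injective b
  · have hs := hb.strictAnti_of_injective hinj
    by_cases h0 : ∀ i, 0 ≤ b i
    · obtain ⟨μ, hN, hμ⟩ := exists_shiftedZ_eq hs h0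
      have hcard : μ.card = 2 * m := by
        have h1 := sum_shiftedZ (μ := μ) rfl hN
        rw [hμ, hsum] at h1
        exact_mod_cast (add_right_cancel h1).symm
      have h1 := h μ hcard
      have hpos := dimFn_pos hs h0 hsum
      rw [eigenvalue_eq_div p μ hN hcard, hμ, div_le_iff₀ hpos] at h1
      have h2 := shiftedZ_apply (K := K) μ 0
      rw [hμ] at h2
      have h3 : (b 0 - K).toNat = μ.rowLen 0 := by
        simp at h2
        omega
      rw [h3]
      exact h1
    · push Not at h0
      obtain ⟨i, hi⟩ := h0
      rw [eigFn_of_neg p m hi, dimFn_of_neg _ hi, mul_zero]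
  · simp only [Function.Injective] at hinj
    push Not at hinj
    obtain ⟨i, j, h1, h2⟩ := hinj
    rw [(alternating_eigFn p m).eq_zero h2 h1, (alternating_dimFn _).eq_zero h2 h1, mul_zero]

/-- After the double decrement at `0`, coordinate `0` is still the largest unless the first two rows
are equal; in that case coordinate `1` takes over and the sorted first row is shorter by one only.
-/
theorem iSup_shiftedZ_sub (hN : μ.colLen 0 ≤ K + 1) (hpos : 0 < μ.rowLen 0) :
    ∃ x : ℕ, (x = μ.rowLen 0 - 1 ∨ x = μ.rowLen 0 - 2) ∧
      (μ.rowLen 1 < μ.rowLen 0 → x = μ.rowLen 0 - 2) ∧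
      ((⨆ i, (shiftedZ (K + 1) μ - Pi.single 0 2 : Fin (K + 1) → ℤ) i) - K).toNat = x := by
  have e0 : (shiftedZ (K + 1) μ - Pi.single 0 2 : Fin (K + 1) → ℤ) 0 = μ.rowLen 0 + K - 2 := by
    rw [Pi.sub_apply, shiftedZ_apply]
    simp
  have e1 : ∀ j : Fin K, (shiftedZ (K + 1) μ - Pi.single 0 2 : Fin (K + 1) → ℤ) j.succ ≤
      μ.rowLen 1 + K - 1 := by
    intro j
    have := μ.rowLen_anti 1 (j.succ : Fin (K + 1)) (by simp)
    rw [Pi.sub_apply, shiftedZ_apply, Pi.single_apply, if_neg (Fin.succ_ne_zero j)]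
    rw [Fin.val_succ] at *
    push_cast
    omega
  by_cases h : μ.rowLen 1 < μ.rowLen 0
  · refine ⟨μ.rowLen 0 - 2, Or.inr rfl, fun _ => rfl, ?_⟩
    rw [iSup_eq_of_forall_le 0 e0]
    · omega
    · intro j
      refine Fin.cases e0.le (fun j => ?_) j
      have := e1 j
      omega
  · refine ⟨μ.rowLen 0 - 1, Or.inl rfl, fun h' => absurd h' h, ?_⟩
    have h1 := μ.rowLen_anti 0 1 (by norm_num)
    have hK : 1 < K + 1 := by
      have : (1, 0) ∈ μ := YoungDiagram.mem_iff_lt_rowLen.mpr (by omega)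
      exact (YoungDiagram.mem_iff_lt_colLen.mp this).trans_le hN
    have e2 : (shiftedZ (K + 1) μ - Pi.single 0 2 : Fin (K + 1) → ℤ) ⟨1, hK⟩ =
        μ.rowLen 0 + K - 1 := by
      rw [Pi.sub_apply, shiftedZ_apply, Pi.single_apply, if_neg (by simp [Fin.ext_iff])]
      push_cast
      have : μ.rowLen 1 = μ.rowLen 0 := by omega
      rw [this]
      ring
    rw [iSup_eq_of_forall_le _ e2]
    · omega
    · intro j
      refine Fin.cases (by omega) (fun j => ?_) j
      have := e1 j
      omega

theorem eigFn_succ_shiftedZ_le (hp : 1 / 2 ≤ p) {φ : ℕ → ℝ}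
    (h : ∀ μ : YoungDiagram, μ.card = 2 * m → eigenvalue p μ ≤ φ (μ.rowLen 0))
    (hcard : μ.card = 2 * m + 2) (hN : μ.colLen 0 ≤ K + 1) :
    ∃ x : ℕ, (x = μ.rowLen 0 - 1 ∨ x = μ.rowLen 0 - 2) ∧
      (μ.rowLen 1 < μ.rowLen 0 → x = μ.rowLen 0 - 2) ∧
      eigFn (K + 1) p (m + 1) (shiftedZ (K + 1) μ) ≤
        φ x * dimFn (K + 1) (2 * m) (shiftedZ (K + 1) μ - Pi.single 0 2) +
        φ (μ.rowLen 0 - 1) *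
          (2 * p * mixedSum (dimFn (K + 1) (2 * m)) (shiftedZ (K + 1) μ)) +
        φ (μ.rowLen 0) * restSum p (dimFn (K + 1) (2 * m)) (shiftedZ (K + 1) μ) := by
  obtain ⟨x, hx1, hx2, hx3⟩ := iSup_shiftedZ_sub hN (rowLen_zero_pos (by omega))
  refine ⟨x, hx1, hx2, ?_⟩
  have hs := shiftedZ_strictAnti (K + 1) μ
  have h1 := eigFn_succ_le hp (K := K) (m := m) (φ := fun y => φ (y - K).toNat)
    (fun b hb hsum => eigFn_le_of_eigenvalue_le h hb hsum) hs.antitone (sum_shiftedZ hcard hN)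
  rw [stepOp_iSup_mul p (fun y => φ (y - K).toNat) _ hs rfl, hx3] at h1
  have h2 := shiftedZ_apply (K := K) μ 0
  have e1 : (shiftedZ (K + 1) μ 0 - K).toNat = μ.rowLen 0 := by
    simp at h2
    omega
  have e2 : (shiftedZ (K + 1) μ 0 - 1 - K).toNat = μ.rowLen 0 - 1 := by
    simp at h2
    omega
  rw [e1, e2] at h1
  exact h1

/-- The induction step for bounding the eigenvalues by those of the partitions with two rows. -/
theorem eigenvalue_le_psi_step (hp : 1 / 2 ≤ p) (hp1 : p ≤ 1)
    (h : ∀ μ : YoungDiagram, μ.card = 2 * m → eigenvalue p μ ≤ psi p m (μ.rowLen 0 - m))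
    (hcard : μ.card = 2 * (m + 1))
    (hmono : ∀ k, μ.rowLen 0 ≤ m + k + 2 → psi p m k ≤ psi p m (k + 1)) :
    eigenvalue p μ ≤ psi p (m + 1) (μ.rowLen 0 - (m + 1)) := by
  obtain ⟨K, hN⟩ : ∃ K, μ.colLen 0 ≤ K + 1 := ⟨μ.colLen 0, by omega⟩
  have hs := shiftedZ_strictAnti (K + 1) μ
  have h0 := shiftedZ_nonneg (K + 1) μ
  have hcard' : μ.card = 2 * m + 2 := by omega
  have hsum := sum_shiftedZ hcard' hN
  have hD := dimFn_pos hs h0 hsum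
  rw [eigenvalue_eq_div p μ hN hcard, div_le_iff₀ (by exact hD)]
  obtain ⟨x, hx1, hx2, hx3⟩ := eigFn_succ_shiftedZ_le (φ := fun y => psi p m (y - m)) hp h hcard' hN
  refine hx3.trans ?_
  have hT := stepOp_dimFn p (2 * m) (shiftedZ (K + 1) μ)
  rw [stepOp_split] at hT
  have hR := restSum_le_one hp1 hs hsum
  have hr01 := rowLen_zero_add_rowLen_one_le μ
  have hbz := shiftedZ_apply (K := K) μ 0
  simp only [Fin.val_zero, Nat.cast_zero, sub_zero] at hbz
  have hy0 := psi_nonneg hp m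
  change _ ≤ _ * dimFn (K + 1) (2 * m + 2) (shiftedZ (K + 1) μ)
  set A2 := dimFn (K + 1) (2 * m) (shiftedZ (K + 1) μ - Pi.single 0 2)
  set A1 := 2 * p * mixedSum (dimFn (K + 1) (2 * m)) (shiftedZ (K + 1) μ)
  set A0 := restSum p (dimFn (K + 1) (2 * m)) (shiftedZ (K + 1) μ)
  set D := dimFn (K + 1) (2 * m + 2) (shiftedZ (K + 1) μ) with hDdef
  push_cast at hT
  have hmR : (0 : ℝ) ≤ m := Nat.cast_nonneg m
  have hZ : (0 : ℝ) < (2 * m + 2) * (2 * m + 1) := by positivity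
  have hq : 0 ≤ 1 - p := by linarith
  -- In this case all indices of `psi` truncate to `0`, except that of `A0` when the first row is
  -- exactly `m + 1`.
  by_cases ha : μ.rowLen 0 ≤ m + 1
  · have h01 := hmono 0 (by omega)
    have hψ := psi_succ_zero p m
    have htc := twiceContent_le (l := μ.rowLen 0) hN (μ.rowLen_anti 0 1 (by norm_num))
    rw [hcard'] at htc
    -- The right side is twice the content sum of `[m + 1, m + 1]`.
    have htc2 : twiceContent (shiftedZ (K + 1) μ) ≤ 2 * (m + 1) * (m - 1) := by
      have : (μ.rowLen 0 : ℝ) ≤ m + 1 := by exact_mod_cast ha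
      push_cast at htc
      nlinarith
    have hTD : (2 * m + 2) * (2 * m + 1) * (A2 + A1 + A0) ≤
        (p * ((2 * m + 2) * (2 * m + 1)) + (1 - p) * (2 * (m + 1) * (m - 1))) * D := by
      rw [hT]
      exact mul_le_mul_of_nonneg_right (by nlinarith) hD.le
    have e1 : x - m = 0 := by omega
    have e2 : μ.rowLen 0 - 1 - m = 0 := by omega
    have e3 : μ.rowLen 0 - (m + 1) = 0 := by omega
    simp only [e1, e2, e3]
    rw [zero_add] at h01
    have h5 := mul_le_mul_of_nonneg_left hTD (hy0 0)
    refine le_of_mul_le_mul_left ?_ hZ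
    have hψD : (2 * m + 2) * (2 * m + 1) * (psi p (m + 1) 0 * D) =
      (3 * (m + 1) * m * psi p m 1 + (2 * p - 1) * (m + 1) * (m + 2) * psi p m 0) * D := by
      rw [← hψ]
      ring
    rw [hψD]
    rcases Nat.lt_or_ge (μ.rowLen 0) (m + 1) with ha' | ha'
    · have e4 : μ.rowLen 0 - m = 0 := by omega
      rw [e4]
      have h6 : 0 ≤ 3 * (m + 1) * m * (psi p m 1 - psi p m 0) * D :=
        mul_nonneg (mul_nonneg (by positivity) (by linarith)) hD.le
      linarith
    · have e4 : μ.rowLen 0 - m = 1 := by omega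
      have hr := restSum_bound (a := m + 1) (c := m + 1) hs h0 hsum (by
        rw [hbz]
        push_cast
        omega) (by omega) le_rfl
      rw [e4]
      push_cast at hr
      have h6 : (2 * m + 2) * (2 * m + 1) * A0 ≤ 3 * (m + 1) * m * D := by
        have := mul_le_mul_of_nonneg_left hR hZ.le
        linarith
      have h7 := mul_le_mul_of_nonneg_left h6 (sub_nonneg.mpr h01)
      linarith
  -- Now `A2`, `A1`, `A0` carry `psi` at `j`, `j + 1`, `j + 2`, and the comparison partition is `[m
  -- + j + 2, m - j]`.
  · obtain ⟨j, hj⟩ : ∃ j, μ.rowLen 0 = m + j + 2 := ⟨μ.rowLen 0 - m - 2, by omega⟩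
    have hjm : j ≤ m := by omega
    obtain ⟨c, rfl⟩ : ∃ c, m = j + c := ⟨m - j, by omega⟩
    have h10 := hmono j (by omega)
    have h21 := hmono (j + 1) (by omega)
    have hψ := psi_succ_succ p hjm
    have e1 : x - (j + c) = j := by omega
    have e2 : μ.rowLen 0 - 1 - (j + c) = j + 1 := by omega
    have e3 : μ.rowLen 0 - (j + c + 1) = j + 1 := by omega
    have e4 : μ.rowLen 0 - (j + c) = j + 2 := by omega
    simp only [e1, e2, e3, e4]
    have htc := twiceContent_le (l := c) hN (by omega)
    rw [hcard', hj] at htc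
    have hba : shiftedZ (K + 1) μ 0 = ((2 * j + c + 2 : ℕ) : ℤ) + K := by
      rw [hbz, hj]
      push_cast
      ring
    have hr := restSum_bound (a := 2 * j + c + 2) (c := c) hs h0 hsum hba (by omega) (by omega)
    have h2 := dimFn_sub_two_bound (a := 2 * j + c + 2) (c := c) hs h0 hsum hba (by omega)
      (by omega) (by
        intro i
        have := μ.rowLen_anti 1 (i.succ : Fin (K + 1)) (by simp)
        rw [hba, shiftedZ_apply]
        rw [Fin.val_succ] at *
        push_cast
        omega)
    push_cast at hr h2 hT htc hψ hZ
    have hTD : (2 * (j + c) + 2) * (2 * (j + c) + 1) * (A2 + A1 + A0) ≤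
        (p * ((2 * (j + c) + 2) * (2 * (j + c) + 1)) + (1 - p) *
          ((j + c + j + 2) * (j + c + j + 2 - 1) +
            (2 * (j + c) + 2 - (j + c + j + 2)) * (c - 3))) * D := by
      rw [hT]
      refine mul_le_mul_of_nonneg_right ?_ hD.le
      have := mul_le_mul_of_nonneg_left htc hq
      linarith
    have hjR : (0 : ℝ) ≤ j := Nat.cast_nonneg j
    have hW : (0 : ℝ) < (2 * (j + c) + 2) * (2 * (j + c) + 1) * (2 * j + 3) := by positivity
    refine le_of_mul_le_mul_left ?_ hW
    have hψD : (2 * ((j : ℝ) + c) + 2) * (2 * (j + c) + 1) * (2 * j + 3) *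
        (psi p (j + c + 1) (j + 1) * D) =
        ((2 * ((j : ℝ) + c) + 2) * (2 * (j + c) + 1) * (2 * j + 3) *
        psi p (j + c + 1) (j + 1)) * D := by ring
    rw [hψD, hψ]
    have t1 : (2 * ((j : ℝ) + c) + 2) * (2 * (j + c) + 1) * (2 * j + 3) * A0 ≤
        c * (c - 1) * (2 * j + 5) * D := by
      have := mul_le_mul_of_nonneg_left hR hW.le
      linarith
    -- Summation by parts: `ψ_j A₂ + ψ_{j+1} A₁ + ψ_{j+2} A₀` equals `ψ_{j+1} (A₂ + A₁ + A₀) +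
    -- (ψ_{j+2} - ψ_{j+1}) A₀ - (ψ_{j+1} - ψ_j) A₂`.
    have t2 := mul_le_mul_of_nonneg_left t1 (sub_nonneg.mpr h21)
    have t3 := mul_le_mul_of_nonneg_left h2 (sub_nonneg.mpr h10)
    have t4 := mul_le_mul_of_nonneg_left hTD
      (mul_nonneg (hy0 (j + 1)) (by positivity : (0 : ℝ) ≤ 2 * j + 3))
    rw [show j + 1 + 1 = j + 2 by ring] at t2
    linarith

end Induction

end InvolutionWalk

end

noncomputable section

open Finset

namespace InvolutionWalk

/-! ### The exceptional partitions of six and the final comparison. -/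

section Comparison

variable {p : ℝ} {μ : YoungDiagram}

theorem colLen_zero_le_card (μ : YoungDiagram) : μ.colLen 0 ≤ μ.card := by
  rw [YoungDiagram.colLen_eq_card]
  exact Finset.card_le_card (Finset.filter_subset _ _)

theorem colLen_zero_le_of_rowLen_eq_zero {k : ℕ} (h : μ.rowLen k = 0) : μ.colLen 0 ≤ k := by
  by_contra hk
  push Not at hk
  rw [← YoungDiagram.mem_iff_lt_colLen, YoungDiagram.mem_iff_lt_rowLen] at hk
  omega

theorem shiftedZ_three (μ : YoungDiagram) :
    shiftedZ 3 μ = ![(μ.rowLen 0 : ℤ) + 2, (μ.rowLen 1 : ℤ) + 1, (μ.rowLen 2 : ℤ)] := by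
  ext i
  fin_cases i <;> simp [shiftedZ, shifted, rho]

/-- With `psi p 2 1 ≤ psi p 2 0` and a first row of at most `3`, all three weights may be replaced
by `psi p 2 0`, so only the content sum matters. The bound `-6` is attained by `[2, 2, 2]` and `[3,
1, 1, 1]`. -/
theorem eigenvalue_le_psi_three_of_content (hp : 1 / 2 ≤ p) (hp1 : p ≤ 1)
    (h : ∀ μ : YoungDiagram, μ.card = 2 * 2 → eigenvalue p μ ≤ psi p 2 (μ.rowLen 0 - 2))
    (hcard : μ.card = 6) (h10 : psi p 2 1 ≤ psi p 2 0) (h3 : μ.rowLen 0 ≤ 3)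
    (htc : twiceContent (shiftedZ 6 μ) ≤ -6) : eigenvalue p μ ≤ psi p 3 0 := by
  have hN : μ.colLen 0 ≤ 5 + 1 := (colLen_zero_le_card μ).trans hcard.le
  have hφ : ∀ x : ℕ, psi p 2 (x - 2) ≤ if x ≤ 3 then psi p 2 0 else 1 := by
    intro x
    split_ifs with hx
    · rcases Nat.lt_or_ge x 3 with h' | h'
      · rw [show x - 2 = 0 by omega]
      · rw [show x - 2 = 1 by omega]
        exact h10
    · rw [psi_of_le p 2 _ (by omega)]
  obtain ⟨x, hx1, -, hx⟩ := eigFn_succ_shiftedZ_le (m := 2) hp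
    (φ := fun x => if x ≤ 3 then psi p 2 0 else 1) (fun μ hμ => (h μ hμ).trans (hφ _)) hcard hN
  have hx3 : x ≤ 3 := by omega
  have hx4 : μ.rowLen 0 - 1 ≤ 3 := by omega
  simp only [if_pos hx3, if_pos hx4, if_pos h3] at hx
  have hT := stepOp_dimFn p (2 * 2) (shiftedZ 6 μ)
  rw [stepOp_split] at hT
  have hD := dimFn_pos (shiftedZ_strictAnti 6 μ) (shiftedZ_nonneg 6 μ) (sum_shiftedZ hcard hN)
  rw [eigenvalue_eq_div p μ hN (m := 3) hcard, div_le_iff₀ (by exact hD)]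
  refine hx.trans ?_
  change psi p 2 0 * dimFn 6 4 (shiftedZ 6 μ - Pi.single 0 2) +
    psi p 2 0 * (2 * p * mixedSum (dimFn 6 4) (shiftedZ 6 μ)) +
    psi p 2 0 * restSum p (dimFn 6 4) (shiftedZ 6 μ) ≤ _ * dimFn 6 6 (shiftedZ 6 μ)
  change _ = _ * dimFn 6 6 (shiftedZ 6 μ) at hT
  have h0 := psi_nonneg hp 2 0
  push_cast at hT
  have h1 : (30 * p - 6 * (1 - p)) * psi p 2 0 ≤ 30 * psi p 3 0 := by
    norm_num [psi]
    nlinarith [mul_nonneg (by linarith : (0 : ℝ) ≤ 1 - p) (by linarith : (0 : ℝ) ≤ 2 * p - 1),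
      mul_nonneg (mul_nonneg (by linarith : (0 : ℝ) ≤ 1 - p)
        (by linarith : (0 : ℝ) ≤ 2 * p - 1)) (by linarith : (0 : ℝ) ≤ 2 * p - 1)]
  have h2 := mul_le_mul_of_nonneg_right h1 hD.le
  have h4 : 0 ≤ (1 - p) * (-6 - twiceContent (shiftedZ 6 μ)) * dimFn 6 6 (shiftedZ 6 μ) *
      psi p 2 0 :=
    mul_nonneg (mul_nonneg (mul_nonneg (by linarith) (by linarith)) hD.le) h0
  linear_combination (1 / 30) * (h2 + h4 + psi p 2 0 * hT)

/-- Two-row partitions give equality, `[4, 1, 1]` and `[3, 2, 1]` are computed exactly, and `[2, 2,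
2]` and the partitions with at least four rows have small enough content. -/
theorem eigenvalue_le_psi_three (hp : 1 / 2 ≤ p) (hp1 : p ≤ 1)
    (h : ∀ μ : YoungDiagram, μ.card = 2 * 2 → eigenvalue p μ ≤ psi p 2 (μ.rowLen 0 - 2))
    (hcard : μ.card = 6) (h10 : psi p 2 1 ≤ psi p 2 0) (h4 : μ.rowLen 0 ≤ 4) :
    eigenvalue p μ ≤ psi p 3 (μ.rowLen 0 - 3) := by
  have hN : μ.colLen 0 ≤ 6 := (colLen_zero_le_card μ).trans hcard.le
  by_cases h2 : μ.rowLen 2 = 0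
  · exact (eigenvalue_of_colLen_le_two p (colLen_zero_le_of_rowLen_eq_zero h2) hcard).le
  have hsum := sum_rowLen hN
  have htc := twiceContent_shiftedZ 6 μ
  rw [Fin.sum_univ_six] at hsum htc
  have a1 := μ.rowLen_anti 0 1 (by norm_num)
  have a2 := μ.rowLen_anti 1 2 (by norm_num)
  have a3 := μ.rowLen_anti 2 3 (by norm_num)
  have a4 := μ.rowLen_anti 3 4 (by norm_num)
  have a5 := μ.rowLen_anti 4 5 (by norm_num)
  norm_num [hcard] at hsum htc
  by_cases h3 : μ.rowLen 3 = 0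
  · have hN3 := colLen_zero_le_of_rowLen_eq_zero h3
    have hcases : (μ.rowLen 0 = 4 ∧ μ.rowLen 1 = 1 ∧ μ.rowLen 2 = 1) ∨
        (μ.rowLen 0 = 3 ∧ μ.rowLen 1 = 2 ∧ μ.rowLen 2 = 1) ∨
        (μ.rowLen 0 = 2 ∧ μ.rowLen 1 = 2 ∧ μ.rowLen 2 = 2) := by omega
    rcases hcases with ⟨e0, e1, e2⟩ | ⟨e0, e1, e2⟩ | ⟨e0, e1, e2⟩
    · rw [eigenvalue_eq_div p μ hN3 (m := 3) hcard, shiftedZ_three, e0, e1, e2]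
      norm_num
      rw [(eigFn_three_three p).2, dimFn_three_six.2]
      norm_num [psi]
      nlinarith
    · rw [eigenvalue_eq_div p μ hN3 (m := 3) hcard, shiftedZ_three, e0, e1, e2]
      norm_num
      rw [(eigFn_three_three p).1, dimFn_three_six.1]
      norm_num [psi]
      nlinarith [mul_nonneg (by linarith : (0 : ℝ) ≤ 1 - p) (by linarith : (0 : ℝ) ≤ 2 * p - 1),
        mul_nonneg (mul_nonneg (by linarith : (0 : ℝ) ≤ 1 - p)
        (by linarith : (0 : ℝ) ≤ 2 * p - 1)) (by linarith : (0 : ℝ) ≤ 2 * p - 1)]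
    · rw [show μ.rowLen 0 - 3 = 0 by omega]
      refine eigenvalue_le_psi_three_of_content hp hp1 h hcard h10 (by omega) ?_
      have e3 : μ.rowLen 4 = 0 := by omega
      have e4 : μ.rowLen 5 = 0 := by omega
      rw [htc, e0, e1, e2, h3, e3, e4]
      norm_num
  · rw [show μ.rowLen 0 - 3 = 0 by omega]
    refine eigenvalue_le_psi_three_of_content hp hp1 h hcard h10 (by omega) ?_
    rw [htc]
    generalize μ.rowLen 0 = r0 at *
    generalize μ.rowLen 1 = r1 at *
    generalize μ.rowLen 2 = r2 at *
    generalize μ.rowLen 3 = r3 at *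
    generalize μ.rowLen 4 = r4 at *
    generalize μ.rowLen 5 = r5 at *
    obtain rfl : r3 = 1 := by omega
    have e4 : r4 ≤ 1 := by omega
    interval_cases r4
    · obtain rfl : r5 = 0 := by omega
      obtain rfl : r2 = 1 := by omega
      have e1 : r1 = 1 ∨ r1 = 2 := by omega
      rcases e1 with rfl | rfl
      · obtain rfl : r0 = 3 := by omega
        norm_num
      · obtain rfl : r0 = 2 := by omega
        norm_num
    · obtain rfl : r2 = 1 := by omega
      obtain rfl : r1 = 1 := by omega
      have e5 : r5 = 0 ∨ r5 = 1 := by omega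
      rcases e5 with rfl | rfl
      · obtain rfl : r0 = 2 := by omega
        norm_num
      · obtain rfl : r0 = 1 := by omega
        norm_num

/-- Every eigenvalue is at most that of the partition with two rows and the same first row, where
the first row is taken to be at least half of the number of cells. -/
theorem eigenvalue_le_psi (hp : 1 / 2 ≤ p) (hp1 : p ≤ 1) (m : ℕ) :
    ∀ μ : YoungDiagram, μ.card = 2 * m → eigenvalue p μ ≤ psi p m (μ.rowLen 0 - m) := by
  induction m with
  | zero =>
    intro μ hμ
    rw [eigenvalue_eq_div p μ le_rfl hμ, psi]
    exact div_self_le_one _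
  | succ m ih =>
    intro μ hμ
    -- The one inequality that may fail, `psi p 2 0 ≤ psi p 2 1`, is required by the induction step
    -- only when the first row has at most `4` boxes.
    by_cases hm : m = 2 ∧ psi p 2 1 ≤ psi p 2 0 ∧ μ.rowLen 0 ≤ 4
    · obtain ⟨rfl, h10, h4⟩ := hm
      exact eigenvalue_le_psi_three hp hp1 ih hμ h10 h4
    · refine eigenvalue_le_psi_step hp hp1 ih hμ fun k hk => ?_
      by_cases hmk : m = 2 → 1 ≤ k
      · exact psi_le_psi_succ hp hp1 m k hmk
      · push Not at hmk
        obtain ⟨rfl, hk1⟩ := hmk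
        obtain rfl : k = 0 := by omega
        by_contra hlt
        exact hm ⟨rfl, (not_le.mp hlt).le, hk⟩

end Comparison

end InvolutionWalk

end

theorem mainTheorem4 (p : ℝ) (hp : 1 / 2 ≤ p) (hp1 : p ≤ 1) (n : ℕ) (hn : Even n)
    (μ : YoungDiagram) (hμ : μ.card = n) (hcol : μ.colLen 0 ≤ μ.rowLen 0)
    (hrow : (μ.rowLen 0 : ℝ) < (n : ℝ) / 2) :
    InvolutionWalk.eigenvalue p μ ≤ InvolutionWalk.eigenvalue p (InvolutionWalk.twoRows (n / 2)) := by
  obtain ⟨m, rfl⟩ := hn.two_dvd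
  have h := InvolutionWalk.eigenvalue_le_psi hp hp1 m μ hμ
  have h1 : μ.rowLen 0 < m := by
    push_cast at hrow
    exact_mod_cast (by linarith : (μ.rowLen 0 : ℝ) < m)
  rw [Nat.mul_div_cancel_left m two_pos, InvolutionWalk.eigenvalue_twoRows]
  -- The truncated difference `μ₁ - m` is `0`, which is the index of `[m, m]`.
  rwa [Nat.sub_eq_zero_of_le h1.le] at h
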